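/- Let $r\ge 1$ and $N\ge 0$. Let $Cl_r$ be the real Clifford algebra generated by $e_1,\dots,e_r$ with $e_ie_j+e_je_i=-2\delta_{ij}$, let $Cl_r^0$ be its even subalgebra, $\mathrm{vol}_r=e_1\cdots e_r$, and $\mathfrak{spin}(r)=\mathrm{span}\{e_ie_j : i<j\}\subset Cl_r^0$. Let $k=\lfloor r/2\rfloor$ and let $\Delta_r=(\mathbb{C}^2)^{\otimes k}$ be the space of complex spinors, on which $Cl_r$ acts as follows: with $$g_1=\begin{pmatrix} i&0\\0&-i\end{pmatrix},\quad g_2=\begin{pmatrix}0&i\\i&0\end{pmatrix},\quad T=\begin{pmatrix}0&-i\\i&0\end{pmatrix},$$ for $1\le j\le k$ the generators $e_{2j-1}$, $e_{2j}$ act by $\mathrm{Id}^{\otimes(k-j)}\otimes g_1\otimes T^{\otimes(j-1)}$ and $\mathrm{Id}^{\otimes(k-j)}\otimes g_2\otimes T^{\otimes(j-1)}$ respectively, and, if $r=2k+1$, $e_r$ acts by $i\,T^{\otimes k}$. For even $r$ let $\Delta_r^{\pm}$ be the $\pm1$-eigenspace of $\psi\mapsto(-i)^{r/2}\,\mathrm{vol}_r\cdot\psi$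 on $\Delta_r$; it is invariant under $Cl_r^0$. Let $d_r=2^{r/2-1}$ if $r\equiv 0$, $d_r=2^{k+1}$ if $r\equiv 3,5$, and $d_r=2^{k}$ otherwise (all congruences are mod $8$). Let $\Phi$ be a real representation of the algebra $Cl_r^0$ on $\mathbb{R}^N$ without trivial summands (no nonzero direct summand on which $Cl_r^0$ acts by zero). **Theorem.** There is an inner product on $\mathbb{R}^N$ for which all $\Phi(e_ie_j)$, $i<j$, are skew-symmetric. For every such inner product, let $\mathcal{C}$ be the centralizer of $\Phi(\mathfrak{spin}(r))$ in the Lie algebra $\mathfrak{so}(N)$ of skew-symmetric endomorphisms of $\mathbb{R}^N$. Then: * If $r\not\equiv 0,4$, there is $m\ge 0$ such that $\mathbb{R}^N\cong\mathbb{R}^m\otimes\tilde\Delta_r$ as a representation of $Cl_r^0$, where $\tilde\Delta_r$ is an irreducible real representation of $Cl_r^0$ of dimension $d_r$. * If $r\equiv 0,4$, there are $m_1,m_2\ge 0$ such that $\mathbb{R}^N\cong\mathbb{R}^{m_1}\otimes\tilde\Delta_r^+\oplus\mathbb{R}^{m_2}\otimes\tilde\Delta_r^-$, where $\tilde\Delta_r^{\pm}$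 are irreducible real representations of $Cl_r^0$ of dimension $d_r$ on which $\mathrm{vol}_r$ acts as $\pm\mathrm{Id}$. For these $m$, $m_1,m_2$ there are an isomorphism of real Lie algebras $$\mathcal{C}\cong\begin{cases}\mathfrak{so}(m_1)\oplus\mathfrak{so}(m_2)& r\equiv 0,\\ \mathfrak{so}(m)& r\equiv 1,7,\\ \mathfrak{u}(m)& r\equiv 2,6,\\ \mathfrak{sp}(m)& r\equiv 3,5,\\ \mathfrak{sp}(m_1)\oplus\mathfrak{sp}(m_2)& r\equiv 4,\end{cases}$$ which for $r\equiv 2,6$ sends $\Phi(\mathrm{vol}_r)\in\mathcal{C}$ to $i\,\mathrm{Id}_m$, and a complex linear isomorphism $$\mathbb{R}^N\otimes\mathbb{C}\;\cong\;\begin{cases}\mathbb{C}^{m_1}\otimes\Delta_r^+\oplus\mathbb{C}^{m_2}\otimes\Delta_r^-& r\equiv 0,\\ \mathbb{C}^m\otimes\Delta_r& r\equiv 1,7,\\ \mathbb{C}^m\otimes\Delta_r^+\oplus\overline{\mathbb{C}^m}\otimes\Delta_r^-& r\equiv 2,\\ \overline{\mathbb{C}^m}\otimes\Delta_r^+\oplus\mathbb{C}^m\otimes\Delta_r^-&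 r\equiv 6,\\ \mathbb{C}^{2m}\otimes\Delta_r& r\equiv 3,5,\\ \mathbb{C}^{2m_2}\otimes\Delta_r^+\oplus\mathbb{C}^{2m_1}\otimes\Delta_r^-& r\equiv 4,\end{cases}$$ which is equivariant both for $Cl_r^0$, acting on the second tensor factors, and for $\mathcal{C}$, acting on the first tensor factors through the isomorphism above. Here $\mathbb{C}^s$ is the standard complex representation of $\mathfrak{so}(s)$, $\mathfrak{u}(s)$ or $\mathfrak{sp}(s/2)$ respectively (for a direct sum of two algebras, that of the summand with the same index), $\overline{\mathbb{C}^m}$ is the conjugate of the standard representation of $\mathfrak{u}(m)$, and $\mathfrak{sp}(m)=\mathfrak{u}(2m)\cap\mathfrak{sp}(2m,\mathbb{C})$ is the compact symplectic Lie algebra. -/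

import Mathlib

open scoped TensorProduct Matrix

attribute [local instance 100] LieRing.ofAssociativeRing

noncomputable section

namespace EvenClifford

/-! ### Clifford algebra of the negative definite form on `ℝ^r`, with `e_i * e_i = -1` -/

/-- The form `v ↦ -(v_1^2 + ⋯ + v_r^2)`. -/
def negForm (r : ℕ) : QuadraticForm ℝ (Fin r → ℝ) :=
  QuadraticMap.weightedSumSquares ℝ (fun _ : Fin r => (-1 : ℝ))

/-- The real Clifford algebra `Cl_r`. -/
abbrev Cl (r : ℕ) : Type := CliffordAlgebra (negForm r)

/-- The even Clifford algebra `Cl_r^0`, a unital subalgebra of `Cl_r`. -/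
abbrev Cl0 (r : ℕ) : Subalgebra ℝ (Cl r) := CliffordAlgebra.even (negForm r)

/-- The standard generators `e_1, …, e_r` of `Cl_r`. -/
def gen (r : ℕ) (i : Fin r) : Cl r := CliffordAlgebra.ι (negForm r) (Pi.single i 1)

/-- The bivector `e_i e_j`, as an element of `Cl_r^0`. -/
def bivector (r : ℕ) (i j : Fin r) : Cl0 r :=
  ⟨gen r i * gen r j, CliffordAlgebra.ι_mul_ι_mem_evenOdd_zero _ _ _⟩

/-- The volume element `e_1 e_2 ⋯ e_r`. -/
def vol (r : ℕ) : Cl r := (List.ofFn (gen r)).prod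

/-- `spin(r) = span {e_i e_j | i < j}`. -/
def spinAlg (r : ℕ) : Submodule ℝ (Cl0 r) :=
  Submodule.span ℝ {x | ∃ i j : Fin r, i < j ∧ x = bivector r i j}

theorem vol_mem {r : ℕ} (hr : Even r) : vol r ∈ Cl0 r := by
  have h := SetLike.list_prod_ofFn_mem_graded (A := CliffordAlgebra.evenOdd (negForm r))
    (fun _ : Fin r => (1 : ZMod 2)) (gen r)
    (fun j => CliffordAlgebra.ι_mem_evenOdd_one _ _)
  have h0 : (List.ofFn (fun _ : Fin r => (1 : ZMod 2))).sum = 0 := by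
    rw [List.sum_ofFn]
    simpa using (ZMod.natCast_eq_zero_iff_even).2 hr
  rw [h0] at h
  exact h

/-- The volume element as an element of `Cl_r^0`, for even `r`. -/
def volEven {r : ℕ} (hr : Even r) : Cl0 r := ⟨vol r, vol_mem hr⟩

/-! ### Complex spinors -/

/-- `Δ_r = ℂ² ⊗ ⋯ ⊗ ℂ²` with `⌊r/2⌋` factors, written in the basis of elementary tensors of the
standard basis of `ℂ²`. Index `p` is the `p`-th factor counted from the right, from `0`. -/
abbrev Spinor (r : ℕ) : Type := (Fin (r / 2) → Fin 2) → ℂ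

/-- The matrix of the tensor product of the `2 × 2` matrices `M p`. -/
def tensorMatrix {k : ℕ} (M : Fin k → Matrix (Fin 2) (Fin 2) ℂ) :
    Matrix (Fin k → Fin 2) (Fin k → Fin 2) ℂ :=
  Matrix.of fun a b => ∏ p, M p (a p) (b p)

def g₁ : Matrix (Fin 2) (Fin 2) ℂ := !![Complex.I, 0; 0, -Complex.I]
def g₂ : Matrix (Fin 2) (Fin 2) ℂ := !![0, Complex.I; Complex.I, 0]
def matT : Matrix (Fin 2) (Fin 2) ℂ := !![0, -Complex.I; Complex.I, 0]

/-- The `p`-th factor from the right of the matrix of `e_{i+1}`. -/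
def gammaFactor (i p : ℕ) : Matrix (Fin 2) (Fin 2) ℂ :=
  if p < i / 2 then matT else if p = i / 2 then (if i % 2 = 0 then g₁ else g₂) else 1

/-- The matrix by which `e_{i+1}` acts on `Δ_r`: for `j ≤ ⌊r/2⌋`,
`e_{2j-1} ↦ 1 ⊗ ⋯ ⊗ 1 ⊗ g₁ ⊗ T ⊗ ⋯ ⊗ T` and `e_{2j} ↦ 1 ⊗ ⋯ ⊗ 1 ⊗ g₂ ⊗ T ⊗ ⋯ ⊗ T` with `j - 1`
factors `T`, and for odd `r` the last generator acts by `i T ⊗ ⋯ ⊗ T`. -/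
def gamma (r : ℕ) (i : Fin r) : Matrix (Fin (r / 2) → Fin 2) (Fin (r / 2) → Fin 2) ℂ :=
  (if (i : ℕ) < 2 * (r / 2) then (1 : ℂ) else Complex.I) •
    tensorMatrix (fun p : Fin (r / 2) => gammaFactor i p)

theorem tensorMatrix_mul {k : ℕ} (M M' : Fin k → Matrix (Fin 2) (Fin 2) ℂ) :
    tensorMatrix M * tensorMatrix M' = tensorMatrix (fun p => M p * M' p) := by
  ext a b
  simp only [tensorMatrix, Matrix.mul_apply, Matrix.of_apply, ← Finset.prod_mul_distrib]
  rw [Finset.prod_univ_sum]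
  simp [Fintype.piFinset_univ]

theorem tensorMatrix_one {k : ℕ} :
    tensorMatrix (fun _ : Fin k => (1 : Matrix (Fin 2) (Fin 2) ℂ)) = 1 := by
  ext a b
  simp only [tensorMatrix, Matrix.of_apply, Matrix.one_apply]
  by_cases h : a = b
  · simp [h]
  · obtain ⟨p, hp⟩ := Function.ne_iff.1 h
    rw [if_neg h]
    exact Finset.prod_eq_zero (Finset.mem_univ p) (by simp [hp])

theorem tensorMatrix_neg {k : ℕ} (M M' : Fin k → Matrix (Fin 2) (Fin 2) ℂ) (q : Fin k)
    (hq : M q = - M' q) (h : ∀ p, p ≠ q → M p = M' p) : tensorMatrix M = - tensorMatrix M' := by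
  ext a b
  simp only [tensorMatrix, Matrix.of_apply, Matrix.neg_apply]
  rw [← Finset.mul_prod_erase _ _ (Finset.mem_univ q),
    ← Finset.mul_prod_erase _ _ (Finset.mem_univ q), hq]
  rw [Finset.prod_congr rfl (fun p hp => by rw [h p (Finset.ne_of_mem_erase hp)])]
  simp

theorem matT_sq : matT * matT = 1 := by
  ext i j; fin_cases i <;> fin_cases j <;> simp [matT, Matrix.mul_apply, Fin.sum_univ_two]
theorem g₁_sq : g₁ * g₁ = -1 := by
  ext i j; fin_cases i <;> fin_cases j <;> simp [g₁, Matrix.mul_apply, Fin.sum_univ_two]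
theorem g₂_sq : g₂ * g₂ = -1 := by
  ext i j; fin_cases i <;> fin_cases j <;> simp [g₂, Matrix.mul_apply, Fin.sum_univ_two]
theorem g₁_g₂ : g₁ * g₂ = -(g₂ * g₁) := by
  ext i j; fin_cases i <;> fin_cases j <;> simp [g₁, g₂, Matrix.mul_apply, Fin.sum_univ_two]
theorem g₁_T : g₁ * matT = -(matT * g₁) := by
  ext i j; fin_cases i <;> fin_cases j <;> simp [g₁, matT, Matrix.mul_apply, Fin.sum_univ_two]
theorem g₂_T : g₂ * matT = -(matT * g₂) := by
  ext i j; fin_cases i <;> fin_cases j <;> simp [g₂, matT, Matrix.mul_apply, Fin.sum_univ_two]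

theorem gamma_sq (r : ℕ) (i : Fin r) : gamma r i * gamma r i = -1 := by
  have hi := i.2
  unfold gamma
  rw [smul_mul_smul_comm, tensorMatrix_mul]
  by_cases h : (i : ℕ) < 2 * (r / 2)
  · rw [tensorMatrix_neg _ (fun _ => 1) (⟨(i : ℕ) / 2, by omega⟩ : Fin (r / 2)),
      tensorMatrix_one]
    · simp [h]
    · simp only [gammaFactor, lt_irrefl, if_false, if_true]
      split_ifs <;> simp [g₁_sq, g₂_sq]
    · intro p hp
      have hp' : (p : ℕ) ≠ (i : ℕ) / 2 := fun e => hp (Fin.ext e)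
      simp only [gammaFactor, if_neg hp']
      split_ifs <;> simp [matT_sq]
  · have : (fun p : Fin (r / 2) => gammaFactor i p * gammaFactor i p) = fun _ => 1 := by
      funext p
      have := p.2
      rw [gammaFactor, if_pos (by omega), matT_sq]
    rw [this, tensorMatrix_one]
    simp [h]

theorem gamma_anticomm_lt (r : ℕ) {i j : Fin r} (hij : i < j) :
    gamma r i * gamma r j = -(gamma r j * gamma r i) := by
  have hi := i.2
  have hj := j.2
  have hij' : (i : ℕ) < j := hij
  unfold gamma
  rw [smul_mul_smul_comm, smul_mul_smul_comm, tensorMatrix_mul, tensorMatrix_mul, mul_comm,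
    tensorMatrix_neg _ _ (⟨(i : ℕ) / 2, by omega⟩ : Fin (r / 2)), smul_neg]
  · by_cases h : (i : ℕ) / 2 = (j : ℕ) / 2
    · have h1 : (i : ℕ) % 2 = 0 := by omega
      have h2 : (j : ℕ) % 2 ≠ 0 := by omega
      simp only [gammaFactor, h, lt_irrefl, if_false, if_true, if_pos h1, if_neg h2]
      exact g₁_g₂
    · have h1 : (i : ℕ) / 2 < (j : ℕ) / 2 := by omega
      simp only [gammaFactor, h1, lt_irrefl, if_false, if_true]
      split_ifs
      · exact g₁_T
      · exact g₂_T
  · intro p hp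
    have hp' : (p : ℕ) ≠ (i : ℕ) / 2 := fun e => hp (Fin.ext e)
    rcases lt_or_gt_of_ne hp' with h | h
    · have h1 : (p : ℕ) < (j : ℕ) / 2 := by omega
      simp only [gammaFactor, if_pos h, if_pos h1]
    · simp only [gammaFactor, if_neg hp', if_neg (not_lt.2 h.le), one_mul, mul_one]

theorem gamma_anticomm (r : ℕ) {i j : Fin r} (hij : i ≠ j) :
    gamma r i * gamma r j = -(gamma r j * gamma r i) := by
  rcases lt_or_gt_of_ne hij with h | h
  · exact gamma_anticomm_lt r h
  · rw [gamma_anticomm_lt r h, neg_neg]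

/-- Clifford multiplication by vectors on `Δ_r`. -/
def gammaMap (r : ℕ) :
    (Fin r → ℝ) →ₗ[ℝ] Matrix (Fin (r / 2) → Fin 2) (Fin (r / 2) → Fin 2) ℂ :=
  Fintype.linearCombination ℝ (gamma r)

theorem gammaMap_sq (r : ℕ) (v : Fin r → ℝ) :
    gammaMap r v * gammaMap r v = algebraMap ℝ _ (negForm r v) := by
  have h1 : gammaMap r v * gammaMap r v
      = ∑ i, ∑ j, (v i * v j) • (gamma r i * gamma r j) := by
    simp only [gammaMap, Fintype.linearCombination_apply, Finset.sum_mul_sum, smul_mul_smul_comm]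
  have h2 : gammaMap r v * gammaMap r v
      = ∑ i, ∑ j, (v i * v j) • (gamma r j * gamma r i) := by
    rw [h1, Finset.sum_comm]
    simp only [mul_comm]
  have h3 : (2 : ℝ) • (gammaMap r v * gammaMap r v)
      = (2 : ℝ) • algebraMap ℝ _ (negForm r v) := by
    rw [two_smul]
    nth_rewrite 1 [h1]
    rw [h2, ← Finset.sum_add_distrib]
    have : ∀ i, (∑ j, (v i * v j) • (gamma r i * gamma r j))
        + (∑ j, (v i * v j) • (gamma r j * gamma r i)) = (2 * (-(v i * v i))) •
          (1 : Matrix (Fin (r / 2) → Fin 2) (Fin (r / 2) → Fin 2) ℂ) := by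
      intro i
      rw [← Finset.sum_add_distrib, Finset.sum_eq_single i]
      · rw [gamma_sq, smul_neg, ← neg_smul, ← add_smul]
        congr 1
        ring
      · intro j _ hj
        rw [gamma_anticomm r hj.symm, smul_neg, neg_add_cancel]
      · simp
    rw [Finset.sum_congr rfl (fun i _ => this i), ← Finset.sum_smul, ← Finset.mul_sum,
      Algebra.algebraMap_eq_smul_one, smul_smul]
    simp [negForm, QuadraticMap.weightedSumSquares_apply]
  exact smul_right_injective _ (two_ne_zero) h3

/-- The spin representation `κ` of `Cl_r` on `Δ_r`. -/
def kappa (r : ℕ) : Cl r →ₐ[ℝ] Matrix (Fin (r / 2) → Fin 2) (Fin (r / 2) → Fin 2) ℂ :=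
  CliffordAlgebra.lift (negForm r) ⟨gammaMap r, gammaMap_sq r⟩

/-- The action of `Cl_r^0` on `Δ_r`. -/
def spinorAct (r : ℕ) (x : Cl0 r) : Module.End ℂ (Spinor r) := Matrix.toLin' (kappa r x)

/-- The endomorphism `ψ ↦ (-i)^{r/2} e_1 ⋯ e_r · ψ` of `Δ_r`; for even `r` it is an involution. -/
def chirality (r : ℕ) : Module.End ℂ (Spinor r) :=
  (-Complex.I) ^ (r / 2) • Matrix.toLin' (kappa r (vol r))

/-- The half-spinors: `Δ_r^+` for `ε = 1` and `Δ_r^-` for `ε = -1` (used for even `r`). -/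
abbrev HalfSpinor (r : ℕ) (ε : ℂ) : Submodule ℂ (Spinor r) :=
  Module.End.eigenspace (chirality r) ε

theorem gen_mul_gen {r : ℕ} {i j : Fin r} (h : i ≠ j) :
    gen r i * gen r j = -(gen r j * gen r i) := by
  have := CliffordAlgebra.ι_mul_ι_add_swap (Q := negForm r) (Pi.single i 1) (Pi.single j 1)
  have h0 : QuadraticMap.polar (negForm r) (Pi.single i 1) (Pi.single j 1) = 0 := by
    simp only [QuadraticMap.polar, negForm, QuadraticMap.weightedSumSquares_apply,
      ← Finset.sum_sub_distrib, Pi.add_apply]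
    refine Finset.sum_eq_zero fun a _ => ?_
    by_cases ha : a = i
    · subst ha; simp [h]
    · simp [ha]
  rw [h0, map_zero] at this
  exact eq_neg_of_add_eq_zero_left this

theorem gen_mul_prod {r : ℕ} (i : Fin r) (l : List (Fin r)) :
    gen r i * (l.map (gen r)).prod
      = (-1 : ℝ) ^ (l.length + l.count i) • ((l.map (gen r)).prod * gen r i) := by
  induction l with
  | nil => simp
  | cons a l ih =>
    rw [List.map_cons, List.prod_cons]
    by_cases h : i = a
    · subst h
      conv_lhs => rw [ih, mul_smul_comm]
      rw [mul_assoc, List.length_cons, List.count_cons_self]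
      congr 1
      ring
    · conv_lhs => rw [← mul_assoc, gen_mul_gen h, neg_mul, mul_assoc, ih, mul_smul_comm, ← neg_smul]
      rw [List.length_cons, List.count_cons_of_ne (Ne.symm h), mul_assoc]
      congr 1
      ring

theorem gen_mul_vol {r : ℕ} (hr : Even r) (i : Fin r) :
    gen r i * vol r = -(vol r * gen r i) := by
  have h := gen_mul_prod i (List.finRange r)
  rw [List.count_eq_one_of_mem (List.nodup_finRange r) (List.mem_finRange i),
    List.length_finRange, hr.add_one.neg_one_pow, ← List.ofFn_eq_map] at h
  simpa [vol] using h

theorem ι_mul_vol {r : ℕ} (hr : Even r) (v : Fin r → ℝ) :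
    CliffordAlgebra.ι (negForm r) v * vol r = -(vol r * CliffordAlgebra.ι (negForm r) v) := by
  have hv : CliffordAlgebra.ι (negForm r) v = ∑ i, v i • gen r i := by
    conv_lhs => rw [← Finset.univ_sum_single v]
    rw [map_sum]
    refine Finset.sum_congr rfl fun i _ => ?_
    rw [gen, ← map_smul, ← Pi.single_smul]
    simp
  rw [hv, Finset.sum_mul, Finset.mul_sum, ← Finset.sum_neg_distrib]
  refine Finset.sum_congr rfl fun i _ => ?_
  rw [smul_mul_assoc, gen_mul_vol hr, mul_smul_comm, smul_neg]

theorem vol_comm {r : ℕ} (hr : Even r) (x : Cl r) (hx : x ∈ Cl0 r) : x * vol r = vol r * x := by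
  induction x, hx using CliffordAlgebra.even_induction with
  | algebraMap t => exact Algebra.commutes t _
  | add x y hx hy ihx ihy => rw [add_mul, mul_add, ihx, ihy]
  | ι_mul_ι_mul m₁ m₂ x hx ih =>
    rw [mul_assoc, ih, ← mul_assoc, mul_assoc (CliffordAlgebra.ι _ m₁), ι_mul_vol hr m₂, mul_neg,
      ← mul_assoc, ι_mul_vol hr m₁, neg_mul, neg_mul, neg_mul, neg_neg]
    simp only [mul_assoc]

theorem spinorAct_mem {r : ℕ} (hr : Even r) (ε : ℂ) (x : Cl0 r) (ψ : Spinor r)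
    (hψ : ψ ∈ HalfSpinor r ε) : spinorAct r x ψ ∈ HalfSpinor r ε := by
  rw [Module.End.mem_eigenspace_iff] at hψ ⊢
  have h : chirality r * spinorAct r x = spinorAct r x * chirality r := by
    unfold chirality spinorAct
    rw [smul_mul_assoc, mul_smul_comm, Module.End.mul_eq_comp, Module.End.mul_eq_comp,
      ← Matrix.toLin'_mul, ← Matrix.toLin'_mul, ← map_mul, ← map_mul, vol_comm hr x x.2]
  have h2 := LinearMap.congr_fun h ψ
  simp only [Module.End.mul_apply] at h2
  rw [h2, hψ, map_smul]

/-- The action of `Cl_r^0` on `Δ_r^±`, for even `r`. -/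
def halfSpinorAct {r : ℕ} (hr : Even r) (ε : ℂ) (x : Cl0 r) : Module.End ℂ (HalfSpinor r ε) :=
  (spinorAct r x).restrict (spinorAct_mem hr ε x)

/-! ### Real representations of the even Clifford algebra -/

/-- `ℝ^N`. -/
abbrev RSpace (N : ℕ) : Type := Fin N → ℝ

/-- Real representations of the algebra `Cl_r^0` on `ℝ^N`. Representations in which `1` does not
act as the identity are allowed, so that trivial (that is, zero) representations make sense. -/
abbrev RealRep (r N : ℕ) : Type := Cl0 r →ₙₐ[ℝ] Module.End ℝ (RSpace N)

/-- No nonzero direct summand on which `Cl_r^0` acts by zero. -/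
def NoTrivialSummand {r N : ℕ} (Φ : RealRep r N) : Prop :=
  ∀ W W' : Submodule ℝ (RSpace N), IsCompl W W' →
    (∀ x, ∀ w ∈ W', Φ x w ∈ W') → (∀ x, ∀ w ∈ W, Φ x w = 0) → W = ⊥

/-- `B` is an inner product on `ℝ^N` for which every `Φ(e_i e_j)`, `i < j`, is skew-symmetric. -/
structure IsHermitian {r N : ℕ} (Φ : RealRep r N) (B : LinearMap.BilinForm ℝ (RSpace N)) :
    Prop where
  symm : ∀ v w, B v w = B w v
  pos : ∀ v, v ≠ 0 → 0 < B v v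
  skew : ∀ i j : Fin r, i < j → ∀ v w, B (Φ (bivector r i j) v) w = -B v (Φ (bivector r i j) w)

/-- The image of `spin(r)` in `End(ℝ^N)`. -/
def spinImage {r N : ℕ} (Φ : RealRep r N) : Set (Module.End ℝ (RSpace N)) :=
  Φ '' (spinAlg r : Set (Cl0 r))

/-- The centralizer of the image of `spin(r)` in `so(ℝ^N, B)`. -/
def spinCentralizer {r N : ℕ} (Φ : RealRep r N) (B : LinearMap.BilinForm ℝ (RSpace N)) :
    LieSubalgebra ℝ (Module.End ℝ (RSpace N)) where
  carrier := {A | A ∈ skewAdjointLieSubalgebra B ∧ ∀ X ∈ spinImage Φ, ⁅A, X⁆ = 0}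
  add_mem' := fun {A A'} h h' => ⟨add_mem h.1 h'.1, fun X hX => by
    rw [add_lie, h.2 X hX, h'.2 X hX, add_zero]⟩
  zero_mem' := ⟨zero_mem _, fun X _ => zero_lie X⟩
  smul_mem' := fun c A h => ⟨(skewAdjointLieSubalgebra B).smul_mem c h.1, fun X hX => by
    rw [smul_lie, h.2 X hX, smul_zero]⟩
  lie_mem' := fun {A A'} h h' => ⟨(skewAdjointLieSubalgebra B).lie_mem h.1 h'.1, fun X hX => by
    rw [lie_lie, h.2 X hX, h'.2 X hX, lie_zero, lie_zero, sub_zero]⟩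

/-- The dimension `d_r` of an irreducible real representation of `Cl_r^0` (for `r ≥ 1`). -/
def dimIrr (r : ℕ) : ℕ :=
  if r % 8 = 0 then 2 ^ (r / 2 - 1)
  else if r % 8 = 3 ∨ r % 8 = 5 then 2 ^ (r / 2 + 1)
  else 2 ^ (r / 2)

/-- Irreducibility of a (unital) representation of `Cl_r^0` on `ℝ^d`. -/
def IsIrreducibleRep {r d : ℕ} (ρ : Cl0 r →ₐ[ℝ] Module.End ℝ (RSpace d)) : Prop :=
  0 < d ∧ ∀ W : Submodule ℝ (RSpace d), (∀ x, ∀ w ∈ W, ρ x w ∈ W) → W = ⊥ ∨ W = ⊤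

/-- `ℝ^N ≅ ℝ^m ⊗ Δ̃_r` with `Δ̃_r` an irreducible representation of `Cl_r^0` of dimension `d_r`. -/
def Branches {r N : ℕ} (Φ : RealRep r N) (m : ℕ) : Prop :=
  ∃ ρ : Cl0 r →ₐ[ℝ] Module.End ℝ (RSpace (dimIrr r)), IsIrreducibleRep ρ ∧
  ∃ E : RSpace N ≃ₗ[ℝ] (RSpace m ⊗[ℝ] RSpace (dimIrr r)),
    ∀ x v, E (Φ x v) = TensorProduct.map LinearMap.id (ρ x) (E v)

/-- `ℝ^N ≅ ℝ^{m₁} ⊗ Δ̃_r^+ ⊕ ℝ^{m₂} ⊗ Δ̃_r^-` with `Δ̃_r^±` irreducible representations of `Cl_r^0` of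
dimension `d_r`, on which the volume element acts by `±1`. -/
def BranchesTwo {r N : ℕ} (hr : Even r) (Φ : RealRep r N) (m₁ m₂ : ℕ) : Prop :=
  ∃ ρ₁ ρ₂ : Cl0 r →ₐ[ℝ] Module.End ℝ (RSpace (dimIrr r)),
  IsIrreducibleRep ρ₁ ∧ ρ₁ (volEven hr) = 1 ∧ IsIrreducibleRep ρ₂ ∧ ρ₂ (volEven hr) = -1 ∧
  ∃ E : RSpace N ≃ₗ[ℝ]
      ((RSpace m₁ ⊗[ℝ] RSpace (dimIrr r)) × (RSpace m₂ ⊗[ℝ] RSpace (dimIrr r))),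
    ∀ x v, E (Φ x v) = LinearMap.prodMap (TensorProduct.map LinearMap.id (ρ₁ x))
      (TensorProduct.map LinearMap.id (ρ₂ x)) (E v)

/-! ### Compact classical Lie algebras and their standard complex representations -/

/-- `so(m)`: real skew-symmetric matrices. -/
abbrev so (m : ℕ) : LieSubalgebra ℝ (Matrix (Fin m) (Fin m) ℝ) :=
  LieAlgebra.Orthogonal.so (Fin m) ℝ

/-- The real Lie algebra of skew-Hermitian complex matrices. -/
def skewHermitian (n : Type) [Fintype n] [DecidableEq n] : LieSubalgebra ℝ (Matrix n n ℂ) where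
  carrier := {A | Aᴴ = -A}
  add_mem' := fun {A A'} (h : Aᴴ = -A) (h' : A'ᴴ = -A') => by
    simp only [Set.mem_ofPred_eq, Matrix.conjTranspose_add, h, h']
    abel
  zero_mem' := by simp
  smul_mem' := fun c A (h : Aᴴ = -A) => by
    simp only [Set.mem_ofPred_eq, Matrix.conjTranspose_smul, h, star_trivial, smul_neg]
  lie_mem' := fun {A A'} (h : Aᴴ = -A) (h' : A'ᴴ = -A') => by
    simp only [Set.mem_ofPred_eq, Ring.lie_def, Matrix.conjTranspose_sub,
      Matrix.conjTranspose_mul, h, h']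
    noncomm_ring

/-- `u(m)`. -/
abbrev u (m : ℕ) : LieSubalgebra ℝ (Matrix (Fin m) (Fin m) ℂ) := skewHermitian (Fin m)

/-- The compact Lie algebra `sp(m) = u(2m) ∩ sp(2m, ℂ)`. -/
def sp (m : ℕ) : LieSubalgebra ℝ (Matrix (Fin m ⊕ Fin m) (Fin m ⊕ Fin m) ℂ) where
  carrier := {A | A ∈ skewHermitian (Fin m ⊕ Fin m) ∧ A ∈ LieAlgebra.Symplectic.sp (Fin m) ℂ}
  add_mem' := fun h h' => ⟨add_mem h.1 h'.1, add_mem h.2 h'.2⟩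
  zero_mem' := ⟨zero_mem _, zero_mem _⟩
  smul_mem' := fun c A h => ⟨(skewHermitian _).smul_mem c h.1, by
    have := (LieAlgebra.Symplectic.sp (Fin m) ℂ).smul_mem (c : ℂ) h.2
    simpa using this⟩
  lie_mem' := fun h h' => ⟨(skewHermitian _).lie_mem h.1 h'.1,
    (LieAlgebra.Symplectic.sp (Fin m) ℂ).lie_mem h.2 h'.2⟩

/-- The standard representation of `so(m)` on `ℂ^m`. -/
def soStd {m : ℕ} (X : so m) : Module.End ℂ (Fin m → ℂ) :=
  Matrix.toLin' ((X : Matrix (Fin m) (Fin m) ℝ).map Complex.ofReal)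

/-- The standard representation of `u(m)` on `ℂ^m`. -/
def uStd {m : ℕ} (X : u m) : Module.End ℂ (Fin m → ℂ) :=
  Matrix.toLin' (X : Matrix (Fin m) (Fin m) ℂ)

/-- The conjugate of the standard representation of `u(m)`. -/
def uConj {m : ℕ} (X : u m) : Module.End ℂ (Fin m → ℂ) :=
  Matrix.toLin' ((X : Matrix (Fin m) (Fin m) ℂ).map (starRingEnd ℂ))

/-- The standard representation of `sp(m)` on `ℂ^{2m}`. -/
def spStd {m : ℕ} (X : sp m) : Module.End ℂ (Fin m ⊕ Fin m → ℂ) :=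
  Matrix.toLin' (X : Matrix (Fin m ⊕ Fin m) (Fin m ⊕ Fin m) ℂ)

/-! ### Decompositions of the complexification -/

/-- Via a complex linear isomorphism, `ℝ^N ⊗ ℂ ≅ E ⊗ S`, where `x ∈ Cl_r^0` acts by `1 ⊗ s x` and
an element `A` of the centralizer of `spin(r)` acts by `e A ⊗ 1`. -/
def ComplexDecomp {r N : ℕ} (Φ : RealRep r N) (B : LinearMap.BilinForm ℝ (RSpace N))
    {E S : Type} [AddCommGroup E] [Module ℂ E] [AddCommGroup S] [Module ℂ S]
    (e : spinCentralizer Φ B → Module.End ℂ E) (s : Cl0 r → Module.End ℂ S) : Prop :=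
  ∃ F : (ℂ ⊗[ℝ] RSpace N) ≃ₗ[ℂ] (E ⊗[ℂ] S),
    (∀ x z, F ((Φ x).baseChange ℂ z) = TensorProduct.map LinearMap.id (s x) (F z)) ∧
    (∀ (A : spinCentralizer Φ B) z,
      F ((A : Module.End ℝ (RSpace N)).baseChange ℂ z) =
        TensorProduct.map (e A) LinearMap.id (F z))

/-- Via a complex linear isomorphism, `ℝ^N ⊗ ℂ ≅ E₁ ⊗ S₁ ⊕ E₂ ⊗ S₂`, where `x ∈ Cl_r^0` acts by
`1 ⊗ s₁ x ⊕ 1 ⊗ s₂ x` and an element `A` of the centralizer of `spin(r)` by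
`e₁ A ⊗ 1 ⊕ e₂ A ⊗ 1`. -/
def ComplexDecompTwo {r N : ℕ} (Φ : RealRep r N) (B : LinearMap.BilinForm ℝ (RSpace N))
    {E₁ S₁ E₂ S₂ : Type} [AddCommGroup E₁] [Module ℂ E₁] [AddCommGroup S₁] [Module ℂ S₁]
    [AddCommGroup E₂] [Module ℂ E₂] [AddCommGroup S₂] [Module ℂ S₂]
    (e₁ : spinCentralizer Φ B → Module.End ℂ E₁) (s₁ : Cl0 r → Module.End ℂ S₁)
    (e₂ : spinCentralizer Φ B → Module.End ℂ E₂) (s₂ : Cl0 r → Module.End ℂ S₂) : Prop :=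
  ∃ F : (ℂ ⊗[ℝ] RSpace N) ≃ₗ[ℂ] ((E₁ ⊗[ℂ] S₁) × (E₂ ⊗[ℂ] S₂)),
    (∀ x z, F ((Φ x).baseChange ℂ z) =
      LinearMap.prodMap (TensorProduct.map LinearMap.id (s₁ x))
        (TensorProduct.map LinearMap.id (s₂ x)) (F z)) ∧
    (∀ (A : spinCentralizer Φ B) z,
      F ((A : Module.End ℝ (RSpace N)).baseChange ℂ z) =
        LinearMap.prodMap (TensorProduct.map (e₁ A) LinearMap.id)
          (TensorProduct.map (e₂ A) LinearMap.id) (F z))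

end EvenClifford

end

noncomputable section

namespace EvenClifford

/-! ### Monomials in the generators -/

/-! Because `Φ 1` is idempotent, its kernel is a direct summand on which everything acts by zero, so
`Φ` is unital. The even algebra is generated by the bivectors, and a bivector permutes the monomials
of even length up to sign; sums over these monomials therefore play the part of averages over a
finite group. One such average is the invariant inner product (`exists_invariantInner`). Another,
combined with the vanishing of the trace of every nonempty even monomial on spinors, gives a nonzero
real intertwiner from Δ_r into each nonzero invariant subspace of any representation
(`exists_spinor_intertwiner`). So Δ_r alone controls all real representations, and no classification
of Clifford algebras is needed.

What remains is the real commutant of the spinors. Over ℂ, Schur's lemma holds on Δ_r for odd r and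
on each half for even r (`spinor_schur_odd`, `halfSpinor_schur`). The antilinear map `spinorJ`
commutes with the even algebra, squares to 1 exactly when r/2 is 0 or 3 mod 4 (`spinorJ_sq`) and to
-1 otherwise, and commutes with chirality up to (-1)^{r/2} (`spinorJ_chirality`). If it squares to 1
and preserves the space considered, its fixed points form a real irreducible representation with
commutant ℝ. If it squares to -1 and preserves the space, the space itself is irreducible over ℝ
with commutant ℍ. If it exchanges the halves (r ≡ 2, 6), the half on which the volume element acts
by i has commutant ℂ, and the other half is its conjugate.

In all three types a symmetric endomorphism in the commutant is a real scalar (`SymmetricSchur`).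
This gives irreducibility, and it makes every nonzero intertwiner a multiple of an isometry, so
copies of the irreducible S can be split off orthogonally until ℝ^N is S^m (`exists_isometry_onto`),
or a sum of two isotypic parts separated by the eigenvalues ±1 of the volume element when r ≡ 0, 4.

The skew part of the commutant of S^m consists of the skew-Hermitian matrices over ℝ, ℂ or ℍ, that
is so(m), u(m) or sp(m). `IsModel` records this together with an explicit complexification: the
inclusion of fixed points, or v ↦ (v, jv) in the other two types (`isModel_real`, `isModel_complex`,
`isModel_quaternionic`); `exists_decomp_of_isModel` transports it to ℝ^N. The placement of signs
comes from one fact: the volume element acts on Δ_r^ε by i^{r/2} ε. This is why the indices are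
crossed for r ≡ 4 and the conjugate sits on Δ_r^+ for r ≡ 6. -/

theorem gen_mul_self {r : ℕ} (i : Fin r) : gen r i * gen r i = -1 := by
  have h : negForm r (Pi.single i 1) = -1 := by
    simp only [negForm, QuadraticMap.weightedSumSquares_apply]
    rw [Finset.sum_eq_single i]
    · simp
    · intro j _ hj
      simp [hj]
    · simp
  rw [gen, CliffordAlgebra.ι_sq_scalar, h]
  simp

/-- Add `i` to `I` if it is missing, and remove it otherwise. -/
def toggle {r : ℕ} (i : Fin r) (I : Finset (Fin r)) : Finset (Fin r) :=
  if i ∈ I then I.erase i else insert i I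

theorem toggle_toggle {r : ℕ} (i : Fin r) (I : Finset (Fin r)) : toggle i (toggle i I) = I := by
  by_cases h : i ∈ I <;> simp [toggle, h]

theorem mem_toggle_of_ne {r : ℕ} {i j : Fin r} (h : j ≠ i) (I : Finset (Fin r)) :
    j ∈ toggle i I ↔ j ∈ I := by
  by_cases hi : i ∈ I <;> simp [toggle, hi, h]

theorem mem_toggle_self {r : ℕ} (i : Fin r) (I : Finset (Fin r)) : i ∈ toggle i I ↔ i ∉ I := by
  by_cases hi : i ∈ I <;> simp [toggle, hi]

theorem even_card_toggle {r : ℕ} (i : Fin r) (I : Finset (Fin r)) :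
    Even (toggle i I).card ↔ ¬ Even I.card := by
  by_cases hi : i ∈ I
  · have := Finset.card_erase_add_one hi
    rw [toggle, if_pos hi, ← this, Nat.even_add_one, not_not]
  · rw [toggle, if_neg hi, Finset.card_insert_of_notMem hi, Nat.even_add_one]

/-- The product of the `gen r i`, `i ∈ I`, in increasing order. -/
def mono {r : ℕ} (I : Finset (Fin r)) : Cl r :=
  (((List.finRange r).filter (· ∈ I)).map (gen r)).prod

/-- The new generator is pushed to the right until it reaches its own position in the list. Every
generator passed costs a sign, and meeting an equal generator produces e_i² = -1. Only the fact that
the total factor is ±1 is kept, because later uses see it squared. -/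
theorem gen_mul_filter_prod {r : ℕ} (i : Fin r) (I : Finset (Fin r)) (l : List (Fin r))
    (hl : l.Nodup) (hi : i ∈ l) : ∃ ε : ℝ, ε * ε = 1 ∧
      gen r i * ((l.filter (· ∈ I)).map (gen r)).prod =
        ε • ((l.filter (· ∈ toggle i I)).map (gen r)).prod := by
  induction l with
  | nil => simp at hi
  | cons a l ih =>
    rw [List.nodup_cons] at hl
    by_cases h : a = i
    · subst h
      have hf : l.filter (· ∈ toggle a I) = l.filter (· ∈ I) := by
        refine List.filter_congr fun x hx => ?_
        have : x ≠ a := fun e => hl.1 (e ▸ hx)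
        simp [mem_toggle_of_ne this]
      by_cases ha : a ∈ I
      · refine ⟨-1, by norm_num, ?_⟩
        rw [List.filter_cons_of_pos (by simpa using ha),
          List.filter_cons_of_neg (by simpa [mem_toggle_self] using ha), hf, List.map_cons,
          List.prod_cons, ← mul_assoc, gen_mul_self]
        simp
      · refine ⟨1, by norm_num, ?_⟩
        rw [List.filter_cons_of_neg (by simpa using ha),
          List.filter_cons_of_pos (by simpa [mem_toggle_self] using ha), hf, List.map_cons,
          List.prod_cons, one_smul]
    · have hil : i ∈ l := by
        rcases List.mem_cons.1 hi with e | e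
        · exact absurd e.symm h
        · exact e
      obtain ⟨ε, hε, he⟩ := ih hl.2 hil
      by_cases ha : a ∈ I
      · refine ⟨-ε, by simpa using hε, ?_⟩
        rw [List.filter_cons_of_pos (by simpa using ha),
          List.filter_cons_of_pos (by simpa [mem_toggle_of_ne h] using ha), List.map_cons,
          List.prod_cons, ← mul_assoc, gen_mul_gen (Ne.symm h), neg_mul, mul_assoc, he,
          List.map_cons, List.prod_cons, mul_smul_comm, neg_smul]
      · refine ⟨ε, hε, ?_⟩
        rw [List.filter_cons_of_neg (by simpa using ha),
          List.filter_cons_of_neg (by simpa [mem_toggle_of_ne h] using ha), he]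

theorem gen_mul_mono {r : ℕ} (i : Fin r) (I : Finset (Fin r)) : ∃ ε : ℝ, ε * ε = 1 ∧
    gen r i * mono I = ε • mono (toggle i I) :=
  gen_mul_filter_prod i I _ (List.nodup_finRange r) (List.mem_finRange i)

theorem length_filter_finRange {r : ℕ} (I : Finset (Fin r)) :
    ((List.finRange r).filter (· ∈ I)).length = I.card := by
  rw [← List.toFinset_card_of_nodup ((List.nodup_finRange r).filter _)]
  congr 1
  ext x
  simp

/-- Every factor other than e_i anticommutes with e_i, and e_i commutes with itself; the correction
in the exponent accounts for the latter. -/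
theorem gen_mul_mono_comm {r : ℕ} (i : Fin r) (I : Finset (Fin r)) :
    gen r i * mono I = (-1 : ℝ) ^ (I.card + if i ∈ I then 1 else 0) • (mono I * gen r i) := by
  have h := gen_mul_prod i ((List.finRange r).filter (· ∈ I))
  rw [length_filter_finRange] at h
  rw [mono, h]
  congr 3
  by_cases hi : i ∈ I
  · rw [if_pos hi, List.count_eq_one_of_mem ((List.nodup_finRange r).filter _) (by simp [hi])]
  · rw [if_neg hi, List.count_eq_zero_of_not_mem (by simp [hi])]

theorem mono_mem {r : ℕ} {I : Finset (Fin r)} (hI : Even I.card) : mono I ∈ Cl0 r := by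
  have h := SetLike.list_prod_map_mem_graded (A := CliffordAlgebra.evenOdd (negForm r))
    ((List.finRange r).filter (· ∈ I)) (fun _ : Fin r => (1 : ZMod 2)) (gen r)
    (fun j _ => CliffordAlgebra.ι_mem_evenOdd_one _ _)
  have h0 : (((List.finRange r).filter (· ∈ I)).map (fun _ : Fin r => (1 : ZMod 2))).sum = 0 := by
    rw [List.map_const', List.sum_replicate, length_filter_finRange]
    simpa using (ZMod.natCast_eq_zero_iff_even).2 hI
  rw [h0] at h
  exact h

/-- Index sets of the monomials that span the even subalgebra. -/
abbrev EvenIndex (r : ℕ) : Type := {I : Finset (Fin r) // Even I.card}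

/-- The monomials of even length. -/
def evenMono {r : ℕ} (I : EvenIndex r) : Cl0 r := ⟨mono I.1, mono_mem I.2⟩

theorem evenMono_empty {r : ℕ} : evenMono (⟨∅, by simp⟩ : EvenIndex r) = 1 := by
  apply Subtype.ext
  simp [evenMono, mono]

/-- Toggle two indices. -/
def toggleTwo {r : ℕ} (i j : Fin r) : EvenIndex r ≃ EvenIndex r where
  toFun I := ⟨toggle i (toggle j I.1), by
    rw [even_card_toggle, even_card_toggle, not_not]; exact I.2⟩
  invFun I := ⟨toggle j (toggle i I.1), by
    rw [even_card_toggle, even_card_toggle, not_not]; exact I.2⟩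
  left_inv I := by simp [toggle_toggle]
  right_inv I := by simp [toggle_toggle]

/-- This is the finite-group substitute: a bivector permutes the even monomials up to sign, so sums
over them can be reindexed by `toggleTwo`. -/
theorem bivector_mul_evenMono {r : ℕ} (i j : Fin r) (I : EvenIndex r) : ∃ ε : ℝ, ε * ε = 1 ∧
    bivector r i j * evenMono I = ε • evenMono (toggleTwo i j I) := by
  obtain ⟨ε, hε, h⟩ := gen_mul_mono j I.1
  obtain ⟨ε', hε', h'⟩ := gen_mul_mono i (toggle j I.1)
  refine ⟨ε * ε', by linear_combination ε' * ε' * hε + hε', Subtype.ext ?_⟩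
  change gen r i * gen r j * mono I.1 = (ε * ε') • mono (toggle i (toggle j I.1))
  rw [mul_assoc, h, mul_smul_comm, h', smul_smul]

theorem bivector_mul_comm_evenMono {r : ℕ} (i j : Fin r) (I : EvenIndex r) : ∃ ε : ℝ, ε * ε = 1 ∧
    evenMono I * bivector r i j = ε • (bivector r i j * evenMono I) := by
  have h1 := gen_mul_mono_comm j I.1
  have h2 := gen_mul_mono_comm i I.1
  set a : ℝ := (-1) ^ (I.1.card + if j ∈ I.1 then 1 else 0) with ha
  set b : ℝ := (-1) ^ (I.1.card + if i ∈ I.1 then 1 else 0) with hb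
  have ha2 : a * a = 1 := by rw [ha, ← pow_add, ← two_mul, pow_mul]; simp
  have hb2 : b * b = 1 := by rw [hb, ← pow_add, ← two_mul, pow_mul]; simp
  refine ⟨a * b, by linear_combination b * b * ha2 + hb2, Subtype.ext ?_⟩
  change mono I.1 * (gen r i * gen r j) = (a * b) • (gen r i * gen r j * mono I.1)
  rw [mul_assoc, h1, mul_smul_comm, ← mul_assoc (gen r i), h2, smul_mul_assoc, smul_smul, smul_smul,
    show a * b * a * b = 1 by linear_combination b * b * ha2 + hb2, one_smul, mul_assoc]

theorem bivector_mul_self {r : ℕ} {i j : Fin r} (h : i ≠ j) :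
    bivector r i j * bivector r i j = -1 := by
  apply Subtype.ext
  change gen r i * gen r j * (gen r i * gen r j) = -1
  rw [mul_assoc, ← mul_assoc (gen r j), gen_mul_gen h.symm, neg_mul, mul_assoc, gen_mul_self]
  simp [gen_mul_self]

/-! ### Generation by bivectors, and squares of monomials. -/

theorem ι_eq_sum {r : ℕ} (v : Fin r → ℝ) :
    CliffordAlgebra.ι (negForm r) v = ∑ i, v i • gen r i := by
  conv_lhs => rw [← Finset.univ_sum_single v]
  rw [map_sum]
  refine Finset.sum_congr rfl fun i _ => ?_
  rw [gen, ← map_smul, ← Pi.single_smul]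
  simp

/-- The even subalgebra is generated by the bivectors. -/
theorem adjoin_bivector (r : ℕ) :
    Algebra.adjoin ℝ {x : Cl0 r | ∃ i j : Fin r, i < j ∧ x = bivector r i j} = ⊤ := by
  set P := Algebra.adjoin ℝ {x : Cl0 r | ∃ i j : Fin r, i < j ∧ x = bivector r i j} with hP
  have hb : ∀ i j, bivector r i j ∈ P := by
    intro i j
    rcases lt_trichotomy i j with h | h | h
    · exact Algebra.subset_adjoin ⟨i, j, h, rfl⟩
    · subst h
      have : bivector r i i = -1 := Subtype.ext (gen_mul_self i)
      rw [this]
      exact neg_mem (one_mem P)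
    · have : bivector r i j = - bivector r j i := Subtype.ext (gen_mul_gen h.ne')
      rw [this]
      exact neg_mem (Algebra.subset_adjoin ⟨j, i, h, rfl⟩)
  rw [eq_top_iff]
  rintro ⟨x, hx⟩ -
  induction x, hx using CliffordAlgebra.even_induction with
  | algebraMap t => exact P.algebraMap_mem t
  | add x y hx hy ihx ihy => exact add_mem ihx ihy
  | ι_mul_ι_mul v w x hx ih =>
    have : (⟨CliffordAlgebra.ι (negForm r) v * CliffordAlgebra.ι (negForm r) w * x,
        mul_mem (CliffordAlgebra.ι_mul_ι_mem_evenOdd_zero _ v w) hx⟩ : Cl0 r)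
          = (∑ i, ∑ j, (v i * w j) • bivector r i j) * ⟨x, hx⟩ := by
      apply Subtype.ext
      simp [ι_eq_sum, Finset.sum_mul_sum, bivector, smul_smul, mul_comm]
    exact this ▸ mul_mem (sum_mem fun i _ => sum_mem fun j _ => P.smul_mem (hb i j) _) ih

/-- Prepending a generator to a product of length n costs (-1)^n for moving it past the product and
one more sign for its square, so the exponent grows by n + 1. Writing the triangular number as a sum
avoids a division. -/
theorem list_prod_mul_self {r : ℕ} (l : List (Fin r)) (hl : l.Nodup) :
    (l.map (gen r)).prod * (l.map (gen r)).prod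
      = (-1 : ℝ) ^ (∑ i ∈ Finset.range (l.length + 1), i) • (1 : Cl r) := by
  induction l with
  | nil => simp
  | cons a l ih =>
    rw [List.nodup_cons] at hl
    have h := gen_mul_prod a l
    rw [List.count_eq_zero_of_not_mem hl.1, add_zero] at h
    set Q := (l.map (gen r)).prod
    have h2 : Q * gen r a = (-1 : ℝ) ^ l.length • (gen r a * Q) := by
      rw [h, smul_smul, ← pow_add, ← two_mul, pow_mul]; simp
    rw [List.map_cons, List.prod_cons, mul_assoc, ← mul_assoc Q, h2, smul_mul_assoc, mul_smul_comm,
      mul_assoc, ih hl.2, mul_smul_comm, mul_smul_comm, mul_one, gen_mul_self, List.length_cons,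
      Finset.sum_range_succ _ (l.length + 1), smul_smul, smul_neg, ← neg_smul]
    congr 1
    ring

/-- For r = 2k the exponent is k(2k + 1), which has the parity of k. -/
theorem volEven_mul_self {r : ℕ} (hr : Even r) :
    volEven hr * volEven hr = (-1 : ℝ) ^ (r / 2) • (1 : Cl0 r) := by
  apply Subtype.ext
  have h := list_prod_mul_self (List.finRange r) (List.nodup_finRange r)
  rw [← List.ofFn_eq_map, List.length_finRange] at h
  change vol r * vol r = (-1 : ℝ) ^ (r / 2) • (1 : Cl r)
  rw [vol, h]
  congr 1
  obtain ⟨k, rfl⟩ := hr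
  have : ∑ i ∈ Finset.range (k + k + 1), i = k * (2 * k + 1) := by
    rw [Finset.sum_range_id]
    rw [show (k + k + 1) * (k + k + 1 - 1) = k * (2 * k + 1) * 2 by simp; ring]
    simp
  rw [this, show (k + k) / 2 = k by omega, mul_add, pow_add, mul_one, mul_comm k, mul_assoc, pow_mul]
  simp

theorem vol_eq_mono (r : ℕ) : vol r = mono Finset.univ := by
  simp [vol, mono, List.ofFn_eq_map]

/-! ### Representations, intertwiners and averaging -/

/-- `B` is an inner product for which the bivectors act by skew-symmetric endomorphisms. -/
structure InvariantInner {r : ℕ} {V : Type} [AddCommGroup V] [Module ℝ V]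
    (ρ : Cl0 r →ₐ[ℝ] Module.End ℝ V) (B : LinearMap.BilinForm ℝ V) : Prop where
  symm : ∀ v w, B v w = B w v
  pos : ∀ v, v ≠ 0 → 0 < B v v
  skew : ∀ i j : Fin r, i < j → ∀ v w, B (ρ (bivector r i j) v) w = -B v (ρ (bivector r i j) w)

/-- Equivariance is preserved by sums and products and the bivectors generate. All later
equivariance claims that are not visible from the construction are reduced to bivectors in this way;
it also makes commuting with spin(r) the same as commuting with the whole even algebra. -/
theorem intertwines_of_bivector {r : ℕ} {V W : Type} [AddCommGroup V] [Module ℝ V]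
    [AddCommGroup W] [Module ℝ W] (ρ : Cl0 r →ₐ[ℝ] Module.End ℝ V)
    (σ : Cl0 r →ₐ[ℝ] Module.End ℝ W) (f : V →ₗ[ℝ] W)
    (h : ∀ i j : Fin r, i < j → ∀ v, f (ρ (bivector r i j) v) = σ (bivector r i j) (f v))
    (x : Cl0 r) : ∀ v, f (ρ x v) = σ x (f v) := by
  have hx : x ∈ Algebra.adjoin ℝ {x : Cl0 r | ∃ i j : Fin r, i < j ∧ x = bivector r i j} := by
    rw [adjoin_bivector]; trivial
  induction hx using Algebra.adjoin_induction with
  | mem x hx =>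
    obtain ⟨i, j, hij, rfl⟩ := hx
    exact h i j hij
  | algebraMap t => intro v; simp [Algebra.algebraMap_eq_smul_one]
  | add x y _ _ hx hy => intro v; simp [hx v, hy v]
  | mul x y _ _ hx hy => intro v; simp [hx, hy]

/-- The form is the sum of the pullbacks of the dot product under all even monomials. Acting by a
bivector permutes the summands, and the signs disappear because each occurs in both arguments. The
empty monomial supplies positivity. -/
theorem exists_invariantInner {r N : ℕ} (ρ : Cl0 r →ₐ[ℝ] Module.End ℝ (RSpace N)) :
    ∃ B, InvariantInner ρ B := by
  let B : LinearMap.BilinForm ℝ (RSpace N) :=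
    LinearMap.mk₂ ℝ (fun v w => ∑ I : EvenIndex r, ρ (evenMono I) v ⬝ᵥ ρ (evenMono I) w)
      (fun v v' w => by simp [Finset.sum_add_distrib])
      (fun c v w => by simp [Finset.mul_sum])
      (fun v w w' => by simp [Finset.sum_add_distrib])
      (fun c v w => by simp [Finset.mul_sum])
  have hB : ∀ v w, B v w = ∑ I : EvenIndex r, ρ (evenMono I) v ⬝ᵥ ρ (evenMono I) w :=
    fun v w => rfl
  refine ⟨B, fun v w => ?_, fun v hv => ?_, fun i j hij v w => ?_⟩
  · simp only [hB, dotProduct_comm]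
  · rw [hB]
    have h0 : ∀ v : RSpace N, 0 ≤ v ⬝ᵥ v := fun v => Finset.sum_nonneg fun _ _ => mul_self_nonneg _
    refine Finset.sum_pos' (fun I _ => h0 _) ⟨⟨∅, by simp⟩, Finset.mem_univ _, ?_⟩
    rw [evenMono_empty, map_one]
    exact lt_of_le_of_ne (h0 v) fun e => hv (dotProduct_self_eq_zero.1 e.symm)
  · have key : ∀ v w, B (ρ (bivector r i j) v) (ρ (bivector r i j) w) = B v w := by
      intro v w
      rw [hB, hB, ← Equiv.sum_comp (toggleTwo i j)]
      refine Finset.sum_congr rfl fun I _ => ?_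
      obtain ⟨ε, hε, h⟩ := bivector_mul_comm_evenMono i j (toggleTwo i j I)
      obtain ⟨ε', hε', h'⟩ := bivector_mul_evenMono i j (toggleTwo i j I)
      have h2 : toggleTwo i j (toggleTwo i j I) = I := by
        apply Subtype.ext
        change toggle i (toggle j (toggle i (toggle j I.1))) = I.1
        have hc : toggle j (toggle i (toggle j I.1)) = toggle i I.1 := by
          ext a
          by_cases hai : a = i
          · subst hai
            simp [mem_toggle_self, mem_toggle_of_ne hij.ne]
          · by_cases haj : a = j
            · subst haj
              simp [mem_toggle_self, mem_toggle_of_ne hij.ne']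
            · simp [mem_toggle_of_ne hai, mem_toggle_of_ne haj]
        rw [hc, toggle_toggle]
      have h3 : ∀ u, ρ (evenMono (toggleTwo i j I)) (ρ (bivector r i j) u)
          = (ε * ε') • ρ (evenMono I) u := by
        intro u
        rw [← Module.End.mul_apply, ← map_mul, h, h', h2, smul_smul, map_smul, LinearMap.smul_apply]
      rw [h3, h3, smul_dotProduct, dotProduct_smul, smul_smul,
        show ε * ε' * (ε * ε') = 1 by linear_combination ε' * ε' * hε + hε', one_smul]
    -- An isometry whose square is -1 is skew-symmetric.
    have h2 : ∀ w, ρ (bivector r i j) (ρ (bivector r i j) w) = -w := by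
      intro w
      rw [← Module.End.mul_apply, ← map_mul, bivector_mul_self hij.ne]
      simp
    have := key v (ρ (bivector r i j) w)
    rw [h2, map_neg] at this
    rw [← this, neg_neg]

/-- `Φ 1` is idempotent, so its kernel and range are complementary. The kernel is killed by every
Φ(x) = Φ(x)Φ(1), hence it is zero, and an injective idempotent is the identity. -/
theorem map_one_of_noTrivialSummand {r N : ℕ} {Φ : RealRep r N} (hΦ : NoTrivialSummand Φ) :
    Φ 1 = 1 := by
  have hP : Φ 1 * Φ 1 = Φ 1 := by rw [← map_mul, one_mul]
  have hW := hΦ (LinearMap.ker (Φ 1)) (LinearMap.range (Φ 1))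
    (LinearMap.IsIdempotentElem.isCompl hP).symm
    (by
      rintro x _ ⟨w, rfl⟩
      refine ⟨Φ x w, ?_⟩
      rw [← Module.End.mul_apply, ← Module.End.mul_apply, ← map_mul, ← map_mul, one_mul, mul_one])
    (by
      intro x w hw
      rw [← mul_one x, map_mul, Module.End.mul_apply, LinearMap.mem_ker.1 hw, map_zero])
  refine LinearMap.ext fun v => LinearMap.ker_eq_bot.1 hW ?_
  rw [← Module.End.mul_apply, hP, Module.End.one_apply]

/-- A representation in which `1` acts as the identity, as a unital homomorphism. -/
def unitalRep {r N : ℕ} (Φ : RealRep r N) (h : Φ 1 = 1) : Cl0 r →ₐ[ℝ] Module.End ℝ (RSpace N) :=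
  AlgHom.ofLinearMap (Φ : Cl0 r →ₗ[ℝ] Module.End ℝ (RSpace N)) h (map_mul Φ)

/-! ### Adjoints and traces of the matrices of the spin representation -/

theorem kappa_gen (r : ℕ) (i : Fin r) : kappa r (gen r i) = gamma r i := by
  rw [kappa, gen, CliffordAlgebra.lift_ι_apply]
  simp [gammaMap, Fintype.linearCombination_apply_single]

theorem tensorMatrix_conjTranspose {k : ℕ} (M : Fin k → Matrix (Fin 2) (Fin 2) ℂ) :
    (tensorMatrix M)ᴴ = tensorMatrix (fun p => (M p)ᴴ) := by
  ext a b
  simp [tensorMatrix, Matrix.conjTranspose_apply]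

theorem matT_conjTranspose : matTᴴ = matT := by
  ext i j; fin_cases i <;> fin_cases j <;> simp [matT]
theorem g₁_conjTranspose : g₁ᴴ = -g₁ := by
  ext i j; fin_cases i <;> fin_cases j <;> simp [g₁]
theorem g₂_conjTranspose : g₂ᴴ = -g₂ := by
  ext i j; fin_cases i <;> fin_cases j <;> simp [g₂]

theorem gamma_conjTranspose (r : ℕ) (i : Fin r) : (gamma r i)ᴴ = -gamma r i := by
  have hi := i.2
  unfold gamma
  rw [Matrix.conjTranspose_smul, tensorMatrix_conjTranspose]
  by_cases h : (i : ℕ) < 2 * (r / 2)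
  · rw [tensorMatrix_neg _ (fun p : Fin (r / 2) => gammaFactor i p)
      (⟨(i : ℕ) / 2, by omega⟩ : Fin (r / 2))]
    · simp [h]
    · simp only [gammaFactor, lt_irrefl, if_false, if_true]
      split_ifs <;> simp [g₁_conjTranspose, g₂_conjTranspose]
    · intro p hp
      have hp' : (p : ℕ) ≠ (i : ℕ) / 2 := fun e => hp (Fin.ext e)
      simp only [gammaFactor, if_neg hp']
      split_ifs <;> simp [matT_conjTranspose]
  · have : (fun p : Fin (r / 2) => (gammaFactor i p)ᴴ) = fun p : Fin (r / 2) => gammaFactor i p := by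
      funext p
      have := p.2
      rw [gammaFactor, if_pos (by omega), matT_conjTranspose]
    rw [this]
    simp [h]

theorem kappa_bivector (r : ℕ) (i j : Fin r) :
    kappa r (bivector r i j : Cl0 r) = gamma r i * gamma r j := by
  change kappa r (gen r i * gen r j) = _
  rw [map_mul, kappa_gen, kappa_gen]

theorem kappa_bivector_conjTranspose {r : ℕ} {i j : Fin r} (h : i ≠ j) :
    (kappa r (bivector r i j : Cl0 r))ᴴ = -kappa r (bivector r i j : Cl0 r) := by
  rw [kappa_bivector, Matrix.conjTranspose_mul, gamma_conjTranspose, gamma_conjTranspose,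
    neg_mul_neg, gamma_anticomm r h, neg_neg]

/-- For i ∈ I and |I| even, e_i anticommutes with the monomial M. Then γMγ equals M because γ² = -1,
while cyclicity of the trace gives it trace -tr M. -/
theorem trace_kappa_evenMono {r : ℕ} (I : EvenIndex r) (hI : I.1.Nonempty) :
    (kappa r (evenMono I : Cl0 r)).trace = 0 := by
  obtain ⟨i, hi⟩ := hI
  have h : gen r i * mono I.1 = -(mono I.1 * gen r i) := by
    rw [gen_mul_mono_comm, if_pos hi, I.2.add_one.neg_one_pow, neg_one_smul]
  change (kappa r (mono I.1)).trace = 0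
  set M := kappa r (mono I.1)
  have h1 : gamma r i * M = -(M * gamma r i) := by
    rw [← kappa_gen, ← map_mul, h, map_neg, map_mul]
  have h2 : gamma r i * M * gamma r i = M := by
    rw [h1, neg_mul, mul_assoc, gamma_sq, mul_neg, mul_one, neg_neg]
  have h3 : (gamma r i * M * gamma r i).trace = -M.trace := by
    rw [Matrix.trace_mul_comm, ← mul_assoc, gamma_sq, neg_one_mul, Matrix.trace_neg]
  rw [h2] at h3
  exact self_eq_neg.1 h3

/-- The underlying real representation of a complex representation. -/
def restrictReal {r : ℕ} {K : Type} [AddCommGroup K] [Module ℂ K] [Module ℝ K]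
    [IsScalarTower ℝ ℂ K] (s : Cl0 r →ₐ[ℝ] Module.End ℂ K) : Cl0 r →ₐ[ℝ] Module.End ℝ K :=
  AlgHom.ofLinearMap
    { toFun := fun x => (s x).restrictScalars ℝ
      map_add' := fun x y => by ext; simp
      map_smul' := fun c x => by ext; simp }
    (by ext; simp) (fun x y => by ext; simp)

@[simp]
theorem restrictReal_apply {r : ℕ} {K : Type} [AddCommGroup K] [Module ℂ K] [Module ℝ K]
    [IsScalarTower ℝ ℂ K] (s : Cl0 r →ₐ[ℝ] Module.End ℂ K) (x : Cl0 r) (k : K) :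
    restrictReal s x k = s x k := rfl

/-- The spin representation of `Cl_r^0` as an algebra homomorphism. -/
def spinorHom (r : ℕ) : Cl0 r →ₐ[ℝ] Module.End ℂ (Spinor r) :=
  AlgHom.ofLinearMap
    { toFun := spinorAct r
      map_add' := fun x y => by simp [spinorAct]
      map_smul' := fun c x => by
        refine LinearMap.ext fun ψ => ?_
        simp [spinorAct, Matrix.smul_mulVec] }
    (by change spinorAct r 1 = 1; simp [spinorAct, Module.End.one_eq_id])
    (fun x y => by
      change spinorAct r (x * y) = spinorAct r x * spinorAct r y
      simp [spinorAct, Module.End.mul_eq_comp, Matrix.toLin'_mul])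

/-- Spinors map nontrivially to every nonzero invariant subspace of a representation. -/
theorem exists_spinor_intertwiner {r : ℕ} {V : Type} [AddCommGroup V] [Module ℝ V]
    (σ : Cl0 r →ₐ[ℝ] Module.End ℝ V) (U : Submodule ℝ V) (hU : ∀ x, ∀ u ∈ U, σ x u ∈ U)
    (hne : U ≠ ⊥) : ∃ h : Spinor r →ₗ[ℝ] V,
      (∀ x ψ, h (spinorHom r x ψ) = σ x (h ψ)) ∧ h ≠ 0 ∧ ∀ ψ, h ψ ∈ U := by
  obtain ⟨v, hvU, hv⟩ := U.exists_mem_ne_zero_of_ne_bot hne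
  -- Average of the rank-one real maps ψ ↦ Re(ψ_a) v over the even monomials, with the adjoint of
  -- e_I as its inverse on spinors. One map for each coordinate a; the trace argument below shows
  -- that not all of them vanish.
  let h (a : Fin (r / 2) → Fin 2) : Spinor r →ₗ[ℝ] V :=
    { toFun := fun ψ => ∑ I : EvenIndex r,
        (((kappa r (evenMono I : Cl0 r))ᴴ *ᵥ ψ) a).re • σ (evenMono I) v
      map_add' := fun ψ φ => by
        simp [Matrix.mulVec_add, add_smul, Finset.sum_add_distrib]
      map_smul' := fun c ψ => by
        simp [Matrix.mulVec_smul, mul_smul, Finset.smul_sum] }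
  have hh : ∀ a ψ, h a ψ = ∑ I : EvenIndex r,
        (((kappa r (evenMono I : Cl0 r))ᴴ *ᵥ ψ) a).re • σ (evenMono I) v := fun _ _ => rfl
  have heq : ∀ a x ψ, h a (spinorHom r x ψ) = σ x (h a ψ) := by
    intro a
    refine intertwines_of_bivector (restrictReal (spinorHom r)) σ (h a) fun i j hij ψ => ?_
    rw [hh, hh, map_sum, ← Equiv.sum_comp (toggleTwo i j)]
    refine Finset.sum_congr rfl fun I _ => ?_
    obtain ⟨ε, hε, h⟩ := bivector_mul_evenMono i j I
    have h1 : evenMono (toggleTwo i j I) = ε • (bivector r i j * evenMono I) := by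
      rw [h, smul_smul, hε, one_smul]
    have h2 : (kappa r (evenMono (toggleTwo i j I) : Cl0 r))ᴴ *ᵥ
        (restrictReal (spinorHom r) (bivector r i j) ψ)
          = ε • ((kappa r (evenMono I : Cl0 r))ᴴ *ᵥ ψ) := by
      have h3 : (kappa r (bivector r i j : Cl0 r))ᴴ * kappa r (bivector r i j : Cl0 r) = 1 := by
        rw [kappa_bivector_conjTranspose hij.ne, neg_mul, ← map_mul, ← MulMemClass.coe_mul,
          bivector_mul_self hij.ne]
        simp
      rw [h1]
      change _ *ᵥ Matrix.toLin' _ ψ = _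
      rw [Matrix.toLin'_apply, Matrix.mulVec_mulVec]
      simp only [SetLike.val_smul, MulMemClass.coe_mul, map_smul, map_mul,
        Matrix.conjTranspose_smul, Matrix.conjTranspose_mul, smul_mul_assoc, mul_assoc, h3, mul_one,
        star_trivial, Matrix.smul_mulVec]
    rw [h2, h1, Pi.smul_apply, Complex.smul_re, map_smul, map_mul, map_smul, LinearMap.smul_apply,
      Module.End.mul_apply, smul_smul, smul_eq_mul, mul_right_comm, hε, one_mul]
  by_contra hcon
  push Not at hcon
  have hzero : ∀ a, h a = 0 := by
    intro a
    by_contra ha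
    obtain ⟨ψ, hψ⟩ := hcon (h a) (heq a) ha
    rw [hh] at hψ
    exact hψ (U.sum_mem fun I _ => U.smul_mem _ (hU _ _ hvU))
  -- Evaluating the a-th map at the a-th basis vector and summing over a turns the coefficients into
  -- real parts of traces of monomials. Only the empty monomial survives, which leaves 2^{r/2} v =
  -- 0.
  have h1 : ∑ a, h a (Pi.single a 1) = 0 := by simp [hzero]
  simp only [hh] at h1
  rw [Finset.sum_comm, Finset.sum_eq_single (⟨∅, by simp⟩ : EvenIndex r)] at h1
  · rw [evenMono_empty] at h1
    have h2 : ((2 : ℝ) ^ (r / 2)) • v = 0 := by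
      simpa [← Nat.cast_smul_eq_nsmul ℝ] using h1
    exact hv ((smul_eq_zero.1 h2).resolve_left (by positivity))
  · intro I _ hI
    have hI' : I.1.Nonempty := by
      rw [Finset.nonempty_iff_ne_empty]
      exact fun e => hI (Subtype.ext e)
    rw [← Finset.sum_smul]
    have := trace_kappa_evenMono I hI'
    have h2 : ∑ a, (((kappa r (evenMono I : Cl0 r))ᴴ *ᵥ Pi.single a 1) a).re
        = ((kappa r (evenMono I : Cl0 r)).trace).re := by
      simp [Matrix.trace]
    rw [h2, this]
    simp
  · simp

/-! ### Orthogonal decomposition into copies of one representation -/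

section Decomposition

variable {r : ℕ} {V S : Type} [AddCommGroup V] [Module ℝ V] [AddCommGroup S] [Module ℝ S]

theorem InvariantInner.nondegenerate {σ : Cl0 r →ₐ[ℝ] Module.End ℝ V}
    {B : LinearMap.BilinForm ℝ V} (hB : InvariantInner σ B) : B.Nondegenerate := by
  constructor
  · intro v hv
    by_contra h
    exact (hB.pos v h).ne' (hv v)
  · intro v hv
    by_contra h
    exact (hB.pos v h).ne' (hv v)

theorem InvariantInner.ext_left {σ : Cl0 r →ₐ[ℝ] Module.End ℝ V}
    {B : LinearMap.BilinForm ℝ V} (hB : InvariantInner σ B) {v w : V}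
    (h : ∀ u, B v u = B w u) : v = w := by
  rw [← sub_eq_zero]
  by_contra hne
  have := hB.pos _ hne
  rw [map_sub B, LinearMap.sub_apply, h, sub_self] at this
  exact this.false

theorem InvariantInner.eq_zero {σ : Cl0 r →ₐ[ℝ] Module.End ℝ V}
    {B : LinearMap.BilinForm ℝ V} (hB : InvariantInner σ B) {v : V} (h : B v v = 0) : v = 0 := by
  by_contra hne
  exact (hB.pos v hne).ne' h

/-- Existence of adjoints. -/
theorem InvariantInner.exists_adjoint [FiniteDimensional ℝ S] {ρ : Cl0 r →ₐ[ℝ] Module.End ℝ S}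
    {β : LinearMap.BilinForm ℝ S} (hβ : InvariantInner ρ β) (C : S →ₗ[ℝ] V →ₗ[ℝ] ℝ) :
    ∃ g : V →ₗ[ℝ] S, ∀ s v, β s (g v) = C s v := by
  refine ⟨(β.toDual hβ.nondegenerate).symm.toLinearMap ∘ₗ C.flip, fun s v => ?_⟩
  rw [hβ.symm]
  simp

/-- Every symmetric endomorphism commuting with the representation is a real scalar. -/
def SymmetricSchur (ρ : Cl0 r →ₐ[ℝ] Module.End ℝ S) (β : LinearMap.BilinForm ℝ S) : Prop :=
  ∀ T : Module.End ℝ S, (∀ x s, T (ρ x s) = ρ x (T s)) → (∀ s t, β (T s) t = β s (T t)) →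
    ∃ c : ℝ, ∀ s, T s = c • s

/-- Bivectors are skew on both sides, so the two signs produced by moving one across the pairing
cancel. -/
theorem adjoint_intertwines {ρ : Cl0 r →ₐ[ℝ] Module.End ℝ S}
    {β : LinearMap.BilinForm ℝ S} (hβ : InvariantInner ρ β) {σ : Cl0 r →ₐ[ℝ] Module.End ℝ V}
    {B : LinearMap.BilinForm ℝ V} (hB : InvariantInner σ B) {f : S →ₗ[ℝ] V}
    (hf : ∀ x s, f (ρ x s) = σ x (f s)) {g : V →ₗ[ℝ] S} (hg : ∀ s v, β s (g v) = B (f s) v)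
    (x : Cl0 r) (v : V) : g (σ x v) = ρ x (g v) := by
  refine intertwines_of_bivector σ ρ g (fun i j hij v => hβ.ext_left fun u => ?_) x v
  rw [hβ.symm, hg, hβ.skew i j hij, hβ.symm, hβ.symm, hβ.symm, hg, hf, hB.skew i j hij, neg_neg]

/-- With h* the adjoint, h*h is symmetric and commutes with the representation, hence is a real
scalar c. Positivity of both forms makes c > 0, and h/√c is an isometry. -/
theorem exists_isometric_intertwiner [FiniteDimensional ℝ S] {ρ : Cl0 r →ₐ[ℝ] Module.End ℝ S}
    {β : LinearMap.BilinForm ℝ S} (hβ : InvariantInner ρ β) (hS : SymmetricSchur ρ β)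
    {σ : Cl0 r →ₐ[ℝ] Module.End ℝ V} {B : LinearMap.BilinForm ℝ V} (hB : InvariantInner σ B)
    (h : S →ₗ[ℝ] V) (hh : ∀ x s, h (ρ x s) = σ x (h s)) (h0 : h ≠ 0) :
    ∃ c : ℝ, c ≠ 0 ∧ ∀ s t, B (c • h s) (c • h t) = β s t := by
  obtain ⟨g, hg⟩ := hβ.exists_adjoint (B ∘ₗ h)
  have hg' : ∀ s v, β s (g v) = B (h s) v := hg
  have hgi := adjoint_intertwines hβ hB hh hg'
  obtain ⟨c, hc⟩ := hS (g ∘ₗ h) (fun x s => by simp [hh, hgi]) (fun s t => by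
    rw [hβ.symm]
    simp only [LinearMap.comp_apply, hg']
    exact hB.symm _ _)
  have hc' : ∀ s t, B (h s) (h t) = c * β s t := by
    intro s t
    rw [← hg']
    change β s ((g ∘ₗ h) t) = _
    rw [hc, map_smul, smul_eq_mul]
  obtain ⟨s, hs⟩ : ∃ s, h s ≠ 0 := by
    by_contra! hc
    exact h0 (LinearMap.ext hc)
  have hs0 : s ≠ 0 := fun e => hs (by rw [e, map_zero])
  have hcpos : 0 < c := by
    have h1 := hB.pos _ hs
    rw [hc'] at h1
    exact (mul_pos_iff_of_pos_right (hβ.pos s hs0)).1 h1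
  refine ⟨(Real.sqrt c)⁻¹, by positivity, fun s t => ?_⟩
  simp only [map_smul, LinearMap.smul_apply, hc', smul_eq_mul]
  rw [← mul_assoc, ← mul_assoc, ← mul_inv, Real.mul_self_sqrt hcpos.le, inv_mul_cancel₀ hcpos.ne',
    one_mul]

/-- A representation whose commuting symmetric endomorphisms are scalars is irreducible. -/
theorem eq_bot_or_top_of_symmetricSchur [FiniteDimensional ℝ S]
    {ρ : Cl0 r →ₐ[ℝ] Module.End ℝ S} {β : LinearMap.BilinForm ℝ S} (hβ : InvariantInner ρ β)
    (hS : SymmetricSchur ρ β) (W : Submodule ℝ S) (hW : ∀ x, ∀ w ∈ W, ρ x w ∈ W) :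
    W = ⊥ ∨ W = ⊤ := by
  let ρW : Cl0 r →ₐ[ℝ] Module.End ℝ W := AlgHom.ofLinearMap
    { toFun := fun x => (ρ x).restrict (hW x)
      map_add' := fun x y => by ext; simp
      map_smul' := fun c x => by ext; simp }
    (by ext; simp) (fun x y => by ext; simp)
  have hρW : ∀ x w, ((ρW x w : W) : S) = ρ x w := fun _ _ => rfl
  let βW : LinearMap.BilinForm ℝ W := β.restrict W
  have hβW : InvariantInner ρW βW :=
    ⟨fun v w => hβ.symm _ _, fun v hv => hβ.pos _ (by simpa using hv),
      fun i j hij v w => hβ.skew i j hij _ _⟩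
  -- `g` is the orthogonal projection onto W, obtained as the adjoint of the inclusion. It is
  -- symmetric and equivariant, hence a scalar; being the identity on a nonzero W, it is the
  -- identity everywhere.
  obtain ⟨g, hg⟩ := hβW.exists_adjoint (β ∘ₗ W.subtype)
  have hg' : ∀ (s : W) v, β s (g v) = β s v := hg
  have hgi := adjoint_intertwines hβW hβ (f := W.subtype) (fun x s => rfl) hg
  obtain ⟨c, hc⟩ := hS (W.subtype ∘ₗ g) (fun x s => by
      change ((g (ρ x s) : W) : S) = _
      rw [hgi]; rfl)
    (fun s t => by
      change β (g s : S) t = β s (g t : S)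
      rw [← hg', hβ.symm s, ← hg' _ s, hβ.symm])
  by_cases h : W = ⊥
  · exact Or.inl h
  · right
    obtain ⟨w, hw, hw0⟩ := W.exists_mem_ne_zero_of_ne_bot h
    have h1 : (g w : S) = w := by
      have : g w = ⟨w, hw⟩ := hβW.ext_left fun u => by
        rw [hβW.symm, hβW.symm _ u]
        exact hg' u w
      rw [this]
    have h2 : (g w : S) = c • w := hc w
    have hc1 : c = 1 := by
      rw [h1] at h2
      have : (c - 1) • w = 0 := by rw [sub_smul, ← h2, one_smul, sub_self]
      exact sub_eq_zero.1 ((smul_eq_zero.1 this).resolve_right hw0)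
    rw [eq_top_iff]
    intro s _
    have h3 : (g s : S) = c • s := hc s
    rw [hc1, one_smul] at h3
    exact h3 ▸ (g s).2

/-- The form `∑ a, β (s a) (t a)` on `Fin m → S`. -/
def sumForm (m : ℕ) (β : LinearMap.BilinForm ℝ S) : LinearMap.BilinForm ℝ (Fin m → S) :=
  LinearMap.mk₂ ℝ (fun s t => ∑ a, β (s a) (t a))
    (fun v v' w => by simp [Finset.sum_add_distrib])
    (fun c v w => by simp [Finset.mul_sum])
    (fun v w w' => by simp [Finset.sum_add_distrib])
    (fun c v w => by simp [Finset.mul_sum])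

theorem sumForm_apply (m : ℕ) (β : LinearMap.BilinForm ℝ S) (s t : Fin m → S) :
    sumForm m β s t = ∑ a, β (s a) (t a) := rfl

/-- The representation on `Fin m → S` that acts on each component. -/
def piRep (m : ℕ) (ρ : Cl0 r →ₐ[ℝ] Module.End ℝ S) : Cl0 r →ₐ[ℝ] Module.End ℝ (Fin m → S) :=
  AlgHom.ofLinearMap
    { toFun := fun x => (ρ x).compLeft (Fin m)
      map_add' := fun x y => by ext; simp
      map_smul' := fun c x => by ext; simp }
    (by ext; simp) (fun x y => by ext; simp)

@[simp]
theorem piRep_apply (m : ℕ) (ρ : Cl0 r →ₐ[ℝ] Module.End ℝ S) (x : Cl0 r) (s : Fin m → S)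
    (a : Fin m) : piRep m ρ x s a = ρ x (s a) := rfl

theorem InvariantInner.pi {ρ : Cl0 r →ₐ[ℝ] Module.End ℝ S} {β : LinearMap.BilinForm ℝ S}
    (hβ : InvariantInner ρ β) (m : ℕ) : InvariantInner (piRep m ρ) (sumForm m β) := by
  have h0 : ∀ s, 0 ≤ β s s := fun s => by
    by_cases h : s = 0
    · simp [h]
    · exact (hβ.pos s h).le
  refine ⟨fun v w => ?_, fun v hv => ?_, fun i j hij v w => ?_⟩
  · simp only [sumForm_apply, hβ.symm]
  · obtain ⟨a, ha⟩ := Function.ne_iff.1 hv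
    exact Finset.sum_pos' (fun a _ => h0 _) ⟨a, Finset.mem_univ a, hβ.pos _ ha⟩
  · simp only [sumForm_apply, piRep_apply, hβ.skew i j hij, Finset.sum_neg_distrib]

/-- An invariant subspace all of whose nonzero invariant subspaces receive a nonzero intertwiner
from `S` is isometric to a power of `S`. -/
theorem exists_isometry_onto [FiniteDimensional ℝ S] [FiniteDimensional ℝ V]
    {ρ : Cl0 r →ₐ[ℝ] Module.End ℝ S}
    {β : LinearMap.BilinForm ℝ S} (hβ : InvariantInner ρ β) (hS : SymmetricSchur ρ β)
    {σ : Cl0 r →ₐ[ℝ] Module.End ℝ V} {B : LinearMap.BilinForm ℝ V} (hB : InvariantInner σ B)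
    (U : Submodule ℝ V) (hU : ∀ x, ∀ u ∈ U, σ x u ∈ U)
    (hex : ∀ U' ≤ U, (∀ x, ∀ u ∈ U', σ x u ∈ U') → U' ≠ ⊥ →
      ∃ h : S →ₗ[ℝ] V, (∀ x s, h (ρ x s) = σ x (h s)) ∧ h ≠ 0 ∧ ∀ s, h s ∈ U') :
    ∃ (m : ℕ) (f : (Fin m → S) →ₗ[ℝ] V), (∀ x s, f (piRep m ρ x s) = σ x (f s)) ∧
      (∀ s t, B (f s) (f t) = sumForm m β s t) ∧ LinearMap.range f = U := by
  induction hn : Module.finrank ℝ U using Nat.strong_induction_on generalizing U with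
  | _ n ih =>
  by_cases hbot : U = ⊥
  · refine ⟨0, 0, fun x s => by simp, fun s t => by simp [sumForm_apply], ?_⟩
    rw [LinearMap.range_zero, hbot]
  obtain ⟨h, hh, h0, hhU⟩ := hex U le_rfl hU hbot
  obtain ⟨c, hc0, hc⟩ := exists_isometric_intertwiner hβ hS hB h hh h0
  set f : S →ₗ[ℝ] V := c • h with hf
  have hfi : ∀ x s, f (ρ x s) = σ x (f s) := fun x s => by simp [hf, hh]
  have hfB : ∀ s t, B (f s) (f t) = β s t := hc
  have hfU : ∀ s, f s ∈ U := fun s => U.smul_mem _ (hhU s)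
  have hf0 : f ≠ 0 := smul_ne_zero hc0 h0
  -- The adjoint of the isometry is a left inverse of it, and its kernel is the orthogonal
  -- complement of the copy of S just found. The induction on dimension continues inside that
  -- complement.
  obtain ⟨g, hg⟩ := hβ.exists_adjoint (B ∘ₗ f)
  have hg' : ∀ s v, β s (g v) = B (f s) v := hg
  have hgi := adjoint_intertwines hβ hB hfi hg'
  have hgf : ∀ s, g (f s) = s := fun s => hβ.ext_left fun u => by
    rw [hβ.symm, hg', hfB, hβ.symm]
  let U' : Submodule ℝ V := U ⊓ LinearMap.ker g
  have hU'lt : U' < U := by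
    refine lt_of_le_of_ne inf_le_left fun e => hf0 ?_
    ext s
    have : f s ∈ U' := e ▸ hfU s
    have h2 : g (f s) = 0 := this.2
    rw [hgf] at h2
    simp [h2]
  obtain ⟨m, f', hf'i, hf'B, hf'r⟩ := ih _ (hn ▸ Submodule.finrank_lt_finrank_of_lt hU'lt) U'
    (fun x u hu => ⟨hU x u hu.1, by
      have : g u = 0 := hu.2
      change g _ = 0
      rw [hgi, this, map_zero]⟩)
    (fun W hW => hex W (hW.trans inf_le_left)) rfl
  have hf'U : ∀ s, f' s ∈ U' := fun s => hf'r ▸ LinearMap.mem_range_self f' s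
  have hcross : ∀ s t, B (f s) (f' t) = 0 := fun s t => by
    have : g (f' t) = 0 := (hf'U t).2
    rw [← hg', this, map_zero]
  let F : (Fin (m + 1) → S) →ₗ[ℝ] V :=
    f ∘ₗ LinearMap.proj 0 + f' ∘ₗ LinearMap.funLeft ℝ S Fin.succ
  have hF : ∀ s, F s = f (s 0) + f' (fun a => s a.succ) := fun s => rfl
  refine ⟨m + 1, F, fun x s => ?_, fun s t => ?_, le_antisymm ?_ ?_⟩
  · rw [hF, hF, map_add, ← hfi, ← hf'i]
    rfl
  · rw [hF, hF, map_add, map_add, LinearMap.add_apply, LinearMap.add_apply, hfB, hf'B, hcross,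
      hB.symm, hcross, sumForm_apply, sumForm_apply, Fin.sum_univ_succ]
    ring
  · rintro _ ⟨s, rfl⟩
    exact add_mem (hfU _) (hf'U _).1
  · intro u hu
    have h1 : u - f (g u) ∈ U' := ⟨sub_mem hu (hfU _), by
      change g _ = 0
      rw [map_sub, hgf, sub_self]⟩
    rw [← hf'r] at h1
    obtain ⟨t, ht⟩ := h1
    refine ⟨Fin.cons (g u) t, ?_⟩
    rw [hF]
    simp [ht]

end Decomposition

/-! ### Models of the centralizer and of the complexification -/

section Model

variable {r : ℕ} {M L T : Type} [AddCommGroup M] [Module ℝ M] [LieRing L] [LieAlgebra ℝ L]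
  [AddCommGroup T] [Module ℂ T] [Module ℝ T]

/-- The Lie algebra `L` is identified by `hat` with the skew-symmetric endomorphisms that commute
with the representation `ρ`, and `F : M → T` exhibits `T` as the complexification of `M`, compatibly
with the actions `aA` of the even Clifford algebra and `aL` of `L` on `T`. -/
structure IsModel (ρ : Cl0 r →ₐ[ℝ] Module.End ℝ M) (β : LinearMap.BilinForm ℝ M)
    (hat : L →ₗ[ℝ] Module.End ℝ M) (aA : Cl0 r → Module.End ℂ T) (aL : L → Module.End ℂ T)
    (F : M →ₗ[ℝ] T) : Prop where
  lie : ∀ X Y, aL ⁅X, Y⁆ = aL X * aL Y - aL Y * aL X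
  map_act : ∀ x v, F (ρ x v) = aA x (F v)
  map_hat : ∀ X v, F (hat X v) = aL X (F v)
  inj : ∀ v w, F v + Complex.I • F w = 0 → v = 0 ∧ w = 0
  surj : ∀ t, ∃ v w, F v + Complex.I • F w = t
  hat_inj : ∀ X, hat X = 0 → X = 0
  skew : ∀ X v w, β (hat X v) w = -β v (hat X w)
  comm : ∀ X x v, hat X (ρ x v) = ρ x (hat X v)
  exists_hat : ∀ T : Module.End ℝ M, (∀ x v, T (ρ x v) = ρ x (T v)) →
    (∀ v w, β (T v) w = -β v (T w)) → ∃ X, hat X = T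

theorem IsModel.injective {ρ : Cl0 r →ₐ[ℝ] Module.End ℝ M} {β : LinearMap.BilinForm ℝ M}
    {hat : L →ₗ[ℝ] Module.End ℝ M} {aA : Cl0 r → Module.End ℂ T} {aL : L → Module.End ℂ T}
    {F : M →ₗ[ℝ] T} (h : IsModel ρ β hat aA aL F) {v w : M} (e : F v = F w) : v = w := by
  have := (h.inj (v - w) 0 (by simp [e])).1
  exact sub_eq_zero.1 this

/-- Compatibility with brackets is required only on the complex side, where it is matrix
multiplication; injectivity of `F` brings it back to the real side. -/
theorem IsModel.hat_lie {ρ : Cl0 r →ₐ[ℝ] Module.End ℝ M} {β : LinearMap.BilinForm ℝ M}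
    {hat : L →ₗ[ℝ] Module.End ℝ M} {aA : Cl0 r → Module.End ℂ T} {aL : L → Module.End ℂ T}
    {F : M →ₗ[ℝ] T} (h : IsModel ρ β hat aA aL F) (X Y : L) (v : M) :
    hat ⁅X, Y⁆ v = hat X (hat Y v) - hat Y (hat X v) := by
  apply h.injective
  rw [map_sub, h.map_hat, h.map_hat, h.map_hat, h.map_hat, h.map_hat, h.lie]
  simp

/-- Conjugation by the isometry `e` carries the image of `hat` onto the centralizer. Surjectivity is
the one point with content: an element of the centralizer commutes with bivectors only by
definition, and must be shown to commute with all of the even algebra. -/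
theorem exists_lieEquiv_of_isModel {N : ℕ} {Φ : RealRep r N} (hΦ : Φ 1 = 1)
    {B : LinearMap.BilinForm ℝ (RSpace N)}
    {ρ : Cl0 r →ₐ[ℝ] Module.End ℝ M} {β : LinearMap.BilinForm ℝ M}
    {hat : L →ₗ[ℝ] Module.End ℝ M} {aA : Cl0 r → Module.End ℂ T} {aL : L → Module.End ℂ T}
    {F : M →ₗ[ℝ] T} (h : IsModel ρ β hat aA aL F) (e : M ≃ₗ[ℝ] RSpace N)
    (heA : ∀ x v, e (ρ x v) = Φ x (e v)) (heB : ∀ v w, B (e v) (e w) = β v w) :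
    ∃ θ : spinCentralizer Φ B ≃ₗ⁅ℝ⁆ L,
      ∀ (A : spinCentralizer Φ B) v, (A : Module.End ℝ (RSpace N)) (e v) = e (hat (θ A) v) := by
  have hmem : ∀ X, e.conj (hat X) ∈ spinCentralizer Φ B := by
    intro X
    refine ⟨?_, ?_⟩
    · intro v w
      obtain ⟨v, rfl⟩ := e.surjective v
      obtain ⟨w, rfl⟩ := e.surjective w
      simp [LinearEquiv.conj_apply, heB, h.skew]
    · rintro _ ⟨x, -, rfl⟩
      rw [LieRing.of_associative_ring_bracket, sub_eq_zero]
      refine LinearMap.ext fun v => ?_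
      obtain ⟨v, rfl⟩ := e.surjective v
      simp [LinearEquiv.conj_apply, ← heA, h.comm]
  let η : L →ₗ⁅ℝ⁆ spinCentralizer Φ B :=
    { toFun := fun X => ⟨e.conj (hat X), hmem X⟩
      map_add' := fun X Y => by ext1; simp
      map_smul' := fun c X => by ext1; simp
      map_lie' := fun {X Y} => by
        apply Subtype.ext
        rw [LieSubalgebra.coe_bracket, LieRing.of_associative_ring_bracket]
        refine LinearMap.ext fun v => ?_
        simp [LinearEquiv.conj_apply, h.hat_lie] }
  have hη : ∀ X v, (η X : Module.End ℝ (RSpace N)) (e v) = e (hat X v) := fun X v => by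
    change e.conj (hat X) (e v) = _
    simp [LinearEquiv.conj_apply]
  have hbij : Function.Bijective η := by
    constructor
    · rw [injective_iff_map_eq_zero]
      intro X hX
      refine h.hat_inj X (LinearMap.ext fun v => e.injective ?_)
      rw [← hη, hX]
      simp
    · rintro ⟨A, hA⟩
      have hcomm : ∀ x v, A (unitalRep Φ hΦ x v) = unitalRep Φ hΦ x (A v) := fun x =>
        intertwines_of_bivector _ _ A (fun i j hij v => by
          have := hA.2 (Φ (bivector r i j)) ⟨_, Submodule.subset_span ⟨i, j, hij, rfl⟩, rfl⟩
          rw [LieRing.of_associative_ring_bracket, sub_eq_zero] at this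
          exact LinearMap.congr_fun this v) x
      obtain ⟨X, hX⟩ := h.exists_hat (e.symm.conj A)
        (fun x v => e.injective (by
          simp only [LinearEquiv.conj_apply, LinearMap.comp_apply, LinearEquiv.coe_coe,
            LinearEquiv.symm_symm, heA, LinearEquiv.apply_symm_apply]
          exact hcomm x (e v)))
        (fun v w => by
          have h1 := hA.1 (e v) (e w)
          simp only [LinearEquiv.conj_apply, LinearMap.comp_apply, LinearEquiv.coe_coe,
            LinearEquiv.symm_symm, ← heB, LinearEquiv.apply_symm_apply]
          simpa using h1)
      refine ⟨X, Subtype.ext (LinearMap.ext fun v => ?_)⟩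
      obtain ⟨v, rfl⟩ := e.surjective v
      rw [hη, hX]
      simp [LinearEquiv.conj_apply]
  refine ⟨(LieEquiv.ofBijective η hbij).symm, fun A v => ?_⟩
  rw [← hη]
  congr 2
  exact ((LieEquiv.ofBijective η hbij).apply_symm_apply A).symm

/-- A real linear map that exhibits `T` as complexification of `M` induces an isomorphism. -/
theorem exists_complexification_equiv [IsScalarTower ℝ ℂ T] {V : Type} [AddCommGroup V] [Module ℝ V] (F : V →ₗ[ℝ] T)
    (inj : ∀ v w, F v + Complex.I • F w = 0 → v = 0 ∧ w = 0)
    (surj : ∀ t, ∃ v w, F v + Complex.I • F w = t) :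
    ∃ G : (ℂ ⊗[ℝ] V) ≃ₗ[ℂ] T, ∀ z v, G (z ⊗ₜ v) = z • F v := by
  let G : (ℂ ⊗[ℝ] V) →ₗ[ℂ] T := F.liftBaseChange ℂ
  have hG : ∀ z v, G (z ⊗ₜ v) = z • F v := fun z v => LinearMap.liftBaseChange_tmul ..
  have hre : ∀ x : ℂ ⊗[ℝ] V, ∃ v w : V, x = 1 ⊗ₜ v + Complex.I ⊗ₜ w := by
    intro x
    induction x using TensorProduct.induction_on with
    | zero => exact ⟨0, 0, by simp⟩
    | tmul z v =>
      refine ⟨z.re • v, z.im • v, ?_⟩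
      rw [← TensorProduct.smul_tmul, ← TensorProduct.smul_tmul, ← TensorProduct.add_tmul]
      congr 1
      apply Complex.ext <;> simp
    | add x y hx hy =>
      obtain ⟨v, w, rfl⟩ := hx
      obtain ⟨v', w', rfl⟩ := hy
      refine ⟨v + v', w + w', ?_⟩
      rw [TensorProduct.tmul_add, TensorProduct.tmul_add]
      abel
  have hbij : Function.Bijective G := by
    constructor
    · rw [injective_iff_map_eq_zero]
      intro x hx
      obtain ⟨v, w, rfl⟩ := hre x
      rw [map_add, hG, hG, one_smul] at hx
      obtain ⟨rfl, rfl⟩ := inj v w hx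
      simp
    · intro t
      obtain ⟨v, w, rfl⟩ := surj t
      exact ⟨1 ⊗ₜ v + Complex.I ⊗ₜ w, by rw [map_add, hG, hG, one_smul]⟩
  exact ⟨LinearEquiv.ofBijective G hbij, hG⟩

theorem exists_decomp_of_isModel [IsScalarTower ℝ ℂ T] {N : ℕ} {Φ : RealRep r N} (hΦ : Φ 1 = 1)
    {B : LinearMap.BilinForm ℝ (RSpace N)}
    {ρ : Cl0 r →ₐ[ℝ] Module.End ℝ M} {β : LinearMap.BilinForm ℝ M}
    {hat : L →ₗ[ℝ] Module.End ℝ M} {aA : Cl0 r → Module.End ℂ T} {aL : L → Module.End ℂ T}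
    {F : M →ₗ[ℝ] T} (h : IsModel ρ β hat aA aL F) (e : M ≃ₗ[ℝ] RSpace N)
    (heA : ∀ x v, e (ρ x v) = Φ x (e v)) (heB : ∀ v w, B (e v) (e w) = β v w) :
    ∃ θ : spinCentralizer Φ B ≃ₗ⁅ℝ⁆ L,
      (∀ (A : spinCentralizer Φ B) v,
        (A : Module.End ℝ (RSpace N)) (e v) = e (hat (θ A) v)) ∧
      ∃ G : (ℂ ⊗[ℝ] RSpace N) ≃ₗ[ℂ] T, (∀ x z, G ((Φ x).baseChange ℂ z) = aA x (G z)) ∧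
        ∀ (A : spinCentralizer Φ B) z,
          G ((A : Module.End ℝ (RSpace N)).baseChange ℂ z) = aL (θ A) (G z) := by
  obtain ⟨θ, hθ⟩ := exists_lieEquiv_of_isModel hΦ h e heA heB
  obtain ⟨G, hG⟩ := exists_complexification_equiv (F ∘ₗ e.symm.toLinearMap)
    (fun v w hvw => by
      have := h.inj _ _ hvw
      simpa using this)
    (fun t => by
      obtain ⟨v, w, rfl⟩ := h.surj t
      exact ⟨e v, e w, by simp⟩)
  refine ⟨θ, hθ, G, fun x z => ?_, fun A z => ?_⟩
  · induction z using TensorProduct.induction_on with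
    | zero => simp
    | tmul z v =>
      obtain ⟨v, rfl⟩ := e.surjective v
      rw [LinearMap.baseChange_tmul, hG, hG, ← heA, map_smul]
      simp [h.map_act]
    | add x y hx hy => simp only [map_add, hx, hy]
  · induction z using TensorProduct.induction_on with
    | zero => simp
    | tmul z v =>
      obtain ⟨v, rfl⟩ := e.surjective v
      rw [LinearMap.baseChange_tmul, hG, hG, hθ, map_smul]
      simp [h.map_hat]
    | add x y hx hy => simp only [map_add, hx, hy]

end Model

/-! ### Orthogonal direct sums of models. -/

section ProdModel

variable {r : ℕ} {M₁ L₁ T₁ M₂ L₂ T₂ : Type} [AddCommGroup M₁] [Module ℝ M₁] [LieRing L₁]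
  [LieAlgebra ℝ L₁] [AddCommGroup T₁] [Module ℂ T₁] [Module ℝ T₁]
  [AddCommGroup M₂] [Module ℝ M₂] [LieRing L₂]
  [LieAlgebra ℝ L₂] [AddCommGroup T₂] [Module ℂ T₂] [Module ℝ T₂]

/-- Direct sum of two representations. -/
def prodRep (ρ₁ : Cl0 r →ₐ[ℝ] Module.End ℝ M₁) (ρ₂ : Cl0 r →ₐ[ℝ] Module.End ℝ M₂) :
    Cl0 r →ₐ[ℝ] Module.End ℝ (M₁ × M₂) :=
  AlgHom.ofLinearMap
    { toFun := fun x => (ρ₁ x).prodMap (ρ₂ x)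
      map_add' := fun x y => by refine LinearMap.ext fun v => ?_; simp
      map_smul' := fun c x => by refine LinearMap.ext fun v => ?_; simp }
    (by refine LinearMap.ext fun v => ?_; simp)
    (fun x y => by refine LinearMap.ext fun v => ?_; simp)

@[simp]
theorem prodRep_apply (ρ₁ : Cl0 r →ₐ[ℝ] Module.End ℝ M₁) (ρ₂ : Cl0 r →ₐ[ℝ] Module.End ℝ M₂)
    (x : Cl0 r) (v : M₁ × M₂) : prodRep ρ₁ ρ₂ x v = (ρ₁ x v.1, ρ₂ x v.2) := rfl

/-- Orthogonal direct sum of two forms. -/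
def prodForm (β₁ : LinearMap.BilinForm ℝ M₁) (β₂ : LinearMap.BilinForm ℝ M₂) :
    LinearMap.BilinForm ℝ (M₁ × M₂) :=
  LinearMap.mk₂ ℝ (fun s t => β₁ s.1 t.1 + β₂ s.2 t.2)
    (fun v v' w => by simp; ring) (fun c v w => by simp; ring)
    (fun v w w' => by simp; ring) (fun c v w => by simp; ring)

theorem prodForm_apply (β₁ : LinearMap.BilinForm ℝ M₁) (β₂ : LinearMap.BilinForm ℝ M₂)
    (s t : M₁ × M₂) : prodForm β₁ β₂ s t = β₁ s.1 t.1 + β₂ s.2 t.2 := rfl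

/-- Componentwise action of a product of Lie algebras. -/
def prodHat (hat₁ : L₁ →ₗ[ℝ] Module.End ℝ M₁) (hat₂ : L₂ →ₗ[ℝ] Module.End ℝ M₂) :
    (L₁ × L₂) →ₗ[ℝ] Module.End ℝ (M₁ × M₂) where
  toFun X := (hat₁ X.1).prodMap (hat₂ X.2)
  map_add' := fun x y => by refine LinearMap.ext fun v => ?_; simp
  map_smul' := fun c x => by refine LinearMap.ext fun v => ?_; simp

/-- Without intertwiners between the two summands, an element of the commutant is block diagonal,
and everything else is componentwise. -/
theorem IsModel.prod {ρ₁ : Cl0 r →ₐ[ℝ] Module.End ℝ M₁} {β₁ : LinearMap.BilinForm ℝ M₁}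
    {hat₁ : L₁ →ₗ[ℝ] Module.End ℝ M₁} {aA₁ : Cl0 r → Module.End ℂ T₁} {aL₁ : L₁ → Module.End ℂ T₁}
    {F₁ : M₁ →ₗ[ℝ] T₁} (h₁ : IsModel ρ₁ β₁ hat₁ aA₁ aL₁ F₁)
    {ρ₂ : Cl0 r →ₐ[ℝ] Module.End ℝ M₂} {β₂ : LinearMap.BilinForm ℝ M₂}
    {hat₂ : L₂ →ₗ[ℝ] Module.End ℝ M₂} {aA₂ : Cl0 r → Module.End ℂ T₂} {aL₂ : L₂ → Module.End ℂ T₂}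
    {F₂ : M₂ →ₗ[ℝ] T₂} (h₂ : IsModel ρ₂ β₂ hat₂ aA₂ aL₂ F₂)
    (h₁₂ : ∀ f : M₁ →ₗ[ℝ] M₂, (∀ x v, f (ρ₁ x v) = ρ₂ x (f v)) → f = 0)
    (h₂₁ : ∀ f : M₂ →ₗ[ℝ] M₁, (∀ x v, f (ρ₂ x v) = ρ₁ x (f v)) → f = 0) :
    IsModel (prodRep ρ₁ ρ₂) (prodForm β₁ β₂) (prodHat hat₁ hat₂)
      (fun x => (aA₁ x).prodMap (aA₂ x)) (fun X : L₁ × L₂ => (aL₁ X.1).prodMap (aL₂ X.2))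
      (F₁.prodMap F₂) where
  lie X Y := by
    refine LinearMap.ext fun v => ?_
    change ((aL₁ ⁅X.1, Y.1⁆).prodMap (aL₂ ⁅X.2, Y.2⁆)) v = _
    simp [h₁.lie, h₂.lie]
  map_act x v := by simp [h₁.map_act, h₂.map_act]
  map_hat X v := by simp [prodHat, h₁.map_hat, h₂.map_hat]
  inj v w h := by
    have h' := Prod.ext_iff.1 h
    obtain ⟨a, b⟩ := h₁.inj v.1 w.1 (by simpa using h'.1)
    obtain ⟨c, d⟩ := h₂.inj v.2 w.2 (by simpa using h'.2)
    exact ⟨Prod.ext a c, Prod.ext b d⟩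
  surj t := by
    obtain ⟨v₁, w₁, e₁⟩ := h₁.surj t.1
    obtain ⟨v₂, w₂, e₂⟩ := h₂.surj t.2
    exact ⟨(v₁, v₂), (w₁, w₂), Prod.ext (by simpa using e₁) (by simpa using e₂)⟩
  hat_inj X hX := by
    refine Prod.ext (h₁.hat_inj _ (LinearMap.ext fun v => ?_))
      (h₂.hat_inj _ (LinearMap.ext fun v => ?_))
    · exact congrArg Prod.fst (LinearMap.congr_fun hX (v, 0))
    · exact congrArg Prod.snd (LinearMap.congr_fun hX (0, v))
  skew X v w := by
    simp only [prodForm_apply, prodHat, LinearMap.coe_mk, AddHom.coe_mk, LinearMap.prodMap_apply,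
      h₁.skew, h₂.skew]
    ring
  comm X x v := by simp [prodHat, h₁.comm, h₂.comm]
  exists_hat T hT hs := by
    have hc : ∀ x v, T (ρ₁ x v.1, ρ₂ x v.2) = (ρ₁ x (T v).1, ρ₂ x (T v).2) := hT
    have z₁₂ := h₁₂ (LinearMap.snd ℝ M₁ M₂ ∘ₗ T ∘ₗ LinearMap.inl ℝ M₁ M₂) fun x v => by
      have := hc x (v, 0)
      simp only [map_zero] at this
      simp [this]
    have z₂₁ := h₂₁ (LinearMap.fst ℝ M₁ M₂ ∘ₗ T ∘ₗ LinearMap.inr ℝ M₁ M₂) fun x v => by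
      have := hc x (0, v)
      simp only [map_zero] at this
      simp [this]
    obtain ⟨X₁, hX₁⟩ := h₁.exists_hat (LinearMap.fst ℝ M₁ M₂ ∘ₗ T ∘ₗ LinearMap.inl ℝ M₁ M₂)
      (fun x v => by
        have := hc x (v, 0)
        simp only [map_zero] at this
        simp [this])
      (fun v w => by simpa [prodForm_apply] using hs (v, 0) (w, 0))
    obtain ⟨X₂, hX₂⟩ := h₂.exists_hat (LinearMap.snd ℝ M₁ M₂ ∘ₗ T ∘ₗ LinearMap.inr ℝ M₁ M₂)
      (fun x v => by
        have := hc x (0, v)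
        simp only [map_zero] at this
        simp [this])
      (fun v w => by simpa [prodForm_apply] using hs (0, v) (0, w))
    refine ⟨(X₁, X₂), LinearMap.ext fun v => ?_⟩
    have hv : T v = T (v.1, 0) + T (0, v.2) := by rw [← map_add]; simp
    have a := LinearMap.congr_fun z₁₂ v.1
    have b := LinearMap.congr_fun z₂₁ v.2
    simp only [LinearMap.comp_apply, LinearMap.inl_apply, LinearMap.inr_apply,
      LinearMap.fst_apply, LinearMap.snd_apply, LinearMap.zero_apply] at a b
    rw [hv]
    simp only [prodHat, LinearMap.coe_mk, AddHom.coe_mk, hX₁, hX₂, LinearMap.prodMap_apply]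
    refine Prod.ext ?_ ?_
    · simp [b]
    · simp [a]

end ProdModel

/-! ### Representations of real, complex and quaternionic type -/

section MatrixAction

variable {ι R K : Type} [Fintype ι] [CommRing R] [AddCommGroup K] [Module R K]

/-- The action of matrices on `ι → K`. -/
def matAct (K : Type) [AddCommGroup K] [Module R K] (Y : Matrix ι ι R) : Module.End R (ι → K) where
  toFun t a := ∑ b, Y a b • t b
  map_add' t t' := by ext a; simp [Finset.sum_add_distrib]
  map_smul' c t := by ext a; simp [Finset.smul_sum, smul_smul, mul_comm]

theorem matAct_apply (Y : Matrix ι ι R) (t : ι → K) (a : ι) :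
    matAct K Y t a = ∑ b, Y a b • t b := rfl

theorem matAct_mul (X Y : Matrix ι ι R) : matAct K (X * Y) = matAct K X * matAct K Y := by
  refine LinearMap.ext fun t => funext fun a => ?_
  simp only [Module.End.mul_apply, matAct_apply, Matrix.mul_apply, Finset.sum_smul,
    Finset.smul_sum, smul_smul]
  exact Finset.sum_comm

theorem matAct_sub (X Y : Matrix ι ι R) : matAct K (X - Y) = matAct K X - matAct K Y := by
  refine LinearMap.ext fun t => funext fun a => ?_
  simp [matAct_apply, sub_smul]

theorem matAct_lie [DecidableEq ι] (X Y : Matrix ι ι R) :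
    matAct K ⁅X, Y⁆ = matAct K X * matAct K Y - matAct K Y * matAct K X := by
  rw [LieRing.of_associative_ring_bracket, matAct_sub, matAct_mul, matAct_mul]

theorem eq_zero_of_matAct_eq_zero [DecidableEq ι] [IsDomain R] [Module.IsTorsionFree R K]
    [Nontrivial K] (Y : Matrix ι ι R) (h : ∀ t : ι → K, matAct K Y t = 0) : Y = 0 := by
  obtain ⟨k, hk⟩ := exists_ne (0 : K)
  ext a b
  have := congrFun (h (Pi.single b k)) a
  rw [matAct_apply, Finset.sum_eq_single b] at this
  · simpa [hk] using this
  · intro c _ hc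
    simp [hc]
  · simp

end MatrixAction

section Components

variable {r m : ℕ} {S : Type} [AddCommGroup S] [Module ℝ S]

/-- The entries of a skew-symmetric intertwiner of `Fin m → S`. -/
theorem exists_components {ρ : Cl0 r →ₐ[ℝ] Module.End ℝ S} {β : LinearMap.BilinForm ℝ S}
    (T : Module.End ℝ (Fin m → S)) (hT : ∀ x v, T (piRep m ρ x v) = piRep m ρ x (T v))
    (hs : ∀ v w, sumForm m β (T v) w = -sumForm m β v (T w)) :
    ∃ C : Fin m → Fin m → Module.End ℝ S, (∀ a b x s, C a b (ρ x s) = ρ x (C a b s)) ∧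
      (∀ a b s t, β (C a b s) t = -β s (C b a t)) ∧ ∀ v a, T v a = ∑ b, C a b (v b) := by
  refine ⟨fun a b => LinearMap.proj a ∘ₗ T ∘ₗ LinearMap.single ℝ (fun _ => S) b,
    fun a b x s => ?_, fun a b s t => ?_, fun v a => ?_⟩
  · have h : Pi.single b (ρ x s) = piRep m ρ x (Pi.single b s) := by
      ext c
      by_cases hc : c = b
      · subst hc; simp
      · simp [hc]
    simp [h, hT]
  · have h := hs (Pi.single b s) (Pi.single a t)
    rw [sumForm_apply, sumForm_apply, Finset.sum_eq_single a, Finset.sum_eq_single b] at h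
    · simpa using h
    · intro c _ hc; simp [hc]
    · simp
    · intro c _ hc; simp [hc]
    · simp
  · conv_lhs => rw [← Finset.univ_sum_single v]
    simp

end Components

/-! ### Real structures on complex vector spaces. -/

theorem I_smul_I_smul {K : Type} [AddCommGroup K] [Module ℂ K] (v : K) :
    Complex.I • Complex.I • v = -v := by
  rw [smul_smul, Complex.I_mul_I, neg_one_smul]

/-- The fixed points of a real structure. -/
def fixedPoints {K : Type} [AddCommGroup K] [Module ℝ K] (j : K →ₗ[ℝ] K) : Submodule ℝ K :=
  LinearMap.eqLocus j LinearMap.id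

theorem mem_fixedPoints {K : Type} [AddCommGroup K] [Module ℝ K] {j : K →ₗ[ℝ] K} {v : K} :
    v ∈ fixedPoints j ↔ j v = v := Iff.rfl

/-- The projection to the fixed points of a real structure. -/
def realPart {K : Type} [AddCommGroup K] [Module ℝ K] (j : K →ₗ[ℝ] K) (hjj : ∀ v, j (j v) = v) :
    K →ₗ[ℝ] fixedPoints j where
  toFun v := ⟨(1 / 2 : ℝ) • (v + j v), by
    rw [mem_fixedPoints, map_smul, map_add, hjj, add_comm]⟩
  map_add' v w := by
    apply Subtype.ext
    simp only [map_add, Submodule.coe_add]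
    module
  map_smul' c v := by
    apply Subtype.ext
    simp only [map_smul, Submodule.coe_smul, RingHom.id_apply]
    module

theorem realPart_apply {K : Type} [AddCommGroup K] [Module ℝ K] (j : K →ₗ[ℝ] K) (hjj : ∀ v, j (j v) = v)
    (v : K) :
    (realPart j hjj v : K) = (1 / 2 : ℝ) • (v + j v) := rfl

section Types

set_option linter.unusedSectionVars false

variable {r : ℕ} {K K' : Type} [AddCommGroup K] [Module ℂ K] [Module ℝ K] [IsScalarTower ℝ ℂ K]
  [AddCommGroup K'] [Module ℂ K'] [Module ℝ K'] [IsScalarTower ℝ ℂ K']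

theorem complex_smul_eq (z : ℂ) (v : K) : z • v = z.re • v + z.im • (Complex.I • v) := by
  rw [← smul_assoc, ← algebraMap_smul ℂ z.re v, ← add_smul]
  congr 1
  apply Complex.ext <;> simp

theorem map_complex_smul (f : K →ₗ[ℝ] K') (hf : ∀ v, f (Complex.I • v) = Complex.I • f v) (z : ℂ)
    (v : K) : f (z • v) = z • f v := by
  rw [complex_smul_eq z v, complex_smul_eq z (f v), map_add, map_smul, map_smul, hf]

theorem map_conj_smul (f : K →ₗ[ℝ] K') (hf : ∀ v, f (Complex.I • v) = -(Complex.I • f v)) (z : ℂ)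
    (v : K) : f (z • v) = (starRingEnd ℂ z) • f v := by
  rw [complex_smul_eq z v, complex_smul_eq _ (f v), map_add, map_smul, map_smul, hf]
  simp

/-- An irreducible complex representation with an invariant Hermitian inner product, whose real part
is `β`. -/
structure SpinorForm (s : Cl0 r →ₐ[ℝ] Module.End ℂ K) (β : LinearMap.BilinForm ℝ K) : Prop where
  inner : InvariantInner (restrictReal s) β
  I_skew : ∀ v w, β (Complex.I • v) w = -β v (Complex.I • w)
  schur : ∀ T : Module.End ℂ K, (∀ x v, T (s x v) = s x (T v)) → ∃ z : ℂ, ∀ v, T v = z • v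

/-- Real endomorphisms commuting with `i` and with the representation are complex scalars. -/
theorem SpinorForm.schur_real {s : Cl0 r →ₐ[ℝ] Module.End ℂ K} {β : LinearMap.BilinForm ℝ K}
    (h : SpinorForm s β) (T : Module.End ℝ K) (hI : ∀ v, T (Complex.I • v) = Complex.I • T v)
    (hT : ∀ x v, T (s x v) = s x (T v)) : ∃ z : ℂ, ∀ v, T v = z • v :=
  h.schur { toFun := T, map_add' := map_add T, map_smul' := map_complex_smul T hI } hT

theorem SpinorForm.smul_left {s : Cl0 r →ₐ[ℝ] Module.End ℂ K} {β : LinearMap.BilinForm ℝ K}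
    (h : SpinorForm s β) (z : ℂ) (v w : K) : β (z • v) w = β v ((starRingEnd ℂ z) • w) := by
  rw [complex_smul_eq z v, complex_smul_eq _ w]
  simp [h.I_skew]

theorem SpinorForm.self_I {s : Cl0 r →ₐ[ℝ] Module.End ℂ K} {β : LinearMap.BilinForm ℝ K}
    (h : SpinorForm s β) (v : K) : β v (Complex.I • v) = 0 := by
  have := h.I_skew v v
  rw [h.inner.symm] at this
  linarith

theorem SpinorForm.self_smul {s : Cl0 r →ₐ[ℝ] Module.End ℂ K} {β : LinearMap.BilinForm ℝ K}
    (h : SpinorForm s β) (z : ℂ) (v : K) : β v (z • v) = z.re * β v v := by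
  rw [complex_smul_eq z v]
  simp [h.self_I]

/-- Since v and iv are orthogonal, pairing zv with v and with iv isolates the real and the imaginary
part of z. This is how complex entries are recovered from the real form. -/
theorem SpinorForm.I_self_smul {s : Cl0 r →ₐ[ℝ] Module.End ℂ K} {β : LinearMap.BilinForm ℝ K}
    (h : SpinorForm s β) (z : ℂ) (v : K) : β (Complex.I • v) (z • v) = z.im * β v v := by
  rw [h.I_skew, smul_smul, h.self_smul]
  simp

/-! #### Real type -/

/-- The representation on the fixed points of an equivariant real structure. -/
def fixedRep (s : Cl0 r →ₐ[ℝ] Module.End ℂ K) (j : K →ₗ[ℝ] K)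
    (hj : ∀ x v, j (s x v) = s x (j v)) : Cl0 r →ₐ[ℝ] Module.End ℝ (fixedPoints j) :=
  AlgHom.ofLinearMap
    { toFun := fun x => (restrictReal s x).restrict (p := fixedPoints j) (q := fixedPoints j)
        (fun v hv => by
          rw [mem_fixedPoints] at hv ⊢
          rw [restrictReal_apply, hj, hv])
      map_add' := fun x y => by ext; simp
      map_smul' := fun c x => by ext; simp }
    (by ext; simp) (fun x y => by ext; simp)

theorem fixedRep_apply (s : Cl0 r →ₐ[ℝ] Module.End ℂ K) (j : K →ₗ[ℝ] K)
    (hj : ∀ x v, j (s x v) = s x (j v)) (x : Cl0 r) (v : fixedPoints j) :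
    (fixedRep s j hj x v : K) = s x v := rfl

/-- The imaginary part of v is the real part of -iv. -/
theorem realPart_add_I_smul (j : K →ₗ[ℝ] K) (hjI : ∀ v, j (Complex.I • v) = -(Complex.I • j v))
    (hjj : ∀ v, j (j v) = v) (v : K) :
    (realPart j hjj v : K) + Complex.I • (realPart j hjj (-(Complex.I • v)) : K) = v := by
  rw [realPart_apply, realPart_apply]
  simp only [map_neg, hjI, smul_comm Complex.I (1 / 2 : ℝ), smul_add, smul_neg,
    neg_neg, I_smul_I_smul]
  module

theorem realPart_coe (j : K →ₗ[ℝ] K) (hjj : ∀ v, j (j v) = v) (v : fixedPoints j) :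
    realPart j hjj v = v := by
  apply Subtype.ext
  rw [realPart_apply, mem_fixedPoints.1 v.2]
  module

theorem realPart_I_smul_coe (j : K →ₗ[ℝ] K) (hjI : ∀ v, j (Complex.I • v) = -(Complex.I • j v))
    (hjj : ∀ v, j (j v) = v) (v : fixedPoints j) :
    realPart j hjj (Complex.I • (v : K)) = 0 := by
  apply Subtype.ext
  rw [realPart_apply, hjI, mem_fixedPoints.1 v.2]
  simp

theorem fixedPoints_inj (j : K →ₗ[ℝ] K) (hjI : ∀ v, j (Complex.I • v) = -(Complex.I • j v))
    (hjj : ∀ v, j (j v) = v) (v w : fixedPoints j)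
    (e : (fixedPoints j).subtype v + Complex.I • (fixedPoints j).subtype w = 0) :
    v = 0 ∧ w = 0 := by
  have ea : (v : K) + Complex.I • (w : K) = 0 := e
  have h1 := congrArg (realPart j hjj) ea
  have h2 := congrArg (realPart j hjj) (congrArg (fun u => Complex.I • u) ea)
  rw [map_add, realPart_coe, realPart_I_smul_coe j hjI, map_zero, add_zero] at h1
  simp only [smul_add, I_smul_I_smul, smul_zero, map_add, map_zero, map_neg, realPart_coe,
    realPart_I_smul_coe j hjI, zero_add, neg_eq_zero] at h2
  exact ⟨h1, h2⟩

theorem fixedPoints_surj (j : K →ₗ[ℝ] K) (hjI : ∀ v, j (Complex.I • v) = -(Complex.I • j v))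
    (hjj : ∀ v, j (j v) = v) (t : K) : ∃ v w : fixedPoints j,
      (fixedPoints j).subtype v + Complex.I • (fixedPoints j).subtype w = t :=
  ⟨realPart j hjj t, realPart j hjj (-(Complex.I • t)), realPart_add_I_smul j hjI hjj t⟩

/-- Extended complex linearly to K, the endomorphism is a complex scalar by Schur's lemma. It
preserves the fixed points of an antilinear map, so the scalar is real. -/
theorem fixed_commutant {s : Cl0 r →ₐ[ℝ] Module.End ℂ K} {β : LinearMap.BilinForm ℝ K}
    (h : SpinorForm s β) (j : K →ₗ[ℝ] K) (hjI : ∀ v, j (Complex.I • v) = -(Complex.I • j v))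
    (hjj : ∀ v, j (j v) = v) (hj : ∀ x v, j (s x v) = s x (j v))
    (T : Module.End ℝ (fixedPoints j))
    (hT : ∀ x v, T (fixedRep s j hj x v) = fixedRep s j hj x (T v)) :
    ∃ c : ℝ, ∀ v, T v = c • v := by
  let ι := (fixedPoints j).subtype
  let i : K →ₗ[ℝ] K := (LinearMap.lsmul ℂ K Complex.I).restrictScalars ℝ
  have hi : ∀ v, i v = Complex.I • v := fun v => rfl
  let P := realPart j hjj
  -- The complex linear extension v ↦ T(Re v) + i T(Im v), with Im v = -Re(iv).
  let T' : Module.End ℝ K := ι ∘ₗ T ∘ₗ P - i ∘ₗ ι ∘ₗ T ∘ₗ P ∘ₗ i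
  have hT' : ∀ v, T' v = (T (P v) : K) - Complex.I • (T (P (Complex.I • v)) : K) := fun v => rfl
  have hP : ∀ x v, P (s x v) = fixedRep s j hj x (P v) := by
    intro x v
    apply Subtype.ext
    rw [fixedRep_apply, realPart_apply, realPart_apply, hj, ← map_add]
    exact ((restrictReal s x).map_smul (1 / 2 : ℝ) (v + j v)).symm
  obtain ⟨z, hz⟩ := h.schur_real T'
    (fun v => by
      rw [hT', hT', I_smul_I_smul, smul_sub, I_smul_I_smul, map_neg, map_neg]
      simp only [Submodule.coe_neg, smul_neg]
      abel)
    (fun x v => by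
      rw [hT', hT', ← (s x).map_smul, hP, hP, hT, hT, fixedRep_apply, fixedRep_apply, map_sub,
        (s x).map_smul])
  refine ⟨z.re, fun v => ?_⟩
  have h1 : (T v : K) = z • (v : K) := by
    rw [← hz, hT']
    change _ = ((T (realPart j hjj v) : fixedPoints j) : K) -
      Complex.I • (T (realPart j hjj (Complex.I • (v : K))) : K)
    rw [realPart_coe, realPart_I_smul_coe j hjI, map_zero]
    simp
  -- Both sides are j(Tv) = Tv for the fixed vector v. This removes Im z • iv for each v separately,
  -- so the zero space needs no special treatment.
  have h2 : (starRingEnd ℂ z) • (v : K) = z • (v : K) := by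
    have := (T v).2
    rw [mem_fixedPoints, h1, map_conj_smul j hjI, mem_fixedPoints.1 v.2] at this
    exact this
  apply Subtype.ext
  rw [h1, Submodule.coe_smul]
  rw [complex_smul_eq, complex_smul_eq z] at h2
  simp only [Complex.conj_re, Complex.conj_im, neg_smul, add_right_inj] at h2
  have h3 : (2 : ℝ) • z.im • Complex.I • (v : K) = 0 := by
    rw [two_smul]
    nth_rewrite 1 [← h2]
    simp
  rw [complex_smul_eq z, (smul_eq_zero.1 h3).resolve_left two_ne_zero, add_zero]

theorem fixed_symmetricSchur {s : Cl0 r →ₐ[ℝ] Module.End ℂ K} {β : LinearMap.BilinForm ℝ K}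
    (h : SpinorForm s β) (j : K →ₗ[ℝ] K) (hjI : ∀ v, j (Complex.I • v) = -(Complex.I • j v))
    (hjj : ∀ v, j (j v) = v) (hj : ∀ x v, j (s x v) = s x (j v)) :
    SymmetricSchur (fixedRep s j hj) (β.restrict (fixedPoints j)) :=
  fun T hT _ => fixed_commutant h j hjI hjj hj T hT

theorem fixed_inner {s : Cl0 r →ₐ[ℝ] Module.End ℂ K} {β : LinearMap.BilinForm ℝ K}
    (h : SpinorForm s β) (j : K →ₗ[ℝ] K) (hj : ∀ x v, j (s x v) = s x (j v)) :
    InvariantInner (fixedRep s j hj) (β.restrict (fixedPoints j)) :=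
  ⟨fun _ _ => h.inner.symm _ _, fun v hv => h.inner.pos _ (by simpa using hv),
    fun i j hij _ _ => h.inner.skew i j hij _ _⟩

theorem fixed_nontrivial [Nontrivial K] (j : K →ₗ[ℝ] K)
    (hjI : ∀ v, j (Complex.I • v) = -(Complex.I • j v))
    (hjj : ∀ v, j (j v) = v) : Nontrivial (fixedPoints j) := by
  obtain ⟨k, hk⟩ := exists_ne (0 : K)
  by_contra hn
  rw [not_nontrivial_iff_subsingleton] at hn
  refine hk ?_
  rw [← realPart_add_I_smul j hjI hjj k, Subsingleton.elim (realPart j hjj k) 0,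
    Subsingleton.elim (realPart j hjj _) 0]
  simp

/-- Real type: entries of an endomorphism in the commutant of the m-fold sum are real numbers, and
skewness of the endomorphism is skewness of the matrix. The complexification is K^m itself, because
K is the complexification of the fixed points. -/
theorem isModel_real [Nontrivial K] {s : Cl0 r →ₐ[ℝ] Module.End ℂ K}
    {β : LinearMap.BilinForm ℝ K}
    (h : SpinorForm s β) (j : K →ₗ[ℝ] K) (hjI : ∀ v, j (Complex.I • v) = -(Complex.I • j v))
    (hjj : ∀ v, j (j v) = v) (hj : ∀ x v, j (s x v) = s x (j v)) (m : ℕ) :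
    IsModel (piRep m (fixedRep s j hj)) (sumForm m (β.restrict (fixedPoints j)))
      (L := so m)
      { toFun := fun Y => matAct (fixedPoints j) (Y : Matrix (Fin m) (Fin m) ℝ)
        map_add' := fun X Y => by
          refine LinearMap.ext fun t => funext fun a => ?_
          simp [matAct_apply, add_smul, Finset.sum_add_distrib]
        map_smul' := fun c Y => by
          refine LinearMap.ext fun t => funext fun a => ?_
          simp [matAct_apply, mul_smul, Finset.smul_sum] }
      (fun x => (s x).compLeft (Fin m))
      (fun Y => matAct K ((Y : Matrix (Fin m) (Fin m) ℝ).map Complex.ofReal))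
      ((fixedPoints j).subtype.compLeft (Fin m)) where
  lie X Y := by
    rw [← matAct_mul, ← matAct_mul, ← matAct_sub, LieSubalgebra.coe_bracket,
      LieRing.of_associative_ring_bracket]
    congr 1
    ext a b
    simp [Matrix.mul_apply]
  map_act x v := rfl
  map_hat X v := by
    ext a
    simp only [LinearMap.compLeft_apply, LinearMap.coe_mk, AddHom.coe_mk, matAct_apply,
      Function.comp_apply, map_sum, map_smul, Matrix.map_apply]
    exact Finset.sum_congr rfl fun b _ => (algebraMap_smul ℂ _ _).symm
  inj v w e := by
    have key : ∀ a, v a = 0 ∧ w a = 0 := fun a =>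
      fixedPoints_inj j hjI hjj _ _ (congrFun e a)
    exact ⟨funext fun a => (key a).1, funext fun a => (key a).2⟩
  surj t := ⟨fun a => realPart j hjj (t a), fun a => realPart j hjj (-(Complex.I • t a)),
    funext fun a => realPart_add_I_smul j hjI hjj (t a)⟩
  hat_inj X hX := by
    have := fixed_nontrivial j hjI hjj
    exact Subtype.ext (eq_zero_of_matAct_eq_zero _ fun t => LinearMap.congr_fun hX t)
  skew X v w := by
    have hX : ∀ a b, (X : Matrix (Fin m) (Fin m) ℝ) b a = -(X : Matrix (Fin m) (Fin m) ℝ) a b :=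
      fun a b => congrFun (congrFun ((LieAlgebra.Orthogonal.mem_so _ _ _).1 X.2) a) b
    simp only [sumForm_apply, LinearMap.coe_mk, AddHom.coe_mk, matAct_apply, map_sum, map_smul,
      LinearMap.sum_apply, LinearMap.smul_apply]
    rw [Finset.sum_comm, ← Finset.sum_neg_distrib]
    refine Finset.sum_congr rfl fun a _ => ?_
    rw [← Finset.sum_neg_distrib]
    refine Finset.sum_congr rfl fun b _ => ?_
    rw [hX, neg_smul]
  comm X x v := by
    ext1 a
    simp [matAct_apply]
  exists_hat T hT hs := by
    have := fixed_nontrivial j hjI hjj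
    obtain ⟨k, hk⟩ := exists_ne (0 : fixedPoints j)
    have hk' := (fixed_inner h j hj).pos k hk
    obtain ⟨C, hC, hCs, hTC⟩ := exists_components T hT hs
    choose c hc using fun a b => fixed_commutant h j hjI hjj hj (C a b) (hC a b)
    refine ⟨⟨Matrix.of c, ?_⟩, ?_⟩
    · rw [LieAlgebra.Orthogonal.mem_so]
      ext a b
      have := hCs b a k k
      simp only [hc, map_smul, LinearMap.smul_apply, smul_eq_mul] at this
      have h2 : (c b a + c a b) * β.restrict (fixedPoints j) k k = 0 := by linarith
      have := (mul_eq_zero.1 h2).resolve_right hk'.ne'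
      simp only [Matrix.transpose_apply, Matrix.of_apply, Matrix.neg_apply]
      linarith
    · refine LinearMap.ext fun v => funext fun a => ?_
      rw [hTC]
      simp [matAct_apply, hc]

end Types

/-! #### Complex type -/

section ComplexType

variable {r : ℕ} {K K' : Type} [AddCommGroup K] [Module ℂ K] [Module ℝ K] [IsScalarTower ℝ ℂ K]
  [AddCommGroup K'] [Module ℂ K'] [Module ℝ K'] [IsScalarTower ℝ ℂ K']

/-- Multiplication by i belongs to the image of the algebra, so a commuting real endomorphism is
automatically complex linear and Schur's lemma applies. -/
theorem complex_commutant {s : Cl0 r →ₐ[ℝ] Module.End ℂ K} {β : LinearMap.BilinForm ℝ K}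
    (h : SpinorForm s β) (ω : Cl0 r) (hω : ∀ v, s ω v = Complex.I • v)
    (T : Module.End ℝ K) (hT : ∀ x v, T (s x v) = s x (T v)) : ∃ z : ℂ, ∀ v, T v = z • v :=
  h.schur_real T (fun v => by rw [← hω, hT, hω]) hT

theorem complex_symmetricSchur [Nontrivial K] {s : Cl0 r →ₐ[ℝ] Module.End ℂ K}
    {β : LinearMap.BilinForm ℝ K}
    (h : SpinorForm s β) (ω : Cl0 r) (hω : ∀ v, s ω v = Complex.I • v) :
    SymmetricSchur (restrictReal s) β := by
  intro T hT hs
  obtain ⟨z, hz⟩ := complex_commutant h ω hω T hT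
  obtain ⟨k, hk⟩ := exists_ne (0 : K)
  -- Symmetry tested on the pair (ik, k) reads -Im z = Im z.
  have h1 := hs (Complex.I • k) k
  rw [h.inner.symm (T _), hz, hz, smul_smul, h.self_smul, h.I_self_smul] at h1
  have h2 := h.inner.pos k hk
  have h3 : z.im * β k k = 0 := by
    rw [Complex.mul_I_re] at h1
    linarith
  refine ⟨z.re, fun v => ?_⟩
  rw [hz, complex_smul_eq, (mul_eq_zero.1 h3).resolve_right h2.ne', zero_smul, add_zero]

/-- Complex type: the complexification of a complex space is the sum of the space and its conjugate,
here realized by v ↦ (v, jv) with the antilinear `j` identifying the conjugate of K with K'. Pushing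
a matrix through `j` conjugates its entries. -/
theorem isModel_complex [Nontrivial K] {s : Cl0 r →ₐ[ℝ] Module.End ℂ K}
    {s' : Cl0 r →ₐ[ℝ] Module.End ℂ K'} {β : LinearMap.BilinForm ℝ K} (h : SpinorForm s β)
    (ω : Cl0 r) (hω : ∀ v, s ω v = Complex.I • v)
    (j : K →ₗ[ℝ] K') (hjI : ∀ v, j (Complex.I • v) = -(Complex.I • j v))
    (hjb : Function.Bijective j) (hj : ∀ x v, j (s x v) = s' x (j v)) (m : ℕ) :
    IsModel (piRep m (restrictReal s)) (sumForm m β) (L := u m)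
      { toFun := fun Y => (matAct K (Y : Matrix (Fin m) (Fin m) ℂ)).restrictScalars ℝ
        map_add' := fun X Y => by
          refine LinearMap.ext fun t => funext fun a => ?_
          simp [matAct_apply, add_smul, Finset.sum_add_distrib]
        map_smul' := fun c Y => by
          refine LinearMap.ext fun t => funext fun a => ?_
          change ∑ b, (c • (Y : Matrix (Fin m) (Fin m) ℂ) a b) • t b = c • ∑ b, _ • t b
          rw [Finset.smul_sum]
          exact Finset.sum_congr rfl fun b _ => smul_assoc _ _ _ }
      (fun x => ((s x).compLeft (Fin m)).prodMap ((s' x).compLeft (Fin m)))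
      (fun Y => (matAct K (Y : Matrix (Fin m) (Fin m) ℂ)).prodMap
        (matAct K' ((Y : Matrix (Fin m) (Fin m) ℂ).map (starRingEnd ℂ))))
      (LinearMap.id.prod (j.compLeft (Fin m))) where
  lie X Y := by
    have h2 : ((⁅X, Y⁆ : u m) : Matrix (Fin m) (Fin m) ℂ).map (starRingEnd ℂ)
        = ⁅(X : Matrix (Fin m) (Fin m) ℂ).map (starRingEnd ℂ),
            (Y : Matrix (Fin m) (Fin m) ℂ).map (starRingEnd ℂ)⁆ := by
      rw [LieSubalgebra.coe_bracket, LieRing.of_associative_ring_bracket,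
        LieRing.of_associative_ring_bracket]
      ext a b
      simp [Matrix.mul_apply]
    rw [h2, LieSubalgebra.coe_bracket, matAct_lie, matAct_lie]
    rfl
  map_act x v := Prod.ext rfl (funext fun a => hj x (v a))
  map_hat X v := by
    refine Prod.ext rfl (funext fun a => ?_)
    change j (∑ b, _ • v b) = ∑ b, _ • j (v b)
    rw [map_sum]
    exact Finset.sum_congr rfl fun b _ => map_conj_smul j hjI _ _
  inj v w e := by
    have key : ∀ a, v a = 0 ∧ w a = 0 := fun a => by
      have e1 : v a + Complex.I • w a = 0 := congrFun (congrArg Prod.fst e) a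
      have e2 : j (v a) + Complex.I • j (w a) = 0 := congrFun (congrArg Prod.snd e) a
      -- By antilinearity the second component is j(v - iw), so the two components determine v + iw
      -- and v - iw independently.
      have e3 : v a - Complex.I • w a = 0 := hjb.1 (by
        rw [map_sub, hjI, sub_neg_eq_add, e2, map_zero])
      have e4 : (2 : ℝ) • v a = 0 := by
        rw [two_smul]
        nth_rewrite 2 [eq_neg_of_add_eq_zero_left e1]
        rw [← sub_eq_add_neg, e3]
      have e5 := (smul_eq_zero.1 e4).resolve_left two_ne_zero
      rw [e5, zero_add] at e1
      exact ⟨e5, (smul_eq_zero.1 e1).resolve_left Complex.I_ne_zero⟩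
    exact ⟨funext fun a => (key a).1, funext fun a => (key a).2⟩
  surj t := by
    choose y hy using fun a => hjb.2 (t.2 a)
    -- Solution of v + iw = t₁ and v - iw = y, where jy = t₂.
    refine ⟨fun a => (1 / 2 : ℝ) • (t.1 a + y a),
      fun a => (1 / 2 : ℝ) • (Complex.I • (y a - t.1 a)), Prod.ext (funext fun a => ?_)
        (funext fun a => ?_)⟩
    · change (1 / 2 : ℝ) • (t.1 a + y a) + Complex.I • ((1 / 2 : ℝ) • (Complex.I • (y a - t.1 a)))
        = t.1 a
      rw [smul_comm Complex.I, I_smul_I_smul]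
      module
    · change j ((1 / 2 : ℝ) • (t.1 a + y a)) +
        Complex.I • j ((1 / 2 : ℝ) • (Complex.I • (y a - t.1 a))) = t.2 a
      rw [map_smul, map_smul, hjI, smul_comm Complex.I, smul_neg, I_smul_I_smul, map_add, map_sub,
        hy]
      module
  hat_inj X hX :=
    Subtype.ext (eq_zero_of_matAct_eq_zero (K := K) _ fun t => LinearMap.congr_fun hX t)
  skew X v w := by
    have hX : ∀ a b, (starRingEnd ℂ) ((X : Matrix (Fin m) (Fin m) ℂ) b a)
        = -(X : Matrix (Fin m) (Fin m) ℂ) a b :=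
      fun a b => congrFun (congrFun X.2 a) b
    simp only [sumForm_apply, LinearMap.coe_mk, AddHom.coe_mk, LinearMap.restrictScalars_apply,
      matAct_apply, map_sum, LinearMap.sum_apply]
    rw [Finset.sum_comm, ← Finset.sum_neg_distrib]
    refine Finset.sum_congr rfl fun a _ => ?_
    rw [← Finset.sum_neg_distrib]
    refine Finset.sum_congr rfl fun b _ => ?_
    rw [h.smul_left, hX, neg_smul, map_neg]
  comm X x v := by
    ext1 a
    simp [matAct_apply]
  exists_hat T hT hs := by
    obtain ⟨k, hk⟩ := exists_ne (0 : K)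
    have hk' := h.inner.pos k hk
    obtain ⟨C, hC, hCs, hTC⟩ := exists_components T hT hs
    choose c hc using fun a b => complex_commutant h ω hω (C a b) (hC a b)
    refine ⟨⟨Matrix.of c, ?_⟩, ?_⟩
    · change (Matrix.of c)ᴴ = -Matrix.of c
      ext a b
      -- The pair (k, k) gives the relation between the real parts of opposite entries, and the pair
      -- (ik, k) the one between the imaginary parts.
      have h1 := hCs b a k k
      have h2 := hCs b a (Complex.I • k) k
      rw [hc, hc, h.inner.symm, h.self_smul, h.self_smul] at h1
      rw [hc, hc, h.inner.symm, smul_smul, h.self_smul, h.I_self_smul] at h2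
      have h3 : ((c b a).re + (c a b).re) * β k k = 0 := by linarith
      have h4 : ((c b a).im - (c a b).im) * β k k = 0 := by
        rw [Complex.mul_I_re] at h2
        linarith
      have h5 := (mul_eq_zero.1 h3).resolve_right hk'.ne'
      have h6 := (mul_eq_zero.1 h4).resolve_right hk'.ne'
      simp only [Matrix.conjTranspose_apply, Matrix.of_apply, Matrix.neg_apply]
      apply Complex.ext
      · simp
        linarith
      · simp
        linarith
    · refine LinearMap.ext fun v => funext fun a => ?_
      rw [hTC]
      simp [matAct_apply, hc]

end ComplexType

/-! #### Quaternionic type -/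

section QuaternionicType

/-- Given skew-Hermitian symmetry, the symplectic condition says that the blocks are A, B in the
first row and -B̄, Ā in the second. Thus the first row determines the matrix, and it stands for the
quaternionic matrix A + Bj with A skew-Hermitian and B symmetric. -/
theorem mem_sp_iff {m : ℕ} (Y : Matrix (Fin m ⊕ Fin m) (Fin m ⊕ Fin m) ℂ) :
    Y ∈ sp m ↔ (∀ a b, Y (.inr a) (.inl b) = -(starRingEnd ℂ) (Y (.inl a) (.inr b))) ∧
      (∀ a b, Y (.inr a) (.inr b) = (starRingEnd ℂ) (Y (.inl a) (.inl b))) ∧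
      (∀ a b, (starRingEnd ℂ) (Y (.inl b) (.inl a)) = -Y (.inl a) (.inl b)) ∧
      (∀ a b, Y (.inl b) (.inr a) = Y (.inl a) (.inr b)) := by
  obtain ⟨A, B, C, D, rfl⟩ : ∃ A B C D, Y = Matrix.fromBlocks A B C D :=
    ⟨_, _, _, _, (Matrix.fromBlocks_toBlocks Y).symm⟩
  have h1 : Matrix.fromBlocks A B C D ∈ skewHermitian (Fin m ⊕ Fin m) ↔
      Aᴴ = -A ∧ Cᴴ = -B ∧ Bᴴ = -C ∧ Dᴴ = -D := by
    change (Matrix.fromBlocks A B C D)ᴴ = -Matrix.fromBlocks A B C D ↔ _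
    rw [Matrix.fromBlocks_conjTranspose, Matrix.fromBlocks_neg, Matrix.fromBlocks_inj]
  have h2 : Matrix.fromBlocks A B C D ∈ LieAlgebra.Symplectic.sp (Fin m) ℂ ↔
      Cᵀ = C ∧ Aᵀ = -D ∧ Dᵀ = -A ∧ Bᵀ = B := by
    rw [LieAlgebra.Symplectic.sp, mem_skewAdjointMatricesLieSubalgebra,
      mem_skewAdjointMatricesSubmodule]
    change (Matrix.fromBlocks A B C D)ᵀ * Matrix.J (Fin m) ℂ =
      Matrix.J (Fin m) ℂ * -Matrix.fromBlocks A B C D ↔ _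
    rw [Matrix.J, Matrix.fromBlocks_transpose, Matrix.fromBlocks_neg, Matrix.fromBlocks_multiply,
      Matrix.fromBlocks_multiply, Matrix.fromBlocks_inj]
    simp only [Matrix.mul_zero, Matrix.mul_one, Matrix.zero_mul, Matrix.one_mul, zero_add, add_zero,
      Matrix.mul_neg, Matrix.neg_mul, neg_neg, neg_inj, neg_zero]
    constructor
    · rintro ⟨a, b, c, d⟩
      exact ⟨a, by rw [← b, neg_neg], c, d⟩
    · rintro ⟨a, b, c, d⟩
      exact ⟨a, by rw [b, neg_neg], c, d⟩
  change (_ ∈ skewHermitian (Fin m ⊕ Fin m) ∧ _ ∈ LieAlgebra.Symplectic.sp (Fin m) ℂ) ↔ _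
  rw [h1, h2]
  simp only [Matrix.fromBlocks_apply₁₁, Matrix.fromBlocks_apply₁₂, Matrix.fromBlocks_apply₂₁,
    Matrix.fromBlocks_apply₂₂, ← Matrix.ext_iff, Matrix.conjTranspose_apply,
    Matrix.transpose_apply, Matrix.neg_apply, starRingEnd_apply]
  constructor
  · rintro ⟨⟨a, b, c, d⟩, e, f, g, i⟩
    refine ⟨fun x y => ?_, fun x y => ?_, a, i⟩
    · rw [← i x y, c, neg_neg]
    · rw [g y x, a y x]
  · rintro ⟨a, b, c, d⟩
    refine ⟨⟨c, fun x y => ?_, fun x y => ?_, fun x y => ?_⟩, fun x y => ?_, fun x y => ?_,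
      fun x y => ?_, d⟩
    · rw [a, star_neg, star_star, d]
    · rw [a, neg_neg, d]
    · rw [b, b, star_star, c y x, neg_neg]
    · rw [a, a, d]
    · rw [b, c, neg_neg]
    · rw [b, c]

/-- The inclusion of `Fin m → K` into its complexification. -/
def quaternionicMap {K : Type} [AddCommGroup K] [Module ℝ K] (j : K →ₗ[ℝ] K)
    (m : ℕ) : (Fin m → K) →ₗ[ℝ] (Fin m ⊕ Fin m → K) where
  toFun v := Sum.elim v (fun a => j (v a))
  map_add' v w := by ext (a | a) <;> simp
  map_smul' c v := by ext (a | a) <;> simp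

theorem quaternionicMap_inl {K : Type} [AddCommGroup K] [Module ℝ K] (j : K →ₗ[ℝ] K)
    (m : ℕ) (v : Fin m → K) (a : Fin m) :
    quaternionicMap j m v (.inl a) = v a := rfl

theorem quaternionicMap_inr {K : Type} [AddCommGroup K] [Module ℝ K] (j : K →ₗ[ℝ] K)
    (m : ℕ) (v : Fin m → K) (a : Fin m) :
    quaternionicMap j m v (.inr a) = j (v a) := rfl

variable {r : ℕ} {K : Type} [AddCommGroup K] [Module ℂ K] [Module ℝ K] [IsScalarTower ℝ ℂ K]

/-- An equivariant quaternionic structure that preserves the form. -/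
structure QuaternionicStructure (s : Cl0 r →ₐ[ℝ] Module.End ℂ K) (β : LinearMap.BilinForm ℝ K)
    (j : K →ₗ[ℝ] K) : Prop where
  I_smul : ∀ v, j (Complex.I • v) = -(Complex.I • j v)
  sq : ∀ v, j (j v) = -v
  act : ∀ x v, j (s x v) = s x (j v)
  form : ∀ v w, β (j v) (j w) = β v w

variable {s : Cl0 r →ₐ[ℝ] Module.End ℂ K} {β : LinearMap.BilinForm ℝ K} {j : K →ₗ[ℝ] K}

theorem QuaternionicStructure.skew (hj : QuaternionicStructure s β j) (v w : K) :
    β (j v) w = -β v (j w) := by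
  rw [← hj.form v, hj.sq, map_neg, neg_neg]

/-- j and ij are both skew for the form, so v is orthogonal to jv and to ijv. -/
theorem QuaternionicStructure.self_smul (hj : QuaternionicStructure s β j) (h : SpinorForm s β)
    (z : ℂ) (v : K) : β v (z • j v) = 0 := by
  have h1 : β v (j v) = 0 := by
    have := hj.skew v v
    rw [h.inner.symm] at this
    linarith
  have h2 : β v (Complex.I • j v) = 0 := by
    have e1 := h.I_skew v (j v)
    have e2 := hj.skew (Complex.I • v) v
    rw [hj.I_smul, map_neg, LinearMap.neg_apply, h.inner.symm _ v] at e2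
    linarith
  rw [complex_smul_eq]
  simp [h1, h2]

theorem QuaternionicStructure.smul_left (hj : QuaternionicStructure s β j) (h : SpinorForm s β)
    (z : ℂ) (v w : K) : β (z • j v) w = -β v (z • j w) := by
  rw [h.smul_left, hj.skew, map_conj_smul j hj.I_smul, Complex.conj_conj]

/-- Real endomorphisms commuting with a representation of quaternionic type are quaternions. -/
theorem quaternionic_commutant (h : SpinorForm s β) (hj : QuaternionicStructure s β j)
    (T : Module.End ℝ K) (hT : ∀ x v, T (s x v) = s x (T v)) :
    ∃ z w : ℂ, ∀ v, T v = z • v + w • j v := by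
  let i : K →ₗ[ℝ] K := (LinearMap.lsmul ℂ K Complex.I).restrictScalars ℝ
  have hi : ∀ v, i v = Complex.I • v := fun v => rfl
  -- P and Q are the complex linear and the antilinear part of T. Schur's lemma applies to P and to
  -- Q ∘ j, which is linear again.
  let P : Module.End ℝ K := (1 / 2 : ℝ) • (T - i ∘ₗ T ∘ₗ i)
  let Q : Module.End ℝ K := (1 / 2 : ℝ) • (T + i ∘ₗ T ∘ₗ i)
  have hP : ∀ v, P v = (1 / 2 : ℝ) • (T v - Complex.I • T (Complex.I • v)) := fun v => rfl
  have hQ : ∀ v, Q v = (1 / 2 : ℝ) • (T v + Complex.I • T (Complex.I • v)) := fun v => rfl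
  have hPI : ∀ v, P (Complex.I • v) = Complex.I • P v := fun v => by
    rw [hP, hP, I_smul_I_smul, map_neg, smul_comm Complex.I, smul_sub Complex.I, I_smul_I_smul,
      smul_neg]
    module
  have hQI : ∀ v, Q (Complex.I • v) = -(Complex.I • Q v) := fun v => by
    rw [hQ, hQ, I_smul_I_smul, map_neg, smul_comm Complex.I, smul_add Complex.I, I_smul_I_smul,
      smul_neg]
    module
  have hPs : ∀ x v, P (s x v) = s x (P v) := fun x v => by
    rw [hP, hP, ← (s x).map_smul, hT, hT, ← (s x).map_smul Complex.I, ← map_sub]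
    exact ((restrictReal s x).map_smul _ _).symm
  have hQs : ∀ x v, Q (s x v) = s x (Q v) := fun x v => by
    rw [hQ, hQ, ← (s x).map_smul, hT, hT, ← (s x).map_smul Complex.I, ← map_add]
    exact ((restrictReal s x).map_smul _ _).symm
  obtain ⟨z, hz⟩ := h.schur_real P hPI hPs
  obtain ⟨w, hw⟩ := h.schur_real (Q ∘ₗ j)
    (fun v => by
      rw [LinearMap.comp_apply, hj.I_smul, map_neg, hQI, neg_neg, LinearMap.comp_apply])
    (fun x v => by rw [LinearMap.comp_apply, hj.act, hQs, LinearMap.comp_apply])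
  refine ⟨z, -w, fun v => ?_⟩
  have h1 : T v = P v + Q v := by
    rw [hP, hQ]
    module
  have h2 : Q v = -(w • j v) := by
    rw [← hw, LinearMap.comp_apply, hj.sq, map_neg, neg_neg]
  rw [h1, h2, hz, neg_smul]

/-- Pairing with k and with ik sees only z, since jk and its complex multiples are orthogonal to k.
Once z is gone, w vanishes because j is injective. -/
theorem quaternion_eq_zero [Nontrivial K] (h : SpinorForm s β) (hj : QuaternionicStructure s β j)
    {z w : ℂ} (e : ∀ v, z • v + w • j v = 0) : z = 0 ∧ w = 0 := by
  obtain ⟨k, hk⟩ := exists_ne (0 : K)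
  have hk' := h.inner.pos k hk
  have h1 : β k (z • k + w • j k) = 0 := by rw [e, map_zero]
  have h2 : β (Complex.I • k) (z • k + w • j k) = 0 := by rw [e, map_zero]
  rw [map_add, h.self_smul, hj.self_smul h, add_zero] at h1
  rw [map_add, h.I_self_smul, h.I_skew, smul_smul, hj.self_smul h, neg_zero, add_zero] at h2
  have hz : z = 0 := Complex.ext ((mul_eq_zero.1 h1).resolve_right hk'.ne')
    ((mul_eq_zero.1 h2).resolve_right hk'.ne')
  refine ⟨hz, ?_⟩
  have h3 := e k
  rw [hz, zero_smul, zero_add] at h3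
  refine (smul_eq_zero.1 h3).resolve_right fun h4 => hk ?_
  have h5 := hj.sq k
  rw [h4, map_zero] at h5
  exact neg_eq_zero.1 h5.symm

/-- The adjoint of z + wj is z̄ - wj, so a symmetric quaternion has w = 0 and z real. -/
theorem quaternionic_symmetricSchur [Nontrivial K] (h : SpinorForm s β)
    (hj : QuaternionicStructure s β j) : SymmetricSchur (restrictReal s) β := by
  intro T hT hs
  obtain ⟨z, w, hzw⟩ := quaternionic_commutant h hj T hT
  have h1 : ∀ v, ((starRingEnd ℂ) z - z) • v + (-2 * w) • j v = 0 := fun v => by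
    have e : (starRingEnd ℂ) z • v - w • j v = z • v + w • j v := h.inner.ext_left fun t => by
      have := hs t v
      rw [hzw, hzw, map_add, LinearMap.add_apply, h.smul_left, hj.smul_left h, ← map_neg,
        ← map_add] at this
      rw [h.inner.symm, h.inner.symm _ t, sub_eq_add_neg, this]
    rw [sub_smul, mul_smul, neg_smul, two_smul, sub_eq_iff_eq_add.1 e]
    module
  obtain ⟨hz, hw⟩ := quaternion_eq_zero h hj h1
  have hw' : w = 0 := by simpa using hw
  have hz' : z.im = 0 := Complex.conj_eq_iff_im.1 (sub_eq_zero.1 hz)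
  refine ⟨z.re, fun v => ?_⟩
  rw [hzw, hw', zero_smul, add_zero, complex_smul_eq, hz', zero_smul, add_zero]

/-- The action of `sp(m)` on `Fin m → K` by matrices of quaternions. -/
def quaternionicAction (j : K →ₗ[ℝ] K) (m : ℕ) : sp m →ₗ[ℝ] Module.End ℝ (Fin m → K) where
  toFun Y :=
    { toFun := fun v a => ∑ b, (Y.1 (.inl a) (.inl b) • v b + Y.1 (.inl a) (.inr b) • j (v b))
      map_add' := fun v w => by
        ext a
        simp only [Pi.add_apply, map_add, smul_add, ← Finset.sum_add_distrib]
        exact Finset.sum_congr rfl fun b _ => by abel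
      map_smul' := fun c v => by
        ext a
        simp only [Pi.smul_apply, map_smul, RingHom.id_apply, Finset.smul_sum, smul_add]
        exact Finset.sum_congr rfl fun b _ => by rw [smul_comm c, smul_comm c] }
  map_add' X Y := by
    refine LinearMap.ext fun t => funext fun a => ?_
    change ∑ b, ((X.1 (.inl a) (.inl b) + Y.1 (.inl a) (.inl b)) • t b +
      (X.1 (.inl a) (.inr b) + Y.1 (.inl a) (.inr b)) • j (t b)) =
      ∑ b, (X.1 (.inl a) (.inl b) • t b + X.1 (.inl a) (.inr b) • j (t b)) +
      ∑ b, (Y.1 (.inl a) (.inl b) • t b + Y.1 (.inl a) (.inr b) • j (t b))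
    rw [← Finset.sum_add_distrib]
    exact Finset.sum_congr rfl fun b _ => by module
  map_smul' c Y := by
    refine LinearMap.ext fun t => funext fun a => ?_
    change ∑ b, ((c • Y.1 (.inl a) (.inl b)) • t b + (c • Y.1 (.inl a) (.inr b)) • j (t b)) =
      c • ∑ b, (Y.1 (.inl a) (.inl b) • t b + Y.1 (.inl a) (.inr b) • j (t b))
    rw [Finset.smul_sum]
    exact Finset.sum_congr rfl fun b _ => by rw [smul_assoc, smul_assoc, smul_add]

theorem quaternionicAction_apply (j : K →ₗ[ℝ] K) (m : ℕ) (Y : sp m) (v : Fin m → K) (a : Fin m) :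
    quaternionicAction j m Y v a =
      ∑ b, (Y.1 (.inl a) (.inl b) • v b + Y.1 (.inl a) (.inr b) • j (v b)) := rfl

/-- Quaternionic type: v ↦ (v, jv) identifies K^{2m} with the complexification of K^m. A
quaternionic matrix A + Bj acts on the first component by (A B), and applying j to the result gives
exactly the second row (-B̄ Ā) of a matrix in sp(m). -/
theorem isModel_quaternionic [Nontrivial K] (h : SpinorForm s β)
    (hj : QuaternionicStructure s β j) (m : ℕ) :
    IsModel (piRep m (restrictReal s)) (sumForm m β) (L := sp m)
      (quaternionicAction j m)
      (fun x => (s x).compLeft (Fin m ⊕ Fin m))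
      (fun Y => matAct K (Y : Matrix (Fin m ⊕ Fin m) (Fin m ⊕ Fin m) ℂ))
      (quaternionicMap j m) where
  lie X Y := by rw [LieSubalgebra.coe_bracket, matAct_lie]
  map_act x v := by
    ext (a | a)
    · rfl
    · exact hj.act x (v a)
  map_hat X v := by
    obtain ⟨h1, h2, -, -⟩ := (mem_sp_iff _).1 X.2
    ext (a | a)
    · rw [quaternionicMap_inl, quaternionicAction_apply, matAct_apply, Fintype.sum_sum_type,
        Finset.sum_add_distrib]
      rfl
    · rw [quaternionicMap_inr, quaternionicAction_apply, matAct_apply, Fintype.sum_sum_type,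
        ← Finset.sum_add_distrib, map_sum]
      refine Finset.sum_congr rfl fun b _ => ?_
      rw [map_add, map_conj_smul j hj.I_smul, map_conj_smul j hj.I_smul, hj.sq,
        quaternionicMap_inl, quaternionicMap_inr, h1, h2]
      module
  inj v w e := by
    have key : ∀ a, v a = 0 ∧ w a = 0 := fun a => by
      have e1 : v a + Complex.I • w a = 0 := congrFun e (.inl a)
      have e2 : j (v a) + Complex.I • j (w a) = 0 := congrFun e (.inr a)
      -- Applying j to the second component gives -v + iw = 0.
      have e3 : v a - Complex.I • w a = 0 := by
        have := congrArg j e2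
        rw [map_add, hj.I_smul, hj.sq, hj.sq, map_zero, smul_neg, neg_neg] at this
        rw [← neg_eq_zero, ← this]
        abel
      have e4 : (2 : ℝ) • v a = 0 := by
        rw [two_smul]
        nth_rewrite 2 [eq_neg_of_add_eq_zero_left e1]
        rw [← sub_eq_add_neg, e3]
      have e5 := (smul_eq_zero.1 e4).resolve_left two_ne_zero
      rw [e5, zero_add] at e1
      exact ⟨e5, (smul_eq_zero.1 e1).resolve_left Complex.I_ne_zero⟩
    exact ⟨funext fun a => (key a).1, funext fun a => (key a).2⟩
  surj t := by
    -- Solution of v + iw = t₁ and -v + iw = j t₂; the second equation is j applied to the second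
    -- component.
    refine ⟨fun a => (1 / 2 : ℝ) • (t (.inl a) - j (t (.inr a))),
      fun a => -((1 / 2 : ℝ) • (Complex.I • (t (.inl a) + j (t (.inr a))))), funext ?_⟩
    rintro (a | a)
    · change (1 / 2 : ℝ) • (t (.inl a) - j (t (.inr a))) +
        Complex.I • -((1 / 2 : ℝ) • (Complex.I • (t (.inl a) + j (t (.inr a))))) = t (.inl a)
      rw [smul_neg, smul_comm Complex.I, I_smul_I_smul]
      module
    · change j ((1 / 2 : ℝ) • (t (.inl a) - j (t (.inr a)))) +
        Complex.I • j (-((1 / 2 : ℝ) • (Complex.I • (t (.inl a) + j (t (.inr a)))))) = t (.inr a)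
      rw [map_neg, map_smul, map_smul, hj.I_smul, smul_neg, smul_comm Complex.I, smul_neg,
        I_smul_I_smul, map_add, map_sub, hj.sq]
      module
  hat_inj X hX := by
    obtain ⟨h1, h2, h3, h4⟩ := (mem_sp_iff _).1 X.2
    have key : ∀ a b, (X : Matrix (Fin m ⊕ Fin m) (Fin m ⊕ Fin m) ℂ) (.inl a) (.inl b) = 0 ∧
        (X : Matrix (Fin m ⊕ Fin m) (Fin m ⊕ Fin m) ℂ) (.inl a) (.inr b) = 0 := fun a b => by
      refine quaternion_eq_zero h hj fun v => ?_
      have := congrFun (LinearMap.congr_fun hX (Pi.single b v)) a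
      rw [quaternionicAction_apply, Finset.sum_eq_single b] at this
      · simpa using this
      · intro c _ hc; simp [hc]
      · simp
    refine Subtype.ext (Matrix.ext ?_)
    rintro (a | a) (b | b)
    · exact (key a b).1
    · exact (key a b).2
    · rw [h1, (key a b).2]; simp
    · rw [h2, (key a b).1]; simp
  skew X v w := by
    obtain ⟨-, -, h3, h4⟩ := (mem_sp_iff _).1 X.2
    simp only [sumForm_apply, quaternionicAction_apply, map_sum, LinearMap.sum_apply,
      map_add, LinearMap.add_apply]
    rw [Finset.sum_comm, ← Finset.sum_neg_distrib]
    refine Finset.sum_congr rfl fun a _ => ?_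
    rw [← Finset.sum_neg_distrib]
    refine Finset.sum_congr rfl fun b _ => ?_
    rw [h.smul_left, hj.smul_left h, h3, h4, neg_smul, map_neg, neg_add]
  comm X x v := by
    ext1 a
    simp [quaternionicAction_apply, hj.act]
  exists_hat T hT hs := by
    obtain ⟨C, hC, hCs, hTC⟩ := exists_components T hT hs
    choose z w hzw using fun a b => quaternionic_commutant h hj (C a b) (hC a b)
    -- The adjoint of z + wj is z̄ - wj; skewness therefore compares opposite entries, and
    -- `quaternion_eq_zero` separates the two coefficients.
    have key : ∀ a b, (starRingEnd ℂ) (z b a) + z a b = 0 ∧ w a b - w b a = 0 := fun a b => by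
      refine quaternion_eq_zero h hj fun v => h.inner.ext_left fun t => ?_
      have := hCs b a t v
      rw [hzw, hzw, map_add, LinearMap.add_apply, h.smul_left, hj.smul_left h, map_add] at this
      rw [h.inner.symm, add_smul, sub_smul, map_add, map_add, map_sub, map_zero,
        LinearMap.zero_apply]
      linarith
    refine ⟨⟨Matrix.fromBlocks (Matrix.of z) (Matrix.of w)
      (Matrix.of fun a b => -(starRingEnd ℂ) (w a b))
      (Matrix.of fun a b => (starRingEnd ℂ) (z a b)), ?_⟩, ?_⟩
    · rw [mem_sp_iff]
      refine ⟨fun a b => rfl, fun a b => rfl, fun a b => ?_, fun a b => ?_⟩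
      · exact eq_neg_of_add_eq_zero_left (key a b).1
      · exact (sub_eq_zero.1 (key a b).2).symm
    · refine LinearMap.ext fun v => funext fun a => ?_
      rw [hTC, quaternionicAction_apply]
      simp [hzw]

end QuaternionicType

/-! ### Schur's lemma for spinors -/

/-- The matrix that acts by `M` on the `p`-th tensor factor. -/
def siteMatrix {k : ℕ} (p : Fin k) (M : Matrix (Fin 2) (Fin 2) ℂ) :
    Matrix (Fin k → Fin 2) (Fin k → Fin 2) ℂ :=
  tensorMatrix (fun q => if q = p then M else 1)

theorem siteMatrix_apply_of_ne {k : ℕ} {p q : Fin k} (M : Matrix (Fin 2) (Fin 2) ℂ)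
    {a b : Fin k → Fin 2} (hq : q ≠ p) (h : a q ≠ b q) : siteMatrix p M a b = 0 := by
  rw [siteMatrix, tensorMatrix, Matrix.of_apply]
  exact Finset.prod_eq_zero (Finset.mem_univ q) (by simp [hq, h])

theorem siteMatrix_apply_update {k : ℕ} (p : Fin k) (M : Matrix (Fin 2) (Fin 2) ℂ)
    (a : Fin k → Fin 2) (c : Fin 2) : siteMatrix p M a (Function.update a p c) = M (a p) c := by
  rw [siteMatrix, tensorMatrix, Matrix.of_apply, Finset.prod_eq_single p]
  · simp
  · intro q _ hq
    simp [hq, Matrix.one_apply]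
  · simp

theorem siteMatrix_g₁ {k : ℕ} (p : Fin k) :
    siteMatrix p g₁ = Matrix.diagonal (fun a => g₁ (a p) (a p)) := by
  ext a b
  by_cases h : a = b
  · subst h
    have := siteMatrix_apply_update p g₁ a (a p)
    rw [Function.update_eq_self] at this
    rw [this, Matrix.diagonal_apply_eq]
  · rw [Matrix.diagonal_apply_ne _ h]
    obtain ⟨q, hq⟩ := Function.ne_iff.1 h
    by_cases hqp : q = p
    · subst hqp
      rw [siteMatrix, tensorMatrix, Matrix.of_apply]
      refine Finset.prod_eq_zero (Finset.mem_univ q) ?_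
      have hoff : ∀ x y : Fin 2, x ≠ y → g₁ x y = 0 := by
        intro x y hxy
        fin_cases x <;> fin_cases y <;> simp_all [g₁]
      simp [hoff _ _ hq]
    · exact siteMatrix_apply_of_ne _ hqp hq

theorem eq_of_update_invariant {k : ℕ} {α : Type} (f : (Fin k → Fin 2) → α)
    (h : ∀ a p c, f (Function.update a p c) = f a) (a b : Fin k → Fin 2) : f a = f b := by
  have key : ∀ s : Finset (Fin k), f (s.piecewise b a) = f a := by
    intro s
    induction s using Finset.induction_on with
    | empty => simp
    | insert p s _ ih => rw [Finset.piecewise_insert, h, ih]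
  rw [← key Finset.univ, Finset.piecewise_univ]

/-- At each site g₁ is diagonal with distinct entries i and -i, so commuting with it kills every
entry whose indices differ at that site. The matrix T flips a site, which makes the remaining
diagonal entries equal. -/
theorem scalar_of_commute_siteMatrix {k : ℕ} (X : Matrix (Fin k → Fin 2) (Fin k → Fin 2) ℂ)
    (h₁ : ∀ p, X * siteMatrix p g₁ = siteMatrix p g₁ * X)
    (hT : ∀ p, X * siteMatrix p matT = siteMatrix p matT * X) : ∃ z : ℂ, X = z • 1 := by
  have hoff : ∀ a b, a ≠ b → X a b = 0 := by
    intro a b hab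
    obtain ⟨p, hp⟩ := Function.ne_iff.1 hab
    have h := congrFun (congrFun (h₁ p) a) b
    rw [siteMatrix_g₁, Matrix.mul_diagonal, Matrix.diagonal_mul] at h
    have hg : ∀ x y : Fin 2, x ≠ y → g₁ x x - g₁ y y ≠ 0 := by
      intro x y hxy
      have h2 : -Complex.I - Complex.I ≠ 0 := by
        rw [← neg_add', ← two_mul, neg_ne_zero]
        exact mul_ne_zero two_ne_zero Complex.I_ne_zero
      fin_cases x <;> fin_cases y <;> simp_all [g₁]
    have h2 : (g₁ (a p) (a p) - g₁ (b p) (b p)) * X a b = 0 := by linear_combination -h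
    exact (mul_eq_zero.1 h2).resolve_left (hg _ _ hp)
  have hX : X = Matrix.diagonal (fun a => X a a) := by
    ext a b
    by_cases hab : a = b
    · subst hab; simp
    · rw [hoff a b hab, Matrix.diagonal_apply_ne _ hab]
  have hupd : ∀ a p c, X (Function.update a p c) (Function.update a p c) = X a a := by
    intro a p c
    by_cases hc : c = a p
    · subst hc; rw [Function.update_eq_self]
    have h := congrFun (congrFun (hT p) a) (Function.update a p c)
    rw [hX, Matrix.diagonal_mul, Matrix.mul_diagonal, siteMatrix_apply_update] at h
    have hm : ∀ x y : Fin 2, y ≠ x → matT x y ≠ 0 := by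
      intro x y hxy
      fin_cases x <;> fin_cases y <;> first | exact absurd rfl hxy | simp [matT]
    rw [mul_comm] at h
    exact (mul_left_cancel₀ (hm _ _ hc) h).symm
  refine ⟨X 0 0, ?_⟩
  rw [Matrix.smul_one_eq_diagonal]
  conv_lhs => rw [hX]
  congr 1
  funext a
  exact eq_of_update_invariant (fun a => X a a) hupd a 0

theorem g₁_mul_g₂ : g₁ * g₂ = (-Complex.I) • matT := by
  ext i j; fin_cases i <;> fin_cases j <;> simp [g₁, g₂, matT, Matrix.mul_apply, Fin.sum_univ_two]

theorem tensorMatrix_smul_site {k : ℕ} (M M' : Fin k → Matrix (Fin 2) (Fin 2) ℂ) (q : Fin k) (c : ℂ)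
    (hq : M q = c • M' q) (h : ∀ p, p ≠ q → M p = M' p) : tensorMatrix M = c • tensorMatrix M' := by
  ext a b
  simp only [tensorMatrix, Matrix.of_apply, Matrix.smul_apply]
  rw [← Finset.mul_prod_erase _ _ (Finset.mem_univ q),
    ← Finset.mul_prod_erase _ _ (Finset.mem_univ q), hq]
  rw [Finset.prod_congr rfl (fun p hp => by rw [h p (Finset.ne_of_mem_erase hp)])]
  simp [mul_assoc]

/-- A matrix commuting with all Clifford generators is scalar. -/
theorem scalar_of_commute_gamma {r : ℕ}
    (X : Matrix (Fin (r / 2) → Fin 2) (Fin (r / 2) → Fin 2) ℂ)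
    (hX : ∀ i, X * gamma r i = gamma r i * X) : ∃ z : ℂ, X = z • 1 := by
  have hi₀ : ∀ p : Fin (r / 2), 2 * (p : ℕ) < r := fun p => by have := p.2; omega
  have hi₁ : ∀ p : Fin (r / 2), 2 * (p : ℕ) + 1 < r := fun p => by have := p.2; omega
  have hγ₀ : ∀ p : Fin (r / 2), gamma r ⟨2 * p, hi₀ p⟩ =
      tensorMatrix (fun q : Fin (r / 2) => gammaFactor (2 * p) q) := fun p => by
    have := p.2
    rw [gamma, if_pos (by change 2 * (p : ℕ) < 2 * (r / 2); omega), one_smul]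
  have hγ₁ : ∀ p : Fin (r / 2), gamma r ⟨2 * p + 1, hi₁ p⟩ =
      tensorMatrix (fun q : Fin (r / 2) => gammaFactor (2 * p + 1) q) := fun p => by
    have := p.2
    rw [gamma, if_pos (by change 2 * (p : ℕ) + 1 < 2 * (r / 2); omega), one_smul]
  have hT : ∀ p, X * siteMatrix p matT = siteMatrix p matT * X := by
    intro p
    -- In a product of paired generators the trailing factors T cancel, which isolates T at the
    -- single site p.
    have h1 : gamma r ⟨2 * p, hi₀ p⟩ * gamma r ⟨2 * p + 1, hi₁ p⟩
        = (-Complex.I) • siteMatrix p matT := by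
      rw [hγ₀, hγ₁, tensorMatrix_mul, siteMatrix]
      refine tensorMatrix_smul_site _ _ p _ ?_ fun q hq => ?_
      · simp only [gammaFactor, show (2 * (p : ℕ) + 1) / 2 = p by omega,
          show (2 * (p : ℕ)) / 2 = p by omega, lt_irrefl, if_false, if_true,
          show (2 * (p : ℕ)) % 2 = 0 by omega, show (2 * (p : ℕ) + 1) % 2 = 1 by omega]
        exact g₁_mul_g₂
      · have hq' : (q : ℕ) ≠ p := fun e => hq (Fin.ext e)
        simp only [gammaFactor, show (2 * (p : ℕ) + 1) / 2 = p by omega,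
          show (2 * (p : ℕ)) / 2 = p by omega, hq', hq, if_false]
        split_ifs
        · exact matT_sq
        · exact mul_one 1
    have h2 : siteMatrix p matT =
        Complex.I • (gamma r ⟨2 * p, hi₀ p⟩ * gamma r ⟨2 * p + 1, hi₁ p⟩) := by
      rw [h1, smul_smul]
      simp
    rw [h2, mul_smul_comm, smul_mul_assoc, ← mul_assoc, hX, mul_assoc, hX, mul_assoc]
  -- T at all sites below n. Multiplying a generator by it strips the trailing factors T and
  -- isolates g₁.
  let low (n : ℕ) : Matrix (Fin (r / 2) → Fin 2) (Fin (r / 2) → Fin 2) ℂ :=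
    tensorMatrix (fun q : Fin (r / 2) => if (q : ℕ) < n then matT else 1)
  have hlow : ∀ n, n ≤ r / 2 → X * low n = low n * X := by
    intro n
    induction n with
    | zero => simp [low, tensorMatrix_one]
    | succ n ih =>
      intro hn
      have h1 : low (n + 1) = low n * siteMatrix ⟨n, hn⟩ matT := by
        simp only [low, siteMatrix, tensorMatrix_mul]
        congr 1
        funext q
        rcases lt_trichotomy (q : ℕ) n with h | h | h
        · simp [h, h.ne, Fin.ext_iff, Nat.lt_succ_of_lt h]
        · simp [h, Fin.ext_iff]
        · simp [h.ne', h.not_gt, Fin.ext_iff, show ¬ (q : ℕ) < n + 1 by omega]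
      rw [h1, ← mul_assoc, ih (by omega), mul_assoc, hT, mul_assoc]
  refine scalar_of_commute_siteMatrix X (fun p => ?_) hT
  have h1 : siteMatrix p g₁ = gamma r ⟨2 * p, hi₀ p⟩ * low p := by
    rw [hγ₀]
    simp only [low, siteMatrix, tensorMatrix_mul]
    congr 1
    funext q
    simp only [gammaFactor, show (2 * (p : ℕ)) / 2 = p by omega]
    rcases lt_trichotomy (q : ℕ) p with h | h | h
    · simp [h, h.ne, Fin.ext_iff, matT_sq]
    · simp [h, Fin.ext_iff]
    · simp [h.ne', h.not_gt, Fin.ext_iff]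
  rw [h1, ← mul_assoc, hX, mul_assoc, hlow _ p.2.le, mul_assoc]

theorem spinorHom_eq_toLin' (r : ℕ) (x : Cl0 r) :
    spinorHom r x = Matrix.toLin' (kappa r (x : Cl r)) := rfl

/-! ### Schur's lemma in odd dimension. -/

theorem vol_mul_self (r : ℕ) : ∃ ε : ℝ, ε * ε = 1 ∧ vol r * vol r = ε • (1 : Cl r) := by
  have h := list_prod_mul_self (List.finRange r) (List.nodup_finRange r)
  rw [← List.ofFn_eq_map] at h
  refine ⟨_, ?_, h⟩
  rw [← pow_add, ← two_mul, pow_mul]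
  simp

/-- For odd r the volume element is central, so it acts by a scalar, which is nonzero because its
square is ±1. Since e_i vol is even, commuting with the even algebra forces commuting with each e_i.
-/
theorem spinor_schur_odd {r : ℕ} (hr : Odd r) (T : Module.End ℂ (Spinor r))
    (hT : ∀ x v, T (spinorHom r x v) = spinorHom r x (T v)) : ∃ z : ℂ, ∀ v, T v = z • v := by
  set X := LinearMap.toMatrix' T with hXdef
  have hTX : T = Matrix.toLin' X := (Matrix.toLin'_toMatrix' T).symm
  have hcomm : ∀ x : Cl0 r, X * kappa r (x : Cl r) = kappa r (x : Cl r) * X := by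
    intro x
    apply Matrix.toLin'.injective
    rw [Matrix.toLin'_mul, Matrix.toLin'_mul, ← hTX, ← spinorHom_eq_toLin']
    exact LinearMap.ext (hT x)
  obtain ⟨c, hc⟩ := scalar_of_commute_gamma (kappa r (vol r)) fun i => by
    rw [← kappa_gen, ← map_mul, ← map_mul, vol_eq_mono, gen_mul_mono_comm]
    rw [if_pos (Finset.mem_univ i), Finset.card_univ, Fintype.card_fin,
      (hr.add_one).neg_one_pow, one_smul]
  have hc0 : c ≠ 0 := by
    rintro rfl
    obtain ⟨ε, hε, h⟩ := vol_mul_self r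
    have h2 := congrArg (kappa r) h
    rw [map_mul, hc, zero_smul, zero_mul, map_smul, map_one] at h2
    have h3 : ε = 0 := by
      have h4 := congrFun (congrFun h2 0) 0
      rw [Matrix.smul_apply, Matrix.one_apply_eq, Matrix.zero_apply] at h4
      have h5 := congrArg Complex.re h4
      rw [Complex.smul_re] at h5
      simpa using h5.symm
    rw [h3] at hε
    simp at hε
  obtain ⟨z, hz⟩ := scalar_of_commute_gamma X fun i => by
    have hmem : gen r i * vol r ∈ Cl0 r := by
      obtain ⟨ε, -, h⟩ := gen_mul_mono i (Finset.univ : Finset (Fin r))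
      rw [vol_eq_mono, h]
      refine (Cl0 r).smul_mem (mono_mem ?_) ε
      rw [even_card_toggle, Finset.card_univ, Fintype.card_fin, Nat.not_even_iff_odd]
      exact hr
    have h := hcomm ⟨_, hmem⟩
    change X * kappa r (gen r i * vol r) = kappa r (gen r i * vol r) * X at h
    rw [map_mul, kappa_gen, hc, mul_smul_comm, mul_one, mul_smul_comm, smul_mul_assoc] at h
    exact smul_right_injective _ hc0 h
  exact ⟨z, fun v => by rw [hTX, hz]; simp⟩

/-! ### Chirality -/

theorem chirality_eq {r : ℕ} (hr : Even r) (v : Spinor r) :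
    chirality r v = (-Complex.I) ^ (r / 2) • spinorHom r (volEven hr) v := rfl

theorem I_pow_mul (k : ℕ) : Complex.I ^ k * (-Complex.I) ^ k = 1 := by
  rw [← mul_pow]; simp

theorem chirality_chirality {r : ℕ} (hr : Even r) (v : Spinor r) :
    chirality r (chirality r v) = v := by
  rw [chirality_eq hr, chirality_eq hr, map_smul, smul_smul, ← Module.End.mul_apply, ← map_mul,
    volEven_mul_self, map_smul, map_one, ← mul_pow]
  simp only [neg_mul_neg, Complex.I_mul_I, LinearMap.smul_apply, Module.End.one_apply]
  rw [← algebraMap_smul ℂ ((-1 : ℝ) ^ (r / 2)) v, smul_smul]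
  simp [← mul_pow]

/-- This scalar decides, for each residue of r, which half-spinors carry the eigenvalue +1, -1 or i
of the volume element. -/
theorem spinorHom_volEven {r : ℕ} (hr : Even r) {ε : ℂ} {v : Spinor r} (hv : v ∈ HalfSpinor r ε) :
    spinorHom r (volEven hr) v = (Complex.I ^ (r / 2) * ε) • v := by
  rw [Module.End.mem_eigenspace_iff, chirality_eq hr] at hv
  rw [mul_smul, ← hv, smul_smul, I_pow_mul, one_smul]

theorem chirality_gamma {r : ℕ} (hr : Even r) (i : Fin r) (v : Spinor r) :
    chirality r (gamma r i *ᵥ v) = -(gamma r i *ᵥ chirality r v) := by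
  have h := congrArg (kappa r) (gen_mul_vol hr i)
  rw [map_neg, map_mul, map_mul, kappa_gen] at h
  simp only [chirality, LinearMap.smul_apply, Matrix.toLin'_apply, Matrix.mulVec_smul,
    Matrix.mulVec_mulVec, h, Matrix.neg_mulVec, smul_neg, neg_neg]

theorem chirality_spinorHom {r : ℕ} (hr : Even r) (x : Cl0 r) (v : Spinor r) :
    chirality r (spinorHom r x v) = spinorHom r x (chirality r v) := by
  have h : volEven hr * x = x * volEven hr := Subtype.ext (vol_comm hr x x.2).symm
  rw [chirality_eq hr, chirality_eq hr, map_smul, ← Module.End.mul_apply, ← map_mul, h, map_mul,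
    Module.End.mul_apply]

/-- The half-spin representations as algebra homomorphisms. -/
def halfSpinorHom {r : ℕ} (hr : Even r) (ε : ℂ) :
    Cl0 r →ₐ[ℝ] Module.End ℂ (HalfSpinor r ε) :=
  AlgHom.ofLinearMap
    { toFun := halfSpinorAct hr ε
      map_add' := fun x y => by
        refine LinearMap.ext fun v => Subtype.ext ?_
        exact LinearMap.congr_fun (map_add (spinorHom r) x y) v
      map_smul' := fun c x => by
        refine LinearMap.ext fun v => Subtype.ext ?_
        exact LinearMap.congr_fun (map_smul (spinorHom r) c x) v }
    (by
      refine LinearMap.ext fun v => Subtype.ext ?_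
      exact LinearMap.congr_fun (map_one (spinorHom r)) v)
    (fun x y => by
      refine LinearMap.ext fun v => Subtype.ext ?_
      exact LinearMap.congr_fun (map_mul (spinorHom r) x y) v)

theorem coe_halfSpinorHom {r : ℕ} (hr : Even r) (ε : ℂ) (x : Cl0 r) (v : HalfSpinor r ε) :
    (halfSpinorHom hr ε x v : Spinor r) = spinorHom r x v := rfl

/-- The projection of spinors to half-spinors. -/
def halfProj {r : ℕ} (hr : Even r) (ε : ℂ) (hε : ε * ε = 1) : Spinor r →ₗ[ℂ] HalfSpinor r ε :=
  LinearMap.codRestrict (HalfSpinor r ε) ((1 / 2 : ℂ) • (LinearMap.id + ε • chirality r))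
    fun v => by
      rw [Module.End.mem_eigenspace_iff]
      simp only [LinearMap.smul_apply, LinearMap.add_apply, LinearMap.id_apply, map_smul, map_add,
        chirality_chirality hr]
      rw [smul_comm ε, smul_add ε, smul_smul ε, hε, one_smul, add_comm]

theorem coe_halfProj {r : ℕ} (hr : Even r) (ε : ℂ) (hε : ε * ε = 1) (v : Spinor r) :
    (halfProj hr ε hε v : Spinor r) = (1 / 2 : ℂ) • (v + ε • chirality r v) := rfl

theorem halfProj_coe {r : ℕ} (hr : Even r) (ε : ℂ) (hε : ε * ε = 1) (v : HalfSpinor r ε) :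
    halfProj hr ε hε v = v := by
  apply Subtype.ext
  rw [coe_halfProj, Module.End.mem_eigenspace_iff.1 v.2, smul_smul, hε]
  module

theorem halfProj_spinorHom {r : ℕ} (hr : Even r) (ε : ℂ) (hε : ε * ε = 1) (x : Cl0 r)
    (v : Spinor r) :
    halfProj hr ε hε (spinorHom r x v) = halfSpinorHom hr ε x (halfProj hr ε hε v) := by
  apply Subtype.ext
  rw [coe_halfSpinorHom, coe_halfProj, coe_halfProj, chirality_spinorHom hr, map_smul, map_add,
    map_smul]

theorem halfProj_add {r : ℕ} (hr : Even r) (ε : ℂ) (hε : ε * ε = 1) (hε' : -ε * -ε = 1)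
    (v : Spinor r) : (halfProj hr ε hε v : Spinor r) + halfProj hr (-ε) hε' v = v := by
  rw [coe_halfProj, coe_halfProj]
  module

/-! ### Schur's lemma for half-spinors. -/

theorem sub_conj_commute_self {R : Type} [Ring R] {x g : R} (hg : g * g = -1) :
    (x - g * x * g) * g = g * (x - g * x * g) := by
  rw [sub_mul, mul_sub, mul_assoc, hg, ← mul_assoc, ← mul_assoc, hg]
  noncomm_ring

/-- As g⁻¹ = -g, the element x - gxg is x + gxg⁻¹, twice the average over conjugation by the odd
element g. It upgrades commuting with hg to commuting with h itself. -/
theorem sub_conj_commute {R : Type} [Ring R] {x g h : R} (hg : g * g = -1) (hgh : g * h = -(h * g))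
    (hx : x * (h * g) = h * g * x) : (x - g * x * g) * h = h * (x - g * x * g) := by
  have hxh : x * h = -(h * g * x * g) := by
    rw [← hx]
    simp only [mul_assoc, hg]
    simp
  have e1 : g * x * g * h = -(h * x) := by
    calc g * x * g * h = g * x * (g * h) := by simp only [mul_assoc]
      _ = -(g * (x * (h * g))) := by rw [hgh]; simp only [mul_neg, mul_assoc]
      _ = -((g * h) * (g * x)) := by rw [hx]; simp only [mul_assoc]
      _ = h * (g * g) * x := by rw [hgh]; simp only [neg_mul, neg_neg, mul_assoc]
      _ = -(h * x) := by rw [hg]; simp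
  have e2 : h * (g * x * g) = -(x * h) := by
    rw [hxh, neg_neg]
    simp only [mul_assoc]
  rw [sub_mul, mul_sub, e1, e2]
  abel

/-- The endomorphism is extended by zero to the other half and averaged over conjugation by one
generator. The average commutes with all generators, hence is a scalar z. On the given half the
conjugated term vanishes, because the generator moves a half-spinor to the other half; so the
original endomorphism is z there. -/
theorem halfSpinor_schur {r : ℕ} (hr : Even r) (h0 : 0 < r) {ε : ℂ} (hε : ε * ε = 1)
    (T : Module.End ℂ (HalfSpinor r ε))
    (hT : ∀ x v, T (halfSpinorHom hr ε x v) = halfSpinorHom hr ε x (T v)) :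
    ∃ z : ℂ, ∀ v, T v = z • v := by
  let R : Module.End ℂ (Spinor r) := (HalfSpinor r ε).subtype ∘ₗ T ∘ₗ halfProj hr ε hε
  have hR : ∀ v, R v = T (halfProj hr ε hε v) := fun v => rfl
  set M := LinearMap.toMatrix' R with hM
  have hRM : R = Matrix.toLin' M := (Matrix.toLin'_toMatrix' R).symm
  have hMs : ∀ x : Cl0 r, M * kappa r (x : Cl r) = kappa r (x : Cl r) * M := fun x => by
    apply Matrix.toLin'.injective
    rw [Matrix.toLin'_mul, Matrix.toLin'_mul, ← hRM, ← spinorHom_eq_toLin']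
    refine LinearMap.ext fun v => ?_
    change R (spinorHom r x v) = spinorHom r x (R v)
    rw [hR, hR, halfProj_spinorHom, hT, coe_halfSpinorHom]
  set i₀ : Fin r := ⟨0, h0⟩
  obtain ⟨z, hz⟩ := scalar_of_commute_gamma (M - gamma r i₀ * M * gamma r i₀) fun i => by
    by_cases hi : i = i₀
    · rw [hi]
      exact sub_conj_commute_self (gamma_sq r i₀)
    · exact sub_conj_commute (gamma_sq r i₀) (gamma_anticomm r (Ne.symm hi)) (by
        rw [← kappa_bivector]
        exact hMs _)
  have hZz : ∀ v, R v - gamma r i₀ *ᵥ R (gamma r i₀ *ᵥ v) = z • v := fun v => by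
    have := congrArg (fun X => X *ᵥ v) hz
    simpa only [Matrix.sub_mulVec, ← Matrix.mulVec_mulVec, Matrix.smul_mulVec, Matrix.one_mulVec,
      ← Matrix.toLin'_apply M, ← hRM] using this
  refine ⟨z, fun v => Subtype.ext ?_⟩
  have h1 : halfProj hr ε hε (gamma r i₀ *ᵥ (v : Spinor r)) = 0 := by
    apply Subtype.ext
    rw [coe_halfProj, chirality_gamma hr, Module.End.mem_eigenspace_iff.1 v.2, Matrix.mulVec_smul,
      smul_neg, smul_smul, hε]
    simp
  have h2 := hZz v
  rw [hR, halfProj_coe, hR, h1] at h2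
  simpa using h2

/-! ### The invariant inner product on spinors -/

/-- The real part of the standard Hermitian inner product of spinors. -/
def spinorForm (r : ℕ) : LinearMap.BilinForm ℝ (Spinor r) :=
  LinearMap.mk₂ ℝ (fun v w => (star v ⬝ᵥ w).re)
    (fun v v' w => by simp [add_dotProduct]) (fun c v w => by simp)
    (fun v w w' => by simp [dotProduct_add]) (fun c v w => by simp)

theorem spinorForm_apply {r : ℕ} (v w : Spinor r) : spinorForm r v w = (star v ⬝ᵥ w).re := rfl

theorem spinorForm_mulVec {r : ℕ} (X : Matrix (Fin (r / 2) → Fin 2) (Fin (r / 2) → Fin 2) ℂ)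
    (v w : Spinor r) : spinorForm r (X *ᵥ v) w = spinorForm r v (Xᴴ *ᵥ w) := by
  rw [spinorForm_apply, spinorForm_apply, Matrix.star_mulVec, Matrix.dotProduct_mulVec]

theorem spinorForm_inner (r : ℕ) : InvariantInner (restrictReal (spinorHom r)) (spinorForm r) where
  symm v w := by
    simp only [spinorForm_apply, dotProduct, Complex.re_sum]
    refine Finset.sum_congr rfl fun a _ => ?_
    simp
    ring
  pos v hv := by
    obtain ⟨a, ha⟩ := Function.ne_iff.1 hv
    simp only [spinorForm_apply, dotProduct, Complex.re_sum]
    have h : ∀ a, ((star v) a * v a).re = Complex.normSq (v a) := fun a => by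
      simp [Complex.normSq_apply]
    simp only [h]
    exact Finset.sum_pos' (fun a _ => Complex.normSq_nonneg _)
      ⟨a, Finset.mem_univ a, Complex.normSq_pos.2 ha⟩
  skew i j hij v w := by
    change spinorForm r (kappa r (bivector r i j : Cl0 r) *ᵥ v) w =
      -spinorForm r v (kappa r (bivector r i j : Cl0 r) *ᵥ w)
    rw [spinorForm_mulVec, kappa_bivector_conjTranspose hij.ne, Matrix.neg_mulVec, map_neg]

theorem spinorForm_I_skew {r : ℕ} (v w : Spinor r) :
    spinorForm r (Complex.I • v) w = -spinorForm r v (Complex.I • w) := by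
  simp [spinorForm_apply]

theorem spinorForm_odd {r : ℕ} (hr : Odd r) : SpinorForm (spinorHom r) (spinorForm r) :=
  ⟨spinorForm_inner r, spinorForm_I_skew, spinor_schur_odd hr⟩

/-- The restriction of the inner product to half-spinors. -/
def halfForm (r : ℕ) (ε : ℂ) : LinearMap.BilinForm ℝ (HalfSpinor r ε) :=
  (spinorForm r).compl₁₂ ((HalfSpinor r ε).subtype.restrictScalars ℝ)
    ((HalfSpinor r ε).subtype.restrictScalars ℝ)

theorem spinorForm_half {r : ℕ} (hr : Even r) (h0 : 0 < r) {ε : ℂ} (hε : ε * ε = 1) :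
    SpinorForm (halfSpinorHom hr ε) (halfForm r ε) where
  inner :=
    ⟨fun v w => (spinorForm_inner r).symm v w,
      fun v hv => (spinorForm_inner r).pos v (by simpa using hv),
      fun i j hij v w => (spinorForm_inner r).skew i j hij v w⟩
  I_skew v w := spinorForm_I_skew (v : Spinor r) w
  schur := halfSpinor_schur hr h0 hε

/-! ### The real or quaternionic structure on spinors -/

/-- The factors of the matrix of the structure map. -/
def structureFactor (k p : ℕ) : Matrix (Fin 2) (Fin 2) ℂ := if (k - p) % 2 = 1 then matT else 1

/-- The matrix of the structure map. -/
def structureMatrix (k : ℕ) : Matrix (Fin k → Fin 2) (Fin k → Fin 2) ℂ :=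
  tensorMatrix (fun p : Fin k => structureFactor k p)

theorem structureMatrix_conjTranspose (k : ℕ) : (structureMatrix k)ᴴ = structureMatrix k := by
  rw [structureMatrix, tensorMatrix_conjTranspose]
  congr 1
  funext p
  rw [structureFactor]
  split_ifs
  · exact matT_conjTranspose
  · exact Matrix.conjTranspose_one

theorem structureMatrix_sq (k : ℕ) : structureMatrix k * structureMatrix k = 1 := by
  rw [structureMatrix, tensorMatrix_mul, ← tensorMatrix_one]
  congr 1
  funext p
  rw [structureFactor]
  split_ifs
  · exact matT_sq
  · exact one_mul 1

theorem tensorMatrix_smul {k : ℕ} (c : Fin k → ℂ) (M : Fin k → Matrix (Fin 2) (Fin 2) ℂ) :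
    tensorMatrix (fun p => c p • M p) = (∏ p, c p) • tensorMatrix M := by
  ext a b
  simp [tensorMatrix, Finset.prod_mul_distrib]

theorem tensorMatrix_map_conj {k : ℕ} (M : Fin k → Matrix (Fin 2) (Fin 2) ℂ) :
    (tensorMatrix M).map (starRingEnd ℂ) = tensorMatrix (fun p => (M p).map (starRingEnd ℂ)) := by
  ext a b
  simp [tensorMatrix]

theorem matT_conj : matT.map (starRingEnd ℂ) = -matT := by
  ext i j; fin_cases i <;> fin_cases j <;> simp [matT]
theorem g₁_conj : g₁.map (starRingEnd ℂ) = -g₁ := by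
  ext i j; fin_cases i <;> fin_cases j <;> simp [g₁]
theorem g₂_conj : g₂.map (starRingEnd ℂ) = -g₂ := by
  ext i j; fin_cases i <;> fin_cases j <;> simp [g₂]
theorem one_conj : (1 : Matrix (Fin 2) (Fin 2) ℂ).map (starRingEnd ℂ) = 1 := by
  ext i j; fin_cases i <;> fin_cases j <;> simp

theorem prod_neg_one_lt {k : ℕ} (n : ℕ) (hn : n ≤ k) (c : ℂ) :
    ∏ p : Fin k, (if (p : ℕ) < n then (-1 : ℂ) else if (p : ℕ) = n then c else 1)
      = (-1) ^ n * if n < k then c else 1 := by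
  rw [Fin.prod_univ_eq_prod_range
    (fun p => if p < n then (-1 : ℂ) else if p = n then c else 1) k]
  obtain ⟨d, rfl⟩ := Nat.exists_eq_add_of_le hn
  rw [Finset.prod_range_add]
  congr 1
  · rw [Finset.prod_congr rfl (fun p hp => if_pos (Finset.mem_range.1 hp))]
    simp
  · rcases d with _ | d
    · simp
    · rw [Finset.prod_range_succ', Finset.prod_eq_one]
      · simp
      · intro p _
        simp

/-- The structure matrix has T at alternate sites, beginning with the leftmost. Conjugation negates
each of the q trailing factors T of the generator; at site q it negates g, which is compensated
exactly when the structure matrix has a T there, since T and g anticommute. The alternation makes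
the total sign independent of q, apart from the last generator in odd dimension. -/
theorem structureMatrix_gammaFactor (k i : ℕ) (hi : i / 2 ≤ k) :
    structureMatrix k * (tensorMatrix fun p : Fin k => gammaFactor i p).map (starRingEnd ℂ) =
      ((-1 : ℂ) ^ (k + 1) * if i < 2 * k then 1 else -1) •
        ((tensorMatrix fun p : Fin k => gammaFactor i p) * structureMatrix k) := by
  set q := i / 2 with hq
  let c : ℂ := if (k - q) % 2 = 1 then 1 else -1
  have hsite : ∀ p : Fin k, structureFactor k p * (gammaFactor i p).map (starRingEnd ℂ) =
      (if (p : ℕ) < q then (-1 : ℂ) else if (p : ℕ) = q then c else 1) •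
        (gammaFactor i p * structureFactor k p) := by
    intro p
    simp only [gammaFactor, ← hq]
    rcases lt_trichotomy (p : ℕ) q with h | h | h
    · rw [if_pos h, if_pos h, matT_conj, structureFactor]
      split_ifs <;> simp
    · simp only [h, lt_irrefl, if_false, if_true, structureFactor, c]
      by_cases h2 : (k - q) % 2 = 1
      · simp only [h2, if_true]
        split_ifs
        · rw [g₁_conj, mul_neg, g₁_T, one_smul]
        · rw [g₂_conj, mul_neg, g₂_T, one_smul]
      · simp only [h2, if_false]
        split_ifs
        · rw [g₁_conj]; simp
        · rw [g₂_conj]; simp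
    · rw [if_neg h.not_gt, if_neg h.ne', if_neg h.not_gt, if_neg h.ne', one_conj]
      simp
  have hmain : structureMatrix k * (tensorMatrix fun p : Fin k => gammaFactor i p).map
      (starRingEnd ℂ) = ((-1) ^ q * if q < k then c else 1) •
        ((tensorMatrix fun p : Fin k => gammaFactor i p) * structureMatrix k) := by
    rw [tensorMatrix_map_conj, structureMatrix, tensorMatrix_mul, tensorMatrix_mul,
      ← prod_neg_one_lt q hi, ← tensorMatrix_smul]
    congr 1
    funext p
    exact hsite p
  rw [hmain]
  congr 1
  by_cases h : i < 2 * k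
  · have hqk' : q < k := by omega
    simp only [h, hqk', if_true, c, mul_one]
    obtain ⟨d, rfl⟩ := Nat.exists_eq_add_of_lt hqk'
    rw [show q + d + 1 - q = d + 1 by omega]
    rcases Nat.even_or_odd d with hd2 | hd2
    · rw [if_pos (by rcases hd2 with ⟨e, rfl⟩; omega), mul_one,
        show q + d + 1 + 1 = q + (d + 2) by ring, pow_add, (hd2.add even_two).neg_one_pow, mul_one]
    · rw [if_neg (by rcases hd2 with ⟨e, rfl⟩; omega),
        show q + d + 1 + 1 = q + (d + 2) by ring, pow_add, (hd2.add_even even_two).neg_one_pow]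
  · have hqk' : q = k := by omega
    simp only [h, hqk', lt_irrefl, if_false, mul_one, pow_succ]
    ring

/-- The exceptional sign of the last generator in odd dimension is absorbed by conjugating its
scalar factor i. A sign common to all generators is what lets J commute with products of two of
them. -/
theorem structureMatrix_gamma (r : ℕ) (i : Fin r) :
    structureMatrix (r / 2) * (gamma r i).map (starRingEnd ℂ) =
      (-1 : ℂ) ^ (r / 2 + 1) • (gamma r i * structureMatrix (r / 2)) := by
  have hmap : (gamma r i).map (starRingEnd ℂ) =
      (if (i : ℕ) < 2 * (r / 2) then (1 : ℂ) else -Complex.I) •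
        (tensorMatrix fun p : Fin (r / 2) => gammaFactor i p).map (starRingEnd ℂ) := by
    ext a b
    simp only [gamma, Matrix.map_apply, Matrix.smul_apply, smul_eq_mul, map_mul]
    split_ifs <;> simp
  rw [hmap, mul_smul_comm, structureMatrix_gammaFactor _ _ (by omega), gamma, smul_mul_assoc,
    smul_smul, smul_smul]
  congr 1
  split_ifs <;> ring

/-- The equivariant conjugate linear structure map of spinors. -/
def spinorJ (r : ℕ) : Spinor r →ₗ[ℝ] Spinor r where
  toFun v := structureMatrix (r / 2) *ᵥ star v
  map_add' v w := by rw [star_add, Matrix.mulVec_add]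
  map_smul' c v := by
    rw [star_smul, star_trivial, Matrix.mulVec_smul, RingHom.id_apply]

theorem spinorJ_apply {r : ℕ} (v : Spinor r) : spinorJ r v = structureMatrix (r / 2) *ᵥ star v := rfl

theorem spinorJ_I_smul {r : ℕ} (v : Spinor r) :
    spinorJ r (Complex.I • v) = -(Complex.I • spinorJ r v) := by
  rw [spinorJ_apply, spinorJ_apply, star_smul, Matrix.mulVec_smul]
  simp

theorem star_mulVec_eq {k : ℕ} (X : Matrix (Fin k → Fin 2) (Fin k → Fin 2) ℂ)
    (v : (Fin k → Fin 2) → ℂ) : star (X *ᵥ v) = X.map (starRingEnd ℂ) *ᵥ star v := by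
  ext a
  simp [Matrix.mulVec, dotProduct]

theorem spinorJ_gamma {r : ℕ} (i : Fin r) (v : Spinor r) :
    spinorJ r (gamma r i *ᵥ v) = (-1 : ℂ) ^ (r / 2 + 1) • (gamma r i *ᵥ spinorJ r v) := by
  rw [spinorJ_apply, star_mulVec_eq, Matrix.mulVec_mulVec, structureMatrix_gamma,
    Matrix.smul_mulVec, ← Matrix.mulVec_mulVec, spinorJ_apply]

theorem spinorJ_act {r : ℕ} (x : Cl0 r) (v : Spinor r) :
    spinorJ r (spinorHom r x v) = spinorHom r x (spinorJ r v) := by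
  refine intertwines_of_bivector (restrictReal (spinorHom r)) (restrictReal (spinorHom r))
    (spinorJ r) (fun i j _ v => ?_) x v
  change spinorJ r (kappa r (bivector r i j : Cl0 r) *ᵥ v) =
    kappa r (bivector r i j : Cl0 r) *ᵥ spinorJ r v
  rw [kappa_bivector, ← Matrix.mulVec_mulVec, spinorJ_gamma, spinorJ_gamma, Matrix.mulVec_smul,
    smul_smul, ← mul_pow, Matrix.mulVec_mulVec]
  simp

/-- There is one factor -1 for each T in the structure matrix, and there are ⌈k/2⌉ of these. -/
theorem prod_structure_sign (k : ℕ) :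
    ∏ p : Fin k, (if (k - (p : ℕ)) % 2 = 1 then (-1 : ℂ) else 1) =
      if k % 4 = 0 ∨ k % 4 = 3 then 1 else -1 := by
  -- Counting sites from the other end makes each factor independent of k, so that induction on k
  -- works.
  rw [Fin.prod_univ_eq_prod_range (fun p => if (k - p) % 2 = 1 then (-1 : ℂ) else 1) k,
    ← Finset.prod_range_reflect]
  have h : ∏ p ∈ Finset.range k, (if (k - (k - 1 - p)) % 2 = 1 then (-1 : ℂ) else 1) =
      ∏ p ∈ Finset.range k, if p % 2 = 0 then (-1 : ℂ) else 1 := by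
    refine Finset.prod_congr rfl fun p hp => ?_
    rw [Finset.mem_range] at hp
    rw [show k - (k - 1 - p) = p + 1 by omega]
    congr 1
    exact propext (by omega)
  rw [h]
  clear h
  induction k with
  | zero => simp
  | succ k ih =>
    rw [Finset.prod_range_succ, ih]
    have : k % 4 < 4 := Nat.mod_lt _ (by norm_num)
    interval_cases h : k % 4
    · simp [show k % 2 = 0 by omega, show (k + 1) % 4 = 1 by omega]
    · simp [show k % 2 = 1 by omega, show (k + 1) % 4 = 2 by omega]
    · simp [show k % 2 = 0 by omega, show (k + 1) % 4 = 3 by omega]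
    · simp [show k % 2 = 1 by omega, show (k + 1) % 4 = 0 by omega]

/-- The square is the structure matrix times its conjugate. A site carrying T contributes T T̄ = -T²
= -1, and every other site contributes 1. -/
theorem spinorJ_sq {r : ℕ} (v : Spinor r) : spinorJ r (spinorJ r v) =
    (if r / 2 % 4 = 0 ∨ r / 2 % 4 = 3 then (1 : ℂ) else -1) • v := by
  have h : structureMatrix (r / 2) * (structureMatrix (r / 2)).map (starRingEnd ℂ) =
      (if r / 2 % 4 = 0 ∨ r / 2 % 4 = 3 then (1 : ℂ) else -1) • 1 := by
    rw [← prod_structure_sign, structureMatrix, tensorMatrix_map_conj, tensorMatrix_mul,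
      ← tensorMatrix_one, ← tensorMatrix_smul]
    congr 1
    funext p
    rw [structureFactor]
    split_ifs
    · rw [matT_conj, mul_neg, matT_sq]
      simp
    · rw [one_conj]
      simp
  rw [spinorJ_apply, spinorJ_apply, star_mulVec_eq, Matrix.mulVec_mulVec, h, star_star,
    Matrix.smul_mulVec, Matrix.one_mulVec]

theorem spinorJ_form {r : ℕ} (v w : Spinor r) :
    spinorForm r (spinorJ r v) (spinorJ r w) = spinorForm r v w := by
  rw [spinorJ_apply, spinorJ_apply, spinorForm_mulVec, structureMatrix_conjTranspose,
    Matrix.mulVec_mulVec, structureMatrix_sq, Matrix.one_mulVec, spinorForm_apply,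
    spinorForm_apply, star_star]
  simp only [dotProduct, Complex.re_sum]
  refine Finset.sum_congr rfl fun a _ => ?_
  simp

/-- The volume element commutes with J, and only the normalizing factor (-i)^{r/2} is conjugated.
Hence J preserves the halves when r/2 is even and exchanges them when it is odd. -/
theorem spinorJ_chirality {r : ℕ} (hr : Even r) (v : Spinor r) :
    spinorJ r (chirality r v) = (-1 : ℂ) ^ (r / 2) • chirality r (spinorJ r v) := by
  rw [chirality_eq hr, chirality_eq hr, map_conj_smul _ spinorJ_I_smul, spinorJ_act, smul_smul]
  congr 1
  rw [map_pow, map_neg, Complex.conj_I, neg_neg, ← mul_pow]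
  simp

theorem spinorJ_mem {r : ℕ} (hr : Even r) {ε ε' : ℂ} (hε : star ε = ε)
    (h : (-1 : ℂ) ^ (r / 2) * ε = ε') {v : Spinor r} (hv : v ∈ HalfSpinor r ε) :
    spinorJ r v ∈ HalfSpinor r ε' := by
  rw [Module.End.mem_eigenspace_iff] at hv ⊢
  have h1 := spinorJ_chirality hr v
  rw [hv, map_conj_smul _ spinorJ_I_smul, starRingEnd_apply, hε] at h1
  rw [← h, mul_smul, h1, smul_smul, ← mul_pow]
  simp

/-- The structure map of half-spinors. -/
def halfJ {r : ℕ} (hr : Even r) {ε ε' : ℂ} (hε : star ε = ε)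
    (h : (-1 : ℂ) ^ (r / 2) * ε = ε') : HalfSpinor r ε →ₗ[ℝ] HalfSpinor r ε' where
  toFun v := ⟨spinorJ r v, spinorJ_mem hr hε h v.2⟩
  map_add' v w := Subtype.ext (map_add (spinorJ r) (v : Spinor r) w)
  map_smul' c v := Subtype.ext (map_smul (spinorJ r) c (v : Spinor r))

theorem halfJ_I_smul {r : ℕ} (hr : Even r) {ε ε' : ℂ} (hε : star ε = ε)
    (h : (-1 : ℂ) ^ (r / 2) * ε = ε') (v : HalfSpinor r ε) :
    halfJ hr hε h (Complex.I • v) = -(Complex.I • halfJ hr hε h v) :=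
  Subtype.ext (spinorJ_I_smul (v : Spinor r))

theorem halfJ_act {r : ℕ} (hr : Even r) {ε ε' : ℂ} (hε : star ε = ε)
    (h : (-1 : ℂ) ^ (r / 2) * ε = ε') (x : Cl0 r) (v : HalfSpinor r ε) :
    halfJ hr hε h (halfSpinorHom hr ε x v) = halfSpinorHom hr ε' x (halfJ hr hε h v) :=
  Subtype.ext (spinorJ_act x (v : Spinor r))

/-! ### Dimensions -/

theorem finrank_real {K : Type} [AddCommGroup K] [Module ℂ K] [Module ℝ K]
    [IsScalarTower ℝ ℂ K] : Module.finrank ℝ K = 2 * Module.finrank ℂ K := by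
  rw [← Module.finrank_mul_finrank ℝ ℂ K, Complex.finrank_real_complex]

theorem finrank_spinor (r : ℕ) : Module.finrank ℂ (Spinor r) = 2 ^ (r / 2) := by
  simp

/-- Clifford multiplication by `e_1` exchanges the half-spinors. -/
def halfSwap {r : ℕ} (hr : Even r) (i : Fin r) (ε : ℂ) : HalfSpinor r ε →ₗ[ℂ] HalfSpinor r (-ε) :=
  (Matrix.toLin' (gamma r i)).restrict fun v hv => by
    rw [Module.End.mem_eigenspace_iff] at hv ⊢
    rw [Matrix.toLin'_apply, chirality_gamma hr, hv, Matrix.mulVec_smul, neg_smul]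

theorem halfSwap_injective {r : ℕ} (hr : Even r) (i : Fin r) (ε : ℂ) :
    Function.Injective (halfSwap hr i ε) := by
  rw [injective_iff_map_eq_zero]
  intro v hv
  have h : gamma r i *ᵥ (v : Spinor r) = 0 := congrArg Subtype.val hv
  have h2 := congrArg (fun w => gamma r i *ᵥ w) h
  simp only [Matrix.mulVec_mulVec, gamma_sq, Matrix.mulVec_zero, Matrix.neg_mulVec,
    Matrix.one_mulVec, neg_eq_zero] at h2
  exact Subtype.ext h2

/-- The two halves are complementary, and a generator embeds each into the other, so each has half
the dimension. -/
theorem finrank_halfSpinor {r : ℕ} (hr : Even r) (h0 : 0 < r) {ε : ℂ} (hε : ε * ε = 1) :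
    Module.finrank ℂ (HalfSpinor r ε) = 2 ^ (r / 2 - 1) := by
  have hε' : -ε * -ε = 1 := by rw [neg_mul_neg, hε]
  have h1 := LinearMap.finrank_le_finrank_of_injective (halfSwap_injective hr ⟨0, h0⟩ ε)
  have h2 := LinearMap.finrank_le_finrank_of_injective (halfSwap_injective hr ⟨0, h0⟩ (-ε))
  rw [neg_neg] at h2
  have hcompl : IsCompl (HalfSpinor r ε) (HalfSpinor r (-ε)) := by
    constructor
    · rw [Submodule.disjoint_def]
      intro v hv hv'
      rw [Module.End.mem_eigenspace_iff] at hv hv'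
      rw [hv] at hv'
      have h3 : (ε + ε) • v = 0 := by
        rw [add_smul]
        nth_rewrite 1 [hv']
        rw [← add_smul, neg_add_cancel, zero_smul]
      refine (smul_eq_zero.1 h3).resolve_left ?_
      rw [← two_mul]
      refine mul_ne_zero two_ne_zero ?_
      rintro rfl
      simp at hε
    · rw [codisjoint_iff, eq_top_iff]
      intro v _
      rw [← halfProj_add hr ε hε hε' v]
      exact Submodule.add_mem_sup (Subtype.mem _) (Subtype.mem _)
  have h3 := Submodule.finrank_add_eq_of_isCompl hcompl
  rw [finrank_spinor] at h3
  have h4 : 2 ^ (r / 2) = 2 * 2 ^ (r / 2 - 1) := by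
    obtain ⟨k, rfl⟩ := hr
    rw [← pow_succ', show (k + k) / 2 - 1 + 1 = (k + k) / 2 by omega]
  omega

theorem nontrivial_halfSpinor {r : ℕ} (hr : Even r) (h0 : 0 < r) {ε : ℂ} (hε : ε * ε = 1) :
    Nontrivial (HalfSpinor r ε) := by
  apply Module.nontrivial_of_finrank_pos (R := ℂ)
  rw [finrank_halfSpinor hr h0 hε]
  positivity

theorem finrank_fixedPoints {K : Type} [AddCommGroup K] [Module ℂ K] [Module ℝ K]
    [IsScalarTower ℝ ℂ K] (j : K →ₗ[ℝ] K)
    (hjI : ∀ v, j (Complex.I • v) = -(Complex.I • j v))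
    (hjj : ∀ v, j (j v) = v) : Module.finrank ℝ (fixedPoints j) = Module.finrank ℂ K := by
  obtain ⟨G, -⟩ := exists_complexification_equiv (fixedPoints j).subtype
    (fixedPoints_inj j hjI hjj) (fixedPoints_surj j hjI hjj)
  rw [← G.finrank_eq, Module.finrank_baseChange]

/-! ### Free modules as tensor products -/

section TensorPi

variable {ι R K : Type} [Fintype ι] [DecidableEq ι] [CommRing R] [AddCommGroup K] [Module R K]

variable (ι R K) in
/-- `R^ι ⊗ K` is the module of `ι`-tuples in `K`. -/
def tensorPi : ((ι → R) ⊗[R] K) ≃ₗ[R] (ι → K) :=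
  (TensorProduct.comm R (ι → R) K).trans (TensorProduct.piScalarRight R R K ι)

theorem tensorPi_tmul (z : ι → R) (k : K) : tensorPi ι R K (z ⊗ₜ k) = fun a => z a • k := by
  simp [tensorPi]

theorem tensorPi_map_right (T : Module.End R K) (x : (ι → R) ⊗[R] K) :
    tensorPi ι R K (TensorProduct.map LinearMap.id T x) = T.compLeft ι (tensorPi ι R K x) := by
  induction x with
  | zero => simp only [map_zero]
  | add x y hx hy => simp only [map_add, hx, hy]
  | tmul z k =>
    funext a
    rw [TensorProduct.map_tmul, LinearMap.compLeft_apply, tensorPi_tmul, tensorPi_tmul]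
    simp

theorem tensorPi_map_left (Y : Matrix ι ι R) (x : (ι → R) ⊗[R] K) :
    tensorPi ι R K (TensorProduct.map (Matrix.toLin' Y) LinearMap.id x) =
      matAct K Y (tensorPi ι R K x) := by
  induction x with
  | zero => simp only [map_zero]
  | add x y hx hy => simp only [map_add, hx, hy]
  | tmul z k =>
    funext a
    rw [TensorProduct.map_tmul, matAct_apply, tensorPi_tmul, tensorPi_tmul]
    simp [Matrix.mulVec, dotProduct, Finset.sum_smul, mul_smul]

theorem tensorPi_symm_compLeft (T : Module.End R K) (t : ι → K) :
    (tensorPi ι R K).symm (T.compLeft ι t) =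
      TensorProduct.map LinearMap.id T ((tensorPi ι R K).symm t) := by
  rw [LinearEquiv.symm_apply_eq, tensorPi_map_right, LinearEquiv.apply_symm_apply]

theorem tensorPi_symm_matAct (Y : Matrix ι ι R) (t : ι → K) :
    (tensorPi ι R K).symm (matAct K Y t) =
      TensorProduct.map (Matrix.toLin' Y) LinearMap.id ((tensorPi ι R K).symm t) := by
  rw [LinearEquiv.symm_apply_eq, tensorPi_map_left, LinearEquiv.apply_symm_apply]

end TensorPi

/-! ### From tuples to tensor products. -/

section Decompositions

variable {r N : ℕ} {Φ : RealRep r N} {B : LinearMap.BilinForm ℝ (RSpace N)}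

theorem complexDecomp_of_equiv {ι K : Type} [Fintype ι] [DecidableEq ι] [AddCommGroup K]
    [Module ℂ K] (s : Cl0 r → Module.End ℂ K) (Y : spinCentralizer Φ B → Matrix ι ι ℂ)
    (G : (ℂ ⊗[ℝ] RSpace N) ≃ₗ[ℂ] (ι → K))
    (h₁ : ∀ x z, G ((Φ x).baseChange ℂ z) = (s x).compLeft ι (G z))
    (h₂ : ∀ (A : spinCentralizer Φ B) z,
      G ((A : Module.End ℝ (RSpace N)).baseChange ℂ z) = matAct K (Y A) (G z)) :
    ComplexDecomp Φ B (fun A => Matrix.toLin' (Y A)) s :=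
  ⟨G.trans (tensorPi ι ℂ K).symm,
    fun x z => by simp only [LinearEquiv.trans_apply, h₁, tensorPi_symm_compLeft],
    fun A z => by simp only [LinearEquiv.trans_apply, h₂, tensorPi_symm_matAct]⟩

theorem complexDecompTwo_of_equiv {ι₁ ι₂ K₁ K₂ : Type} [Fintype ι₁] [DecidableEq ι₁]
    [Fintype ι₂] [DecidableEq ι₂] [AddCommGroup K₁] [Module ℂ K₁] [AddCommGroup K₂] [Module ℂ K₂]
    (s₁ : Cl0 r → Module.End ℂ K₁) (s₂ : Cl0 r → Module.End ℂ K₂)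
    (Y₁ : spinCentralizer Φ B → Matrix ι₁ ι₁ ℂ) (Y₂ : spinCentralizer Φ B → Matrix ι₂ ι₂ ℂ)
    (G : (ℂ ⊗[ℝ] RSpace N) ≃ₗ[ℂ] ((ι₁ → K₁) × (ι₂ → K₂)))
    (h₁ : ∀ x z, G ((Φ x).baseChange ℂ z) =
      ((s₁ x).compLeft ι₁).prodMap ((s₂ x).compLeft ι₂) (G z))
    (h₂ : ∀ (A : spinCentralizer Φ B) z, G ((A : Module.End ℝ (RSpace N)).baseChange ℂ z) =
      (matAct K₁ (Y₁ A)).prodMap (matAct K₂ (Y₂ A)) (G z)) :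
    ComplexDecompTwo Φ B (fun A => Matrix.toLin' (Y₁ A)) s₁ (fun A => Matrix.toLin' (Y₂ A)) s₂ := by
  refine ⟨G.trans ((tensorPi ι₁ ℂ K₁).symm.prodCongr (tensorPi ι₂ ℂ K₂).symm),
    fun x z => ?_, fun A z => ?_⟩
  · rw [LinearEquiv.trans_apply, h₁]
    exact Prod.ext (tensorPi_symm_compLeft _ _) (tensorPi_symm_compLeft _ _)
  · rw [LinearEquiv.trans_apply, h₂]
    exact Prod.ext (tensorPi_symm_matAct _ _) (tensorPi_symm_matAct _ _)

/-- The constructions list the half with volume eigenvalue i or +1 first; for r ≡ 4, 6 that half is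
Δ_r^-. -/
theorem ComplexDecompTwo.swap {E₁ S₁ E₂ S₂ : Type} [AddCommGroup E₁] [Module ℂ E₁]
    [AddCommGroup S₁] [Module ℂ S₁] [AddCommGroup E₂] [Module ℂ E₂] [AddCommGroup S₂] [Module ℂ S₂]
    {e₁ : spinCentralizer Φ B → Module.End ℂ E₁} {s₁ : Cl0 r → Module.End ℂ S₁}
    {e₂ : spinCentralizer Φ B → Module.End ℂ E₂} {s₂ : Cl0 r → Module.End ℂ S₂}
    (h : ComplexDecompTwo Φ B e₁ s₁ e₂ s₂) : ComplexDecompTwo Φ B e₂ s₂ e₁ s₁ := by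
  obtain ⟨F, h₁, h₂⟩ := h
  refine ⟨F.trans (LinearEquiv.prodComm ℂ _ _), fun x z => ?_, fun A z => ?_⟩
  · rw [LinearEquiv.trans_apply, h₁]
    rfl
  · rw [LinearEquiv.trans_apply, h₂]
    rfl

theorem exists_irreducibleRep {S : Type} [AddCommGroup S] [Module ℝ S] [FiniteDimensional ℝ S]
    [Nontrivial S] {ρ : Cl0 r →ₐ[ℝ] Module.End ℝ S} {β : LinearMap.BilinForm ℝ S}
    (hβ : InvariantInner ρ β) (hS : SymmetricSchur ρ β) (hd : Module.finrank ℝ S = dimIrr r) :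
    ∃ (ρ' : Cl0 r →ₐ[ℝ] Module.End ℝ (RSpace (dimIrr r))) (φ : S ≃ₗ[ℝ] RSpace (dimIrr r)),
      IsIrreducibleRep ρ' ∧ ∀ x s, φ (ρ x s) = ρ' x (φ s) := by
  let φ : S ≃ₗ[ℝ] RSpace (dimIrr r) := LinearEquiv.ofFinrankEq _ _ (by simp [hd])
  have hφ : ∀ x s, φ (ρ x s) = ((φ.conjAlgEquiv ℝ).toAlgHom.comp ρ) x (φ s) := fun x s => by
    change φ (ρ x s) = φ (ρ x (φ.symm (φ s)))
    rw [φ.symm_apply_apply]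
  refine ⟨(φ.conjAlgEquiv ℝ).toAlgHom.comp ρ, φ, ⟨?_, fun W hW => ?_⟩, hφ⟩
  · rw [← hd]
    exact Module.finrank_pos
  · rcases eq_bot_or_top_of_symmetricSchur hβ hS (W.comap φ.toLinearMap) (fun x w hw => by
      rw [Submodule.mem_comap] at hw ⊢
      exact (hφ x w) ▸ hW x _ hw) with h | h
    · left
      rw [eq_bot_iff]
      intro w hw
      have : φ.symm w ∈ W.comap φ.toLinearMap := by simpa using hw
      rw [h, Submodule.mem_bot] at this
      simpa using this
    · right
      rw [eq_top_iff]
      intro w _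
      have : φ.symm w ∈ W.comap φ.toLinearMap := h ▸ Submodule.mem_top
      simpa using this

theorem branches_of_equiv {S : Type} [AddCommGroup S] [Module ℝ S] [FiniteDimensional ℝ S]
    [Nontrivial S] {ρ : Cl0 r →ₐ[ℝ] Module.End ℝ S} {β : LinearMap.BilinForm ℝ S}
    (hβ : InvariantInner ρ β) (hS : SymmetricSchur ρ β) (hd : Module.finrank ℝ S = dimIrr r)
    {m : ℕ} (e : (Fin m → S) ≃ₗ[ℝ] RSpace N) (he : ∀ x v, e (piRep m ρ x v) = Φ x (e v)) :
    Branches Φ m := by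
  obtain ⟨ρ', φ, hρ', hφ⟩ := exists_irreducibleRep hβ hS hd
  refine ⟨ρ', hρ', e.symm.trans ((LinearEquiv.piCongrRight fun _ => φ).trans
    (tensorPi (Fin m) ℝ _).symm), fun x v => ?_⟩
  obtain ⟨w, rfl⟩ := e.surjective v
  rw [← he]
  simp only [LinearEquiv.trans_apply, LinearEquiv.symm_apply_apply]
  rw [← tensorPi_symm_compLeft]
  exact congrArg _ (funext fun a => hφ x (w a))

theorem branchesTwo_of_equiv (hr : Even r) {S₁ S₂ : Type} [AddCommGroup S₁] [Module ℝ S₁]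
    [FiniteDimensional ℝ S₁] [Nontrivial S₁] [AddCommGroup S₂] [Module ℝ S₂]
    [FiniteDimensional ℝ S₂] [Nontrivial S₂]
    {ρ₁ : Cl0 r →ₐ[ℝ] Module.End ℝ S₁} {β₁ : LinearMap.BilinForm ℝ S₁}
    {ρ₂ : Cl0 r →ₐ[ℝ] Module.End ℝ S₂} {β₂ : LinearMap.BilinForm ℝ S₂}
    (hβ₁ : InvariantInner ρ₁ β₁) (hS₁ : SymmetricSchur ρ₁ β₁)
    (hd₁ : Module.finrank ℝ S₁ = dimIrr r) (hω₁ : ∀ v, ρ₁ (volEven hr) v = v)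
    (hβ₂ : InvariantInner ρ₂ β₂) (hS₂ : SymmetricSchur ρ₂ β₂)
    (hd₂ : Module.finrank ℝ S₂ = dimIrr r) (hω₂ : ∀ v, ρ₂ (volEven hr) v = -v)
    {m₁ m₂ : ℕ} (e : ((Fin m₁ → S₁) × (Fin m₂ → S₂)) ≃ₗ[ℝ] RSpace N)
    (he : ∀ x v, e (prodRep (piRep m₁ ρ₁) (piRep m₂ ρ₂) x v) = Φ x (e v)) :
    BranchesTwo hr Φ m₁ m₂ := by
  obtain ⟨ρ₁', φ₁, hρ₁', hφ₁⟩ := exists_irreducibleRep hβ₁ hS₁ hd₁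
  obtain ⟨ρ₂', φ₂, hρ₂', hφ₂⟩ := exists_irreducibleRep hβ₂ hS₂ hd₂
  refine ⟨ρ₁', ρ₂', hρ₁', ?_, hρ₂', ?_, e.symm.trans
    (((LinearEquiv.piCongrRight fun _ => φ₁).trans (tensorPi (Fin m₁) ℝ _).symm).prodCongr
      ((LinearEquiv.piCongrRight fun _ => φ₂).trans (tensorPi (Fin m₂) ℝ _).symm)),
    fun x v => ?_⟩
  · refine LinearMap.ext fun v => ?_
    obtain ⟨w, rfl⟩ := φ₁.surjective v
    rw [← hφ₁, hω₁, Module.End.one_apply]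
  · refine LinearMap.ext fun v => ?_
    obtain ⟨w, rfl⟩ := φ₂.surjective v
    rw [← hφ₂, hω₂, map_neg, LinearMap.neg_apply, Module.End.one_apply]
  · obtain ⟨w, rfl⟩ := e.surjective v
    rw [← he]
    simp only [LinearEquiv.trans_apply, LinearEquiv.symm_apply_apply]
    refine Prod.ext ?_ ?_
    · refine Eq.trans ?_ (tensorPi_symm_compLeft _ _)
      exact congrArg (tensorPi (Fin m₁) ℝ _).symm (funext fun a => hφ₁ x (w.1 a))
    · refine Eq.trans ?_ (tensorPi_symm_compLeft _ _)
      exact congrArg (tensorPi (Fin m₂) ℝ _).symm (funext fun a => hφ₂ x (w.2 a))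

end Decompositions

/-! ### Orthogonal decompositions of a representation -/

section Isotypic

variable {r : ℕ} {V S S₁ S₂ : Type} [AddCommGroup V] [Module ℝ V] [AddCommGroup S] [Module ℝ S]
  [AddCommGroup S₁] [Module ℝ S₁] [AddCommGroup S₂] [Module ℝ S₂]

/-- There is a nonzero intertwining map from `ρ` to `σ` with values in `U`. -/
def MapsInto (ρ : Cl0 r →ₐ[ℝ] Module.End ℝ S) (σ : Cl0 r →ₐ[ℝ] Module.End ℝ V)
    (U : Submodule ℝ V) : Prop :=
  ∃ h : S →ₗ[ℝ] V, (∀ x s, h (ρ x s) = σ x (h s)) ∧ h ≠ 0 ∧ ∀ s, h s ∈ U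

theorem MapsInto.comp_surjective {ρ : Cl0 r →ₐ[ℝ] Module.End ℝ S}
    {ρ₁ : Cl0 r →ₐ[ℝ] Module.End ℝ S₁} {σ : Cl0 r →ₐ[ℝ] Module.End ℝ V} {U : Submodule ℝ V}
    (h : MapsInto ρ σ U) (f : S₁ →ₗ[ℝ] S) (hf : ∀ x s, f (ρ₁ x s) = ρ x (f s))
    (hs : Function.Surjective f) : MapsInto ρ₁ σ U := by
  obtain ⟨h, hh, h0, hU⟩ := h
  refine ⟨h ∘ₗ f, fun x s => ?_, fun e => h0 (LinearMap.ext fun v => ?_), fun s => hU _⟩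
  · rw [LinearMap.comp_apply, hf, hh, LinearMap.comp_apply]
  · obtain ⟨w, rfl⟩ := hs v
    exact LinearMap.congr_fun e w

/-- If `S` is spanned by the images of two intertwining maps, one of them can be composed. -/
theorem MapsInto.or_of_span {ρ : Cl0 r →ₐ[ℝ] Module.End ℝ S}
    {ρ₁ : Cl0 r →ₐ[ℝ] Module.End ℝ S₁} {ρ₂ : Cl0 r →ₐ[ℝ] Module.End ℝ S₂}
    {σ : Cl0 r →ₐ[ℝ] Module.End ℝ V} {U : Submodule ℝ V}
    (h : MapsInto ρ σ U) (f₁ : S₁ →ₗ[ℝ] S) (hf₁ : ∀ x s, f₁ (ρ₁ x s) = ρ x (f₁ s))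
    (f₂ : S₂ →ₗ[ℝ] S) (hf₂ : ∀ x s, f₂ (ρ₂ x s) = ρ x (f₂ s))
    (hs : ∀ s, ∃ v w, f₁ v + f₂ w = s) : MapsInto ρ₁ σ U ∨ MapsInto ρ₂ σ U := by
  obtain ⟨h, hh, h0, hU⟩ := h
  by_cases h1 : h ∘ₗ f₁ = 0
  · refine Or.inr ⟨h ∘ₗ f₂, fun x s => by simp [hf₂, hh], fun h2 => h0 ?_, fun s => hU _⟩
    refine LinearMap.ext fun s => ?_
    obtain ⟨v, w, rfl⟩ := hs s
    have e1 := LinearMap.congr_fun h1 v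
    have e2 := LinearMap.congr_fun h2 w
    rw [LinearMap.comp_apply, LinearMap.zero_apply] at e1 e2
    rw [map_add, e1, e2, LinearMap.zero_apply, add_zero]
  · exact Or.inl ⟨h ∘ₗ f₁, fun x s => by simp [hf₁, hh], h1, fun s => hU _⟩

/-- An element acting by opposite nonzero scalars on source and image leaves no room for a nonzero
intertwiner. It is used with the volume element. -/
theorem intertwiner_eq_zero {ρ : Cl0 r →ₐ[ℝ] Module.End ℝ S}
    {σ : Cl0 r →ₐ[ℝ] Module.End ℝ V} {ω : Cl0 r} {δ : ℝ} (f : S →ₗ[ℝ] V)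
    (hf : ∀ x s, f (ρ x s) = σ x (f s)) (h₁ : ∀ s, ρ ω s = δ • s)
    (h₂ : ∀ s, σ ω (f s) = -(δ • f s)) (hδ : δ ≠ 0) : f = 0 := by
  refine LinearMap.ext fun s => ?_
  have h := hf ω s
  rw [h₁, h₂, map_smul, eq_neg_iff_add_eq_zero, ← add_smul] at h
  exact (smul_eq_zero.1 h).resolve_left fun h' => hδ (by linarith)

theorem isometry_injective {M : Type} [AddCommGroup M] [Module ℝ M]
    {ρ : Cl0 r →ₐ[ℝ] Module.End ℝ M} {β : LinearMap.BilinForm ℝ M} (hβ : InvariantInner ρ β)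
    {B : LinearMap.BilinForm ℝ V} (f : M →ₗ[ℝ] V) (hf : ∀ s t, B (f s) (f t) = β s t) :
    Function.Injective f := by
  rw [injective_iff_map_eq_zero]
  intro v hv
  refine hβ.eq_zero ?_
  rw [← hf, hv, map_zero]

theorem InvariantInner.prod {ρ₁ : Cl0 r →ₐ[ℝ] Module.End ℝ S₁} {β₁ : LinearMap.BilinForm ℝ S₁}
    (h₁ : InvariantInner ρ₁ β₁) {ρ₂ : Cl0 r →ₐ[ℝ] Module.End ℝ S₂}
    {β₂ : LinearMap.BilinForm ℝ S₂} (h₂ : InvariantInner ρ₂ β₂) :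
    InvariantInner (prodRep ρ₁ ρ₂) (prodForm β₁ β₂) where
  symm v w := by rw [prodForm_apply, prodForm_apply, h₁.symm, h₂.symm]
  pos v hv := by
    have nonneg₁ : 0 ≤ β₁ v.1 v.1 := by
      by_cases h : v.1 = 0
      · simp [h]
      · exact (h₁.pos _ h).le
    have nonneg₂ : 0 ≤ β₂ v.2 v.2 := by
      by_cases h : v.2 = 0
      · simp [h]
      · exact (h₂.pos _ h).le
    rw [prodForm_apply]
    by_cases h : v.1 = 0
    · exact add_pos_of_nonneg_of_pos nonneg₁ (h₂.pos _ fun h' => hv (Prod.ext h h'))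
    · exact add_pos_of_pos_of_nonneg (h₁.pos _ h) nonneg₂
  skew i j hij v w := by
    simp only [prodForm_apply, prodRep_apply, h₁.skew i j hij, h₂.skew i j hij]
    ring

variable [FiniteDimensional ℝ V] [FiniteDimensional ℝ S] [FiniteDimensional ℝ S₁]
  [FiniteDimensional ℝ S₂]

theorem exists_isotypic_equiv {ρ : Cl0 r →ₐ[ℝ] Module.End ℝ S} {β : LinearMap.BilinForm ℝ S}
    (hβ : InvariantInner ρ β) (hS : SymmetricSchur ρ β) {σ : Cl0 r →ₐ[ℝ] Module.End ℝ V}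
    {B : LinearMap.BilinForm ℝ V} (hB : InvariantInner σ B)
    (hex : ∀ U : Submodule ℝ V, (∀ x, ∀ u ∈ U, σ x u ∈ U) → U ≠ ⊥ → MapsInto ρ σ U) :
    ∃ (m : ℕ) (e : (Fin m → S) ≃ₗ[ℝ] V), (∀ x v, e (piRep m ρ x v) = σ x (e v)) ∧
      ∀ v w, B (e v) (e w) = sumForm m β v w := by
  obtain ⟨m, f, hf, hfB, hfr⟩ := exists_isometry_onto hβ hS hB ⊤ (fun _ _ _ => Submodule.mem_top)
    (fun U _ hU hne => hex U hU hne)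
  exact ⟨m, LinearEquiv.ofBijective f ⟨isometry_injective (hβ.pi m) f hfB,
    LinearMap.range_eq_top.1 hfr⟩, hf, hfB⟩

/-- The central involution ω splits V into its ±1-eigenspaces. Inside each, only the model with the
matching eigenvalue can map nontrivially, so the one-model splitting applies to each eigenspace
separately. -/
theorem exists_two_isotypic_equiv {ω : Cl0 r} (hω : ω * ω = 1) (hc : ∀ x, x * ω = ω * x)
    {ρ₁ : Cl0 r →ₐ[ℝ] Module.End ℝ S₁} {β₁ : LinearMap.BilinForm ℝ S₁}
    (hβ₁ : InvariantInner ρ₁ β₁) (hS₁ : SymmetricSchur ρ₁ β₁) (hω₁ : ∀ v, ρ₁ ω v = v)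
    {ρ₂ : Cl0 r →ₐ[ℝ] Module.End ℝ S₂} {β₂ : LinearMap.BilinForm ℝ S₂}
    (hβ₂ : InvariantInner ρ₂ β₂) (hS₂ : SymmetricSchur ρ₂ β₂) (hω₂ : ∀ v, ρ₂ ω v = -v)
    {σ : Cl0 r →ₐ[ℝ] Module.End ℝ V} {B : LinearMap.BilinForm ℝ V} (hB : InvariantInner σ B)
    (hex : ∀ U : Submodule ℝ V, (∀ x, ∀ u ∈ U, σ x u ∈ U) → U ≠ ⊥ →
      MapsInto ρ₁ σ U ∨ MapsInto ρ₂ σ U) :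
    ∃ (m₁ m₂ : ℕ) (e : ((Fin m₁ → S₁) × (Fin m₂ → S₂)) ≃ₗ[ℝ] V),
      (∀ x v, e (prodRep (piRep m₁ ρ₁) (piRep m₂ ρ₂) x v) = σ x (e v)) ∧
      ∀ v w, B (e v) (e w) = prodForm (sumForm m₁ β₁) (sumForm m₂ β₂) v w := by
  have hσ : ∀ v, σ ω (σ ω v) = v := fun v => by
    rw [← Module.End.mul_apply, ← map_mul, hω, map_one, Module.End.one_apply]
  have hinv : ∀ δ : ℝ, ∀ x, ∀ u ∈ Module.End.eigenspace (σ ω) δ,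
      σ x u ∈ Module.End.eigenspace (σ ω) δ := fun δ x u hu => by
    rw [Module.End.mem_eigenspace_iff] at hu ⊢
    rw [← Module.End.mul_apply, ← map_mul, ← hc, map_mul, Module.End.mul_apply, hu, map_smul]
  obtain ⟨m₁, f₁, hf₁, hfB₁, hfr₁⟩ := exists_isometry_onto hβ₁ hS₁ hB
    (Module.End.eigenspace (σ ω) 1) (hinv 1) (fun U hU hUi hne => by
      refine (hex U hUi hne).resolve_right fun ⟨h, hh, h0, hhU⟩ => h0 ?_
      refine intertwiner_eq_zero (ω := ω) (δ := -1) h hh (fun s => by simp [hω₂])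
        (fun s => ?_) (by norm_num)
      rw [Module.End.mem_eigenspace_iff.1 (hU (hhU s))]
      simp)
  obtain ⟨m₂, f₂, hf₂, hfB₂, hfr₂⟩ := exists_isometry_onto hβ₂ hS₂ hB
    (Module.End.eigenspace (σ ω) (-1)) (hinv (-1)) (fun U hU hUi hne => by
      refine (hex U hUi hne).resolve_left fun ⟨h, hh, h0, hhU⟩ => h0 ?_
      refine intertwiner_eq_zero (ω := ω) (δ := 1) h hh (fun s => by simp [hω₁])
        (fun s => ?_) (by norm_num)
      rw [Module.End.mem_eigenspace_iff.1 (hU (hhU s))]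
      simp)
  -- The adjoint of f₁ composed with f₂ intertwines representations with opposite values of ω, hence
  -- it is zero.
  have horth : ∀ s t, B (f₁ s) (f₂ t) = 0 := by
    obtain ⟨g, hg⟩ := (hβ₁.pi m₁).exists_adjoint (B ∘ₗ f₁)
    have hg' : ∀ s v, sumForm m₁ β₁ s (g v) = B (f₁ s) v := hg
    have hgi := adjoint_intertwines (hβ₁.pi m₁) hB hf₁ hg'
    have h0 : g ∘ₗ f₂ = 0 := by
      refine intertwiner_eq_zero (ρ := piRep m₂ ρ₂) (σ := piRep m₁ ρ₁) (ω := ω) (δ := -1) _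
        (fun x s => by rw [LinearMap.comp_apply, hf₂, hgi, LinearMap.comp_apply])
        (fun s => funext fun a => ?_) (fun s => funext fun a => ?_) (by norm_num)
      · rw [piRep_apply, hω₂]
        simp
      · rw [piRep_apply, hω₁]
        simp
    intro s t
    rw [← hg', ← LinearMap.comp_apply g f₂ t, h0, LinearMap.zero_apply, map_zero]
  have hiso : ∀ v w, B (f₁.coprod f₂ v) (f₁.coprod f₂ w) =
      prodForm (sumForm m₁ β₁) (sumForm m₂ β₂) v w := fun v w => by
    rw [LinearMap.coprod_apply, LinearMap.coprod_apply, prodForm_apply, ← hfB₁, ← hfB₂,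
      map_add B, LinearMap.add_apply, map_add (B _), map_add (B _), horth,
      hB.symm (f₂ v.2) (f₁ w.1), horth]
    ring
  refine ⟨m₁, m₂, LinearEquiv.ofBijective (f₁.coprod f₂)
    ⟨isometry_injective ((hβ₁.pi m₁).prod (hβ₂.pi m₂)) _ hiso, fun v => ?_⟩,
    fun x v => ?_, hiso⟩
  -- Projections to the two eigenspaces of the involution.
  · have h₁ : (1 / 2 : ℝ) • (v + σ ω v) ∈ LinearMap.range f₁ := by
      rw [hfr₁, Module.End.mem_eigenspace_iff, map_smul, map_add, hσ, add_comm, one_smul]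
    have h₂ : (1 / 2 : ℝ) • (v - σ ω v) ∈ LinearMap.range f₂ := by
      rw [hfr₂, Module.End.mem_eigenspace_iff, map_smul, map_sub, hσ]
      module
    obtain ⟨s, hs⟩ := h₁
    obtain ⟨t, ht⟩ := h₂
    refine ⟨(s, t), ?_⟩
    rw [LinearMap.coprod_apply, hs, ht]
    module
  · change f₁ (piRep m₁ ρ₁ x v.1) + f₂ (piRep m₂ ρ₂ x v.2) = σ x (f₁ v.1 + f₂ v.2)
    rw [hf₁, hf₂, map_add]

end Isotypic

/-! ### The cases of the theorem -/

section Cases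

theorem finiteDimensional_real (K : Type) [AddCommGroup K] [Module ℂ K] [Module ℝ K]
    [IsScalarTower ℝ ℂ K] [FiniteDimensional ℂ K] : FiniteDimensional ℝ K :=
  Module.Finite.trans ℂ K

/-- K is spanned by the fixed points and i times the fixed points, which are two copies of the same
real representation. -/
theorem MapsInto.fixedRep {r : ℕ} {K V : Type} [AddCommGroup K] [Module ℂ K] [Module ℝ K]
    [IsScalarTower ℝ ℂ K] [AddCommGroup V] [Module ℝ V] {s : Cl0 r →ₐ[ℝ] Module.End ℂ K}
    {σ : Cl0 r →ₐ[ℝ] Module.End ℝ V} {U : Submodule ℝ V} (h : MapsInto (restrictReal s) σ U)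
    (j : K →ₗ[ℝ] K) (hjI : ∀ v, j (Complex.I • v) = -(Complex.I • j v))
    (hjj : ∀ v, j (j v) = v) (hj : ∀ x v, j (s x v) = s x (j v)) :
    MapsInto (fixedRep s j hj) σ U := by
  refine or_self_iff.1 (h.or_of_span (fixedPoints j).subtype (fun x v => rfl)
    ((LinearMap.lsmul ℂ K Complex.I).restrictScalars ℝ ∘ₗ (fixedPoints j).subtype)
    (fun x v => ?_) (fixedPoints_surj j hjI hjj))
  exact (map_smul (s x) Complex.I (v : K)).symm

theorem MapsInto.halfSpinor {r : ℕ} (hr : Even r) {V : Type} [AddCommGroup V] [Module ℝ V]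
    {σ : Cl0 r →ₐ[ℝ] Module.End ℝ V} {U : Submodule ℝ V}
    (h : MapsInto (restrictReal (spinorHom r)) σ U) {ε ε' : ℂ} (hε : ε * ε = 1) (hε' : -ε = ε') :
    MapsInto (restrictReal (halfSpinorHom hr ε)) σ U ∨
      MapsInto (restrictReal (halfSpinorHom hr ε')) σ U := by
  subst hε'
  refine h.or_of_span ((HalfSpinor r ε).subtype.restrictScalars ℝ) (fun x v => rfl)
    ((HalfSpinor r (-ε)).subtype.restrictScalars ℝ) (fun x v => rfl) fun v => ?_
  have hε' : -ε * -ε = 1 := by rw [neg_mul_neg, hε]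
  exact ⟨halfProj hr ε hε v, halfProj hr (-ε) hε' v, halfProj_add hr ε hε hε' v⟩

theorem piRep_intertwiner_eq_zero {r m₁ m₂ : ℕ} {S₁ S₂ : Type} [AddCommGroup S₁] [Module ℝ S₁]
    [AddCommGroup S₂] [Module ℝ S₂] {ρ₁ : Cl0 r →ₐ[ℝ] Module.End ℝ S₁}
    {ρ₂ : Cl0 r →ₐ[ℝ] Module.End ℝ S₂} {ω : Cl0 r} {δ : ℝ} (hδ : δ ≠ 0)
    (h₁ : ∀ s, ρ₁ ω s = δ • s) (h₂ : ∀ s, ρ₂ ω s = -(δ • s))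
    (f : (Fin m₁ → S₁) →ₗ[ℝ] (Fin m₂ → S₂))
    (hf : ∀ x v, f (piRep m₁ ρ₁ x v) = piRep m₂ ρ₂ x (f v)) : f = 0 :=
  intertwiner_eq_zero (ω := ω) f hf (fun _ => funext fun _ => h₁ _) (fun _ => funext fun _ => h₂ _) hδ

variable {r N : ℕ} {Φ : RealRep r N} {B : LinearMap.BilinForm ℝ (RSpace N)}

theorem IsHermitian.invariantInner (hB : IsHermitian Φ B) (h : Φ 1 = 1) :
    InvariantInner (unitalRep Φ h) B :=
  ⟨hB.symm, hB.pos, hB.skew⟩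

theorem mapsInto_spinor {V : Type} [AddCommGroup V] [Module ℝ V]
    (σ : Cl0 r →ₐ[ℝ] Module.End ℝ V) (U : Submodule ℝ V) (hU : ∀ x, ∀ u ∈ U, σ x u ∈ U)
    (hne : U ≠ ⊥) : MapsInto (restrictReal (spinorHom r)) σ U :=
  exists_spinor_intertwiner σ U hU hne

/-- The case r ≡ 1, 7: J is a real structure, and the irreducible representation is its space of
fixed points. -/
theorem exists_decomp_real (hr : Odd r) (h1 : Φ 1 = 1) (hB : IsHermitian Φ B)
    (hsq : r / 2 % 4 = 0 ∨ r / 2 % 4 = 3) (hd : dimIrr r = 2 ^ (r / 2)) :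
    ∃ m : ℕ, Branches Φ m ∧ ∃ θ : spinCentralizer Φ B ≃ₗ⁅ℝ⁆ so m,
      ComplexDecomp Φ B (fun A => soStd (θ A)) (spinorAct r) := by
  have hjj : ∀ v, spinorJ r (spinorJ r v) = v := fun v => by
    rw [spinorJ_sq, if_pos hsq, one_smul]
  have := fixed_nontrivial (spinorJ r) spinorJ_I_smul hjj
  have hβ := fixed_inner (spinorForm_odd hr) (spinorJ r) spinorJ_act
  have hS := fixed_symmetricSchur (spinorForm_odd hr) (spinorJ r) spinorJ_I_smul hjj spinorJ_act
  obtain ⟨m, e, heA, heB⟩ := exists_isotypic_equiv hβ hS (hB.invariantInner h1)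
    fun U hU hne => (mapsInto_spinor _ U hU hne).fixedRep _ spinorJ_I_smul hjj spinorJ_act
  obtain ⟨θ, -, G, hG₁, hG₂⟩ := exists_decomp_of_isModel h1
    (isModel_real (spinorForm_odd hr) (spinorJ r) spinorJ_I_smul hjj spinorJ_act m) e heA heB
  refine ⟨m, branches_of_equiv hβ hS ?_ e heA, θ, complexDecomp_of_equiv _
    (fun A => ((θ A : so m) : Matrix (Fin m) (Fin m) ℝ).map Complex.ofReal) G hG₁ hG₂⟩
  rw [finrank_fixedPoints _ spinorJ_I_smul hjj, finrank_spinor, hd]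

theorem quaternionicStructure_spinor (hsq : ¬(r / 2 % 4 = 0 ∨ r / 2 % 4 = 3)) :
    QuaternionicStructure (spinorHom r) (spinorForm r) (spinorJ r) :=
  ⟨spinorJ_I_smul, fun v => by rw [spinorJ_sq, if_neg hsq, neg_one_smul], spinorJ_act,
    spinorJ_form⟩

/-- The case r ≡ 3, 5: J is a quaternionic structure, and Δ_r is already irreducible over ℝ, which
doubles the real dimension. -/
theorem exists_decomp_quaternionic (hr : Odd r) (h1 : Φ 1 = 1) (hB : IsHermitian Φ B)
    (hsq : ¬(r / 2 % 4 = 0 ∨ r / 2 % 4 = 3)) (hd : dimIrr r = 2 ^ (r / 2 + 1)) :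
    ∃ m : ℕ, Branches Φ m ∧ ∃ θ : spinCentralizer Φ B ≃ₗ⁅ℝ⁆ sp m,
      ComplexDecomp Φ B (fun A => spStd (θ A)) (spinorAct r) := by
  have hj := quaternionicStructure_spinor hsq
  have hS := quaternionic_symmetricSchur (spinorForm_odd hr) hj
  obtain ⟨m, e, heA, heB⟩ := exists_isotypic_equiv (spinorForm_inner r) hS (hB.invariantInner h1)
    (mapsInto_spinor _)
  obtain ⟨θ, -, G, hG₁, hG₂⟩ := exists_decomp_of_isModel h1
    (isModel_quaternionic (spinorForm_odd hr) hj m) e heA heB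
  refine ⟨m, branches_of_equiv (spinorForm_inner r) hS ?_ e heA, θ, complexDecomp_of_equiv _
    (fun A => ((θ A : sp m) : Matrix (Fin m ⊕ Fin m) (Fin m ⊕ Fin m) ℂ)) G hG₁ hG₂⟩
  rw [finrank_real, finrank_spinor, hd, pow_succ']

theorem halfSpinorHom_volEven (hr : Even r) {ε c : ℂ} (hc : Complex.I ^ (r / 2) * ε = c)
    (v : HalfSpinor r ε) : halfSpinorHom hr ε (volEven hr) v = c • v := by
  apply Subtype.ext
  rw [coe_halfSpinorHom, spinorHom_volEven hr v.2, hc]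
  rfl

theorem halfJ_halfJ (hr : Even r) {ε ε' : ℂ} (hε : star ε = ε) (h : (-1 : ℂ) ^ (r / 2) * ε = ε')
    (hε' : star ε' = ε') (h' : (-1 : ℂ) ^ (r / 2) * ε' = ε) (v : HalfSpinor r ε) :
    halfJ hr hε' h' (halfJ hr hε h v) =
      (if r / 2 % 4 = 0 ∨ r / 2 % 4 = 3 then (1 : ℂ) else -1) • v :=
  Subtype.ext (spinorJ_sq (v : Spinor r))

theorem halfJ_surjective (hr : Even r) {ε ε' : ℂ} (hε : star ε = ε)
    (h : (-1 : ℂ) ^ (r / 2) * ε = ε')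
    (hε' : star ε' = ε') (h' : (-1 : ℂ) ^ (r / 2) * ε' = ε) :
    Function.Surjective (halfJ hr hε h) := by
  intro v
  have h2 := halfJ_halfJ hr hε' h' hε h v
  split_ifs at h2 with hs
  · exact ⟨_, h2.trans (one_smul _ _)⟩
  · refine ⟨-halfJ hr hε' h' v, ?_⟩
    rw [map_neg, h2]
    exact (congrArg Neg.neg (neg_one_smul ℂ v)).trans (neg_neg v)

theorem halfJ_injective (hr : Even r) {ε ε' : ℂ} (hε : star ε = ε)
    (h : (-1 : ℂ) ^ (r / 2) * ε = ε')
    (hε' : star ε' = ε') (h' : (-1 : ℂ) ^ (r / 2) * ε' = ε) :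
    Function.Injective (halfJ hr hε h) := by
  rw [injective_iff_map_eq_zero]
  intro v hv
  have h2 := halfJ_halfJ hr hε h hε' h' v
  rw [hv, map_zero] at h2
  refine (smul_eq_zero.1 h2.symm).resolve_left ?_
  split_ifs <;> simp

/-- The cases r ≡ 2, 6: ε is the sign for which the volume element acts by i on Δ_r^ε. The other
half is equivalent to it as a real representation through J, so a single real irreducible occurs,
and the same J provides the conjugate factor of the complexification. -/
theorem exists_decomp_complex (he : Even r) (h0 : 0 < r) (h1 : Φ 1 = 1) (hB : IsHermitian Φ B)
    {ε ε' : ℂ} (hε : ε * ε = 1) (hs : star ε = ε) (hε' : -ε = ε')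
    (hI : Complex.I ^ (r / 2) * ε = Complex.I) (hk : Odd (r / 2)) (hd : dimIrr r = 2 ^ (r / 2)) :
    ∃ m : ℕ, Branches Φ m ∧ ∃ θ : spinCentralizer Φ B ≃ₗ⁅ℝ⁆ u m,
      (∃ hJ : Φ (volEven he) ∈ spinCentralizer Φ B,
        (θ ⟨Φ (volEven he), hJ⟩ : Matrix (Fin m) (Fin m) ℂ) =
          Complex.I • (1 : Matrix (Fin m) (Fin m) ℂ)) ∧
      ComplexDecompTwo Φ B (fun A => uStd (θ A)) (halfSpinorAct he ε)
        (fun A => uConj (θ A)) (halfSpinorAct he ε') := by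
  have hs' : star ε' = ε' := by rw [← hε', star_neg, hs]
  have hj : (-1 : ℂ) ^ (r / 2) * ε = ε' := by rw [hk.neg_one_pow, neg_one_mul, hε']
  have hj' : (-1 : ℂ) ^ (r / 2) * ε' = ε := by
    rw [hk.neg_one_pow, neg_one_mul, ← hε', neg_neg]
  have hf := spinorForm_half he h0 hε
  have hω := halfSpinorHom_volEven he hI
  have := nontrivial_halfSpinor he h0 hε
  have := finiteDimensional_real (HalfSpinor r ε)
  have hS := complex_symmetricSchur hf (volEven he) hω
  obtain ⟨m, e, heA, heB⟩ := exists_isotypic_equiv hf.inner hS (hB.invariantInner h1)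
    fun U hU hne => ((mapsInto_spinor _ U hU hne).halfSpinor he hε hε').elim id fun h =>
      h.comp_surjective (halfJ he hs hj) (halfJ_act he hs hj) (halfJ_surjective he hs hj hs' hj')
  obtain ⟨θ, hθ, G, hG₁, hG₂⟩ := exists_decomp_of_isModel h1
    (isModel_complex hf (volEven he) hω (halfJ he hs hj) (halfJ_I_smul he hs hj)
      ⟨halfJ_injective he hs hj hs' hj', halfJ_surjective he hs hj hs' hj'⟩
      (halfJ_act he hs hj) m) e heA heB
  refine ⟨m, branches_of_equiv hf.inner hS ?_ e heA, θ, ?_, complexDecompTwo_of_equiv _ _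
    (fun A => ((θ A : u m) : Matrix (Fin m) (Fin m) ℂ))
    (fun A => ((θ A : u m) : Matrix (Fin m) (Fin m) ℂ).map (starRingEnd ℂ)) G hG₁ hG₂⟩
  · rw [finrank_real, finrank_halfSpinor he h0 hε, hd, ← pow_succ', Nat.sub_add_cancel hk.pos]
  -- The element of the centralizer corresponding to i Id is Φ(vol), because vol acts by i on every
  -- copy. Membership of Φ(vol) in the centralizer follows from this identification.
  · let X : u m := ⟨Complex.I • (1 : Matrix (Fin m) (Fin m) ℂ), by
      change (Complex.I • (1 : Matrix (Fin m) (Fin m) ℂ))ᴴ = -_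
      rw [Matrix.conjTranspose_smul, Matrix.conjTranspose_one]
      simp⟩
    have hA : ((θ.symm X : spinCentralizer Φ B) : Module.End ℝ (RSpace N)) =
        Φ (volEven he) := by
      refine LinearMap.ext fun v => ?_
      obtain ⟨w, rfl⟩ := e.surjective v
      rw [hθ, LieEquiv.apply_symm_apply]
      refine Eq.trans ?_ (heA _ _)
      refine congrArg e (funext fun a => ?_)
      change matAct _ (Complex.I • (1 : Matrix (Fin m) (Fin m) ℂ)) w a = _
      rw [piRep_apply, restrictReal_apply, hω, matAct_apply, Finset.sum_eq_single a]
      · simp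
      · intro b _ hb
        simp [hb.symm]
      · simp
    have hJ : Φ (volEven he) ∈ spinCentralizer Φ B := hA ▸ (θ.symm X).2
    refine ⟨hJ, ?_⟩
    have h2 : (⟨Φ (volEven he), hJ⟩ : spinCentralizer Φ B) = θ.symm X := Subtype.ext hA.symm
    rw [h2, LieEquiv.apply_symm_apply]

theorem volEven_central (he : Even r) (x : Cl0 r) : x * volEven he = volEven he * x :=
  Subtype.ext (vol_comm he x x.2)

/-- The case r ≡ 0: J restricts to a real structure on each half, and i^{r/2} = 1 makes the volume
eigenvalue agree with the chirality. -/
theorem exists_decomp_two_real (he : Even r) (h0 : 0 < r) (h1 : Φ 1 = 1) (hB : IsHermitian Φ B)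
    (hk : r / 2 % 4 = 0) (hd : dimIrr r = 2 ^ (r / 2 - 1)) :
    ∃ m₁ m₂ : ℕ, BranchesTwo he Φ m₁ m₂ ∧
      ∃ θ : spinCentralizer Φ B ≃ₗ⁅ℝ⁆ (so m₁ × so m₂),
        ComplexDecompTwo Φ B (fun A => soStd (θ A).1) (halfSpinorAct he 1)
          (fun A => soStd (θ A).2) (halfSpinorAct he (-1)) := by
  have hk2 : Even (r / 2) := Nat.even_iff.2 (by omega)
  have hI : Complex.I ^ (r / 2) = 1 := by
    rw [← Nat.div_add_mod (r / 2) 4, hk, add_zero, pow_mul, Complex.I_pow_four, one_pow]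
  have hω2 : volEven he * volEven he = 1 := by
    rw [volEven_mul_self, hk2.neg_one_pow, one_smul]
  have hε₁ : (1 : ℂ) * 1 = 1 := one_mul 1
  have hε₂ : (-1 : ℂ) * -1 = 1 := by norm_num
  have hs₁ : star (1 : ℂ) = 1 := star_one _
  have hs₂ : star (-1 : ℂ) = -1 := by rw [star_neg, star_one]
  have hj₁ : (-1 : ℂ) ^ (r / 2) * 1 = 1 := by rw [hk2.neg_one_pow, one_mul]
  have hj₂ : (-1 : ℂ) ^ (r / 2) * -1 = -1 := by rw [hk2.neg_one_pow, one_mul]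
  have hf₁ := spinorForm_half he h0 hε₁
  have hf₂ := spinorForm_half he h0 hε₂
  have hjj₁ : ∀ v, halfJ he hs₁ hj₁ (halfJ he hs₁ hj₁ v) = v := fun v => by
    rw [halfJ_halfJ, if_pos (Or.inl hk), one_smul]
  have hjj₂ : ∀ v, halfJ he hs₂ hj₂ (halfJ he hs₂ hj₂ v) = v := fun v => by
    rw [halfJ_halfJ, if_pos (Or.inl hk), one_smul]
  have := nontrivial_halfSpinor he h0 hε₁
  have := nontrivial_halfSpinor he h0 hε₂
  have := finiteDimensional_real (HalfSpinor r 1)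
  have := finiteDimensional_real (HalfSpinor r (-1))
  have := fixed_nontrivial _ (halfJ_I_smul he hs₁ hj₁) hjj₁
  have := fixed_nontrivial _ (halfJ_I_smul he hs₂ hj₂) hjj₂
  have hβ₁ := fixed_inner hf₁ _ (halfJ_act he hs₁ hj₁)
  have hβ₂ := fixed_inner hf₂ _ (halfJ_act he hs₂ hj₂)
  have hS₁ := fixed_symmetricSchur hf₁ _ (halfJ_I_smul he hs₁ hj₁) hjj₁ (halfJ_act he hs₁ hj₁)
  have hS₂ := fixed_symmetricSchur hf₂ _ (halfJ_I_smul he hs₂ hj₂) hjj₂ (halfJ_act he hs₂ hj₂)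
  have hω₁ : ∀ v, fixedRep _ _ (halfJ_act he hs₁ hj₁) (volEven he) v = v := fun v =>
    Subtype.ext (by
      rw [fixedRep_apply, halfSpinorHom_volEven he (c := 1) (by rw [hI, one_mul]), one_smul])
  have hω₂ : ∀ v, fixedRep _ _ (halfJ_act he hs₂ hj₂) (volEven he) v = -v := fun v =>
    Subtype.ext (by
      rw [fixedRep_apply, halfSpinorHom_volEven he (c := -1) (by rw [hI, one_mul])]
      exact neg_one_smul ℂ (v : HalfSpinor r (-1)))
  obtain ⟨m₁, m₂, e, heA, heB⟩ := exists_two_isotypic_equiv hω2 (volEven_central he) hβ₁ hS₁ hω₁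
    hβ₂ hS₂ hω₂ (hB.invariantInner h1)
    fun U hU hne => ((mapsInto_spinor _ U hU hne).halfSpinor he hε₁ rfl).imp
      (fun h => h.fixedRep _ (halfJ_I_smul he hs₁ hj₁) hjj₁ _)
      (fun h => h.fixedRep _ (halfJ_I_smul he hs₂ hj₂) hjj₂ _)
  obtain ⟨θ, -, G, hG₁, hG₂⟩ := exists_decomp_of_isModel h1
    ((isModel_real hf₁ _ (halfJ_I_smul he hs₁ hj₁) hjj₁ (halfJ_act he hs₁ hj₁) m₁).prod
      (isModel_real hf₂ _ (halfJ_I_smul he hs₂ hj₂) hjj₂ (halfJ_act he hs₂ hj₂) m₂)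
      (fun f hf => piRep_intertwiner_eq_zero one_ne_zero
        (fun s => (hω₁ s).trans (by simp)) (fun s => (hω₂ s).trans (by simp)) f hf)
      (fun f hf => piRep_intertwiner_eq_zero (δ := -1) (by norm_num)
        (fun s => (hω₂ s).trans (by simp)) (fun s => (hω₁ s).trans (by module)) f hf)) e heA heB
  refine ⟨m₁, m₂, branchesTwo_of_equiv he hβ₁ hS₁ ?_ hω₁ hβ₂ hS₂ ?_ hω₂ e heA, θ,
    complexDecompTwo_of_equiv _ _
      (fun A => (((θ A).1 : so m₁) : Matrix (Fin m₁) (Fin m₁) ℝ).map Complex.ofReal)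
      (fun A => (((θ A).2 : so m₂) : Matrix (Fin m₂) (Fin m₂) ℝ).map Complex.ofReal) G hG₁ hG₂⟩
  · rw [finrank_fixedPoints _ (halfJ_I_smul he hs₁ hj₁) hjj₁, finrank_halfSpinor he h0 hε₁, hd]
  · rw [finrank_fixedPoints _ (halfJ_I_smul he hs₂ hj₂) hjj₂, finrank_halfSpinor he h0 hε₂, hd]

theorem quaternionicStructure_halfSpinor (he : Even r) {ε : ℂ} (hs : star ε = ε)
    (hj : (-1 : ℂ) ^ (r / 2) * ε = ε) (hsq : ¬(r / 2 % 4 = 0 ∨ r / 2 % 4 = 3)) :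
    QuaternionicStructure (halfSpinorHom he ε) (halfForm r ε) (halfJ he hs hj) :=
  ⟨halfJ_I_smul he hs hj, fun v => by
      rw [halfJ_halfJ, if_neg hsq]
      exact neg_one_smul ℂ v,
    halfJ_act he hs hj, fun v w => spinorJ_form (v : Spinor r) w⟩

/-- The case r ≡ 4: J restricts to a quaternionic structure on each half. Here i^{r/2} = -1, so the
volume element is +1 on Δ_r^-, and that half is the first model, with multiplicity m₁. -/
theorem exists_decomp_two_quaternionic (he : Even r) (h0 : 0 < r) (h1 : Φ 1 = 1)
    (hB : IsHermitian Φ B) (hk : r / 2 % 4 = 2) (hd : dimIrr r = 2 ^ (r / 2)) :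
    ∃ m₁ m₂ : ℕ, BranchesTwo he Φ m₁ m₂ ∧
      ∃ θ : spinCentralizer Φ B ≃ₗ⁅ℝ⁆ (sp m₁ × sp m₂),
        ComplexDecompTwo Φ B (fun A => spStd (θ A).2) (halfSpinorAct he 1)
          (fun A => spStd (θ A).1) (halfSpinorAct he (-1)) := by
  have hk2 : Even (r / 2) := Nat.even_iff.2 (by omega)
  have hI : Complex.I ^ (r / 2) = -1 := by
    rw [← Nat.div_add_mod (r / 2) 4, hk, pow_add, pow_mul, Complex.I_pow_four, one_pow, one_mul,
      Complex.I_sq]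
  have hω2 : volEven he * volEven he = 1 := by
    rw [volEven_mul_self, hk2.neg_one_pow, one_smul]
  have hε₁ : (-1 : ℂ) * -1 = 1 := by norm_num
  have hε₂ : (1 : ℂ) * 1 = 1 := one_mul 1
  have hf₁ := spinorForm_half he h0 hε₁
  have hf₂ := spinorForm_half he h0 hε₂
  have hq₁ := quaternionicStructure_halfSpinor he (ε := -1) (by rw [star_neg, star_one])
    (by rw [hk2.neg_one_pow, one_mul]) (by omega)
  have hq₂ := quaternionicStructure_halfSpinor he (ε := 1) (star_one _)
    (by rw [hk2.neg_one_pow, one_mul]) (by omega)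
  have := nontrivial_halfSpinor he h0 hε₁
  have := nontrivial_halfSpinor he h0 hε₂
  have := finiteDimensional_real (HalfSpinor r 1)
  have := finiteDimensional_real (HalfSpinor r (-1))
  have hS₁ := quaternionic_symmetricSchur hf₁ hq₁
  have hS₂ := quaternionic_symmetricSchur hf₂ hq₂
  have hω₁ : ∀ v, restrictReal (halfSpinorHom he (-1)) (volEven he) v = v := fun v => by
    rw [restrictReal_apply, halfSpinorHom_volEven he (c := 1) (by rw [hI, hε₁]), one_smul]
  have hω₂ : ∀ v, restrictReal (halfSpinorHom he 1) (volEven he) v = -v := fun v => by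
    rw [restrictReal_apply, halfSpinorHom_volEven he (c := -1) (by rw [hI, mul_one])]
    exact neg_one_smul ℂ v
  obtain ⟨m₁, m₂, e, heA, heB⟩ := exists_two_isotypic_equiv hω2 (volEven_central he) hf₁.inner
    hS₁ hω₁ hf₂.inner hS₂ hω₂ (hB.invariantInner h1)
    fun U hU hne => (mapsInto_spinor _ U hU hne).halfSpinor he hε₁ (neg_neg 1)
  obtain ⟨θ, -, G, hG₁, hG₂⟩ := exists_decomp_of_isModel h1
    ((isModel_quaternionic hf₁ hq₁ m₁).prod (isModel_quaternionic hf₂ hq₂ m₂)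
      (fun f hf => piRep_intertwiner_eq_zero one_ne_zero
        (fun s => (hω₁ s).trans (by simp)) (fun s => (hω₂ s).trans (by simp)) f hf)
      (fun f hf => piRep_intertwiner_eq_zero (δ := -1) (by norm_num)
        (fun s => (hω₂ s).trans (by simp)) (fun s => (hω₁ s).trans (by module)) f hf)) e heA heB
  refine ⟨m₁, m₂, branchesTwo_of_equiv he hf₁.inner hS₁ ?_ hω₁ hf₂.inner hS₂ ?_ hω₂ e heA, θ,
    (complexDecompTwo_of_equiv _ _
      (fun A => (((θ A).1 : sp m₁) : Matrix (Fin m₁ ⊕ Fin m₁) (Fin m₁ ⊕ Fin m₁) ℂ))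
      (fun A => (((θ A).2 : sp m₂) : Matrix (Fin m₂ ⊕ Fin m₂) (Fin m₂ ⊕ Fin m₂) ℂ))
      G hG₁ hG₂).swap⟩
  · rw [finrank_real, finrank_halfSpinor he h0 hε₁, hd, ← pow_succ',
      Nat.sub_add_cancel (by omega)]
  · rw [finrank_real, finrank_halfSpinor he h0 hε₂, hd, ← pow_succ',
      Nat.sub_add_cancel (by omega)]

end Cases

end EvenClifford

end

/-! ### The theorem: selection of the case by the residue of r. -/

theorem mainTheorem4 (r N : ℕ) (hr : 1 ≤ r) (Φ : EvenClifford.RealRep r N)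
    (hΦ : EvenClifford.NoTrivialSummand Φ) :
    (∃ B : LinearMap.BilinForm ℝ (EvenClifford.RSpace N), EvenClifford.IsHermitian Φ B) ∧
    ∀ B : LinearMap.BilinForm ℝ (EvenClifford.RSpace N), EvenClifford.IsHermitian Φ B →
      (r % 8 = 1 ∨ r % 8 = 7 →
        ∃ m : ℕ, EvenClifford.Branches Φ m ∧
        ∃ θ : EvenClifford.spinCentralizer Φ B ≃ₗ⁅ℝ⁆ EvenClifford.so m,
          EvenClifford.ComplexDecomp Φ B
            (fun A => EvenClifford.soStd (θ A)) (EvenClifford.spinorAct r)) ∧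
      (r % 8 = 3 ∨ r % 8 = 5 →
        ∃ m : ℕ, EvenClifford.Branches Φ m ∧
        ∃ θ : EvenClifford.spinCentralizer Φ B ≃ₗ⁅ℝ⁆ EvenClifford.sp m,
          EvenClifford.ComplexDecomp Φ B
            (fun A => EvenClifford.spStd (θ A)) (EvenClifford.spinorAct r)) ∧
      (∀ he : Even r,
        (r % 8 = 0 →
          ∃ m₁ m₂ : ℕ, EvenClifford.BranchesTwo he Φ m₁ m₂ ∧
          ∃ θ : EvenClifford.spinCentralizer Φ B ≃ₗ⁅ℝ⁆
              (EvenClifford.so m₁ × EvenClifford.so m₂),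
            EvenClifford.ComplexDecompTwo Φ B
              (fun A => EvenClifford.soStd (θ A).1) (EvenClifford.halfSpinorAct he 1)
              (fun A => EvenClifford.soStd (θ A).2) (EvenClifford.halfSpinorAct he (-1))) ∧
        (r % 8 = 2 →
          ∃ m : ℕ, EvenClifford.Branches Φ m ∧
          ∃ θ : EvenClifford.spinCentralizer Φ B ≃ₗ⁅ℝ⁆ EvenClifford.u m,
            (∃ hJ : Φ (EvenClifford.volEven he) ∈ EvenClifford.spinCentralizer Φ B,
              (θ ⟨Φ (EvenClifford.volEven he), hJ⟩ : Matrix (Fin m) (Fin m) ℂ) =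
                Complex.I • (1 : Matrix (Fin m) (Fin m) ℂ)) ∧
            EvenClifford.ComplexDecompTwo Φ B
              (fun A => EvenClifford.uStd (θ A)) (EvenClifford.halfSpinorAct he 1)
              (fun A => EvenClifford.uConj (θ A)) (EvenClifford.halfSpinorAct he (-1))) ∧
        (r % 8 = 4 →
          ∃ m₁ m₂ : ℕ, EvenClifford.BranchesTwo he Φ m₁ m₂ ∧
          ∃ θ : EvenClifford.spinCentralizer Φ B ≃ₗ⁅ℝ⁆
              (EvenClifford.sp m₁ × EvenClifford.sp m₂),
            EvenClifford.ComplexDecompTwo Φ B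
              (fun A => EvenClifford.spStd (θ A).2) (EvenClifford.halfSpinorAct he 1)
              (fun A => EvenClifford.spStd (θ A).1) (EvenClifford.halfSpinorAct he (-1))) ∧
        (r % 8 = 6 →
          ∃ m : ℕ, EvenClifford.Branches Φ m ∧
          ∃ θ : EvenClifford.spinCentralizer Φ B ≃ₗ⁅ℝ⁆ EvenClifford.u m,
            (∃ hJ : Φ (EvenClifford.volEven he) ∈ EvenClifford.spinCentralizer Φ B,
              (θ ⟨Φ (EvenClifford.volEven he), hJ⟩ : Matrix (Fin m) (Fin m) ℂ) =
                Complex.I • (1 : Matrix (Fin m) (Fin m) ℂ)) ∧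
            EvenClifford.ComplexDecompTwo Φ B
              (fun A => EvenClifford.uConj (θ A)) (EvenClifford.halfSpinorAct he 1)
              (fun A => EvenClifford.uStd (θ A)) (EvenClifford.halfSpinorAct he (-1)))) := by
  have h1 := EvenClifford.map_one_of_noTrivialSummand hΦ
  refine ⟨?_, fun B hB => ⟨fun h => ?_, fun h => ?_, fun he =>
    ⟨fun h => ?_, fun h => ?_, fun h => ?_, fun h => ?_⟩⟩⟩
  · obtain ⟨B, hB⟩ := EvenClifford.exists_invariantInner (EvenClifford.unitalRep Φ h1)
    exact ⟨B, hB.symm, hB.pos, hB.skew⟩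
  · refine EvenClifford.exists_decomp_real (Nat.odd_iff.2 (by omega)) h1 hB (by omega) ?_
    rw [EvenClifford.dimIrr, if_neg (by omega), if_neg (by omega)]
  · refine EvenClifford.exists_decomp_quaternionic (Nat.odd_iff.2 (by omega)) h1 hB (by omega) ?_
    rw [EvenClifford.dimIrr, if_neg (by omega), if_pos h]
  · refine EvenClifford.exists_decomp_two_real he hr h1 hB (by omega) ?_
    rw [EvenClifford.dimIrr, if_pos h]
  -- For r ≡ 2, i^{r/2} = i, so the volume element acts by i on Δ_r^+.
  · refine EvenClifford.exists_decomp_complex he hr h1 hB (ε := 1) (one_mul 1) (star_one _) rfl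
      ?_ (Nat.odd_iff.2 (by omega)) ?_
    · rw [← Nat.div_add_mod (r / 2) 4, show r / 2 % 4 = 1 by omega, pow_add, pow_mul,
        Complex.I_pow_four, one_pow, one_mul, pow_one, mul_one]
    · rw [EvenClifford.dimIrr, if_neg (by omega), if_neg (by omega)]
  · refine EvenClifford.exists_decomp_two_quaternionic he hr h1 hB (by omega) ?_
    rw [EvenClifford.dimIrr, if_neg (by omega), if_neg (by omega)]
  -- For r ≡ 6, i^{r/2} = -i, so the volume element acts by i on Δ_r^-, and the two factors are
  -- exchanged at the end.
  · obtain ⟨m, hm, θ, hθ, hF⟩ := EvenClifford.exists_decomp_complex he hr h1 hB (ε := -1)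
      (ε' := 1) (by norm_num) (by rw [star_neg, star_one]) (neg_neg 1)
      (by
        rw [← Nat.div_add_mod (r / 2) 4, show r / 2 % 4 = 3 by omega, pow_add, pow_mul,
          Complex.I_pow_four, one_pow, one_mul, Complex.I_pow_three]
        ring)
      (Nat.odd_iff.2 (by omega))
      (by rw [EvenClifford.dimIrr, if_neg (by omega), if_neg (by omega)])
    exact ⟨m, hm, θ, hθ, hF.swap⟩
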